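/- For a finite quiver $Q$ (loops and multiple arrows allowed), an $\mathbb{F}_1$-representation assigns to every vertex a finite pointed set and to every arrow a pointed map that is injective outside the preimage of the base point; it is nilpotent if all sufficiently long paths act by the zero map. Let $H_{Q,\mathrm{nil}}$ be the Hall algebra of nilpotent $\mathbb{F}_1$-representations of $Q$: it consists of the finitely supported complex functions on the set of isomorphism classes, with product $$[M]\cdot[N]=\sum_{[R]}\bigl|\{L\le R : L\cong N,\ R/L\cong M\}\bigr|\,[R]$$ and coproduct $\Delta(f)([M],[N])=f([M\oplus N])$. Let $\mathfrak{n}_Q$ be the Lie algebra of primitive elements of $H_{Q,\mathrm{nil}}$, with the commutator bracket. (1) Let $T$ be a finite tree and let $Q$, $Q'$ be two orientations of $T$. For a nonempty connected subgraph $S$ of $T$ let $[S]_Q$ be the class of the thin representation of $Q$ supported on $S$ (one nonzero element at every vertex of $S$, every arrow over an edge of $S$ acting by the nonzero map). The elements $[S]_Q$ form a basis of $\mathfrak{n}_Q$, the elements $[S]_{Q'}$ form a basis of $\mathfrak{n}_{Q'}$, and $$[S]_Q\longmapsto(-1)^{r(S)}[S]_{Q'}$$ defines an isomorphism of Lie algebras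 $\mathfrak{n}_Q\cong\mathfrak{n}_{Q'}$, where $r(S)$ is the number of edges of $S$ to which $Q$ and $Q'$ give opposite directions. (2) Let $n\ge 1$ and let $Q$ be a quiver of type $\tilde{\mathbb{A}}_n$, that is, an orientation of a cycle with $n$ vertices and $n$ edges (a loop if $n=1$, a double edge if $n=2$). If $Q$ is equioriented (all arrows go around the cycle in the same direction), put $Z_Q=0$. Otherwise, for $d\ge1$ let $\tilde I_d$ be the band representation whose coefficient quiver is the $d$-fold cyclic covering of $Q$; it is nilpotent and $[\tilde I_d]\in\mathfrak{n}_Q$, and we let $Z_Q$ be the span of $\{[\tilde I_d] : d\ge 1\}$. Then $Z_Q$ is a central ideal of $\mathfrak{n}_Q$, and $\mathfrak{n}_Q/Z_Q\cong\mathfrak{a}_+$ as Lie algebras, where $\mathfrak{a}_+=t\,\mathfrak{gl}_n(\mathbb{C})[t]\oplus N_+$ is the positive part of the affine Lie algebra $\hat{\mathfrak{gl}}_n=\mathfrak{gl}_n(\mathbb{C})[t,t^{-1}]\oplus\mathbb{C}c$, with $c$ central, $[x\otimes t^p,y\otimes t^q]=[x,y]\otimes t^{p+q}+\operatorname{tr}(xy)\,q\,\delta_{q,-p}\,c$,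 and $N_+$ the strictly upper triangular matrices. (3) In the situation of (2), if $Q'$ is an equioriented quiver of type $\tilde{\mathbb{A}}_n$, then there is a surjective homomorphism of Lie algebras $\mathfrak{n}_Q\to\mathfrak{n}_{Q'}$ with kernel $Z_Q$; so $\mathfrak{n}_Q$ is a central extension of $\mathfrak{n}_{Q'}$. -/

import Mathlib

/-! ## Quivers, representations over the field with one element -/

/-- A quiver `(V, E, s, t)`; loops and parallel arrows are allowed. -/
structure FQuiver (V E : Type) where
  src : E → V
  tgt : E → V

namespace FQuiver

variable {V E : Type}

/-- The pair of end points of an arrow, i.e. the edge of the underlying undirected graph. -/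
def ends (Q : FQuiver V E) (e : E) : Sym2 V := s(Q.src e, Q.tgt e)

/-- Oriented paths of given length, from one vertex to another. -/
inductive Path (Q : FQuiver V E) : V → V → ℕ → Type
  | nil (v : V) : Path Q v v 0
  | cons {u : V} {k : ℕ} (e : E) (p : Path Q u (Q.src e) k) : Path Q u (Q.tgt e) (k + 1)

end FQuiver

/-- A representation of `Q` over the field with one element: a finite pointed set at every vertex,
and for every arrow a pointed map that is injective off the preimage of the base point. -/
structure F1Rep {V E : Type} (Q : FQuiver V E) where
  X : V → Type
  zero : ∀ v, X v
  finite : ∀ v, Finite (X v)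
  map : ∀ e, X (Q.src e) → X (Q.tgt e)
  map_zero : ∀ e, map e (zero _) = zero _
  map_inj : ∀ e x y, map e x = map e y → map e x ≠ zero _ → x = y

namespace F1Rep

variable {V E : Type} {Q : FQuiver V E}

/-- The composite map along a path. -/
def act (M : F1Rep Q) {u w : V} {k : ℕ} : Q.Path u w k → M.X u → M.X w
  | .nil _, x => x
  | .cons e p, x => M.map e (M.act p x)

/-- Nilpotent representations: all sufficiently long paths act by zero. -/
def IsNilpotent (M : F1Rep Q) : Prop :=
  ∃ N : ℕ, ∀ k ≥ N, ∀ (u w : V) (p : Q.Path u w k) (x : M.X u), M.act p x = M.zero w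

/-- Morphisms of representations. -/
structure Hom (M N : F1Rep Q) where
  app : ∀ v, M.X v → N.X v
  app_zero : ∀ v, app v (M.zero v) = N.zero v
  app_inj : ∀ v x y, app v x = app v y → app v x ≠ N.zero v → x = y
  comm : ∀ e x, app _ (M.map e x) = N.map e (app _ x)

theorem Hom.app_act {M N : F1Rep Q} (f : Hom M N) {u w : V} {k : ℕ} (p : Q.Path u w k)
    (x : M.X u) : f.app w (M.act p x) = N.act p (f.app u x) := by
  induction p with
  | nil => rfl
  | cons e p ih => simp only [act]; rw [f.comm, ih]

/-- Isomorphisms of representations: pointed bijections commuting with the arrows. -/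
structure Iso (M N : F1Rep Q) where
  app : ∀ v, M.X v ≃ N.X v
  app_zero : ∀ v, app v (M.zero v) = N.zero v
  comm : ∀ e x, app _ (M.map e x) = N.map e (app _ x)

namespace Hom

def id (M : F1Rep Q) : Hom M M := ⟨fun _ x => x, fun _ => rfl, fun _ _ _ h _ => h, fun _ _ => rfl⟩

def comp {M N P : F1Rep Q} (g : Hom N P) (f : Hom M N) : Hom M P where
  app v x := g.app v (f.app v x)
  app_zero v := by rw [f.app_zero, g.app_zero]
  app_inj v x y h h0 := by
    have h1 := g.app_inj v _ _ h h0
    refine f.app_inj v _ _ h1 fun h2 => h0 ?_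
    rw [h2, g.app_zero]
  comm e x := by rw [f.comm, g.comm]

end Hom

namespace Iso

def refl (M : F1Rep Q) : Iso M M := ⟨fun _ => Equiv.refl _, fun _ => rfl, fun _ _ => rfl⟩

def symm {M N : F1Rep Q} (f : Iso M N) : Iso N M where
  app v := (f.app v).symm
  app_zero v := by rw [Equiv.symm_apply_eq, f.app_zero]
  comm e x := by rw [Equiv.symm_apply_eq, f.comm, Equiv.apply_symm_apply]

def trans {M N P : F1Rep Q} (f : Iso M N) (g : Iso N P) : Iso M P where
  app v := (f.app v).trans (g.app v)
  app_zero v := by rw [Equiv.trans_apply, f.app_zero, g.app_zero]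
  comm e x := by simp only [Equiv.trans_apply]; rw [f.comm, g.comm]

def toHom {M N : F1Rep Q} (f : Iso M N) : Hom M N where
  app v := f.app v
  app_zero := f.app_zero
  app_inj v _ _ h _ := (f.app v).injective h
  comm := f.comm

end Iso

/-- A subrepresentation: a pointed subset at every vertex, stable under the arrows. -/
@[ext] structure Sub (M : F1Rep Q) where
  carrier : ∀ v, Set (M.X v)
  zero_mem : ∀ v, M.zero v ∈ carrier v
  map_mem : ∀ e x, x ∈ carrier _ → M.map e x ∈ carrier _

namespace Sub

variable {M : F1Rep Q}

/-- A subrepresentation as a representation. -/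
def toRep (L : Sub M) : F1Rep Q where
  X v := {x : M.X v // x ∈ L.carrier v}
  zero v := ⟨M.zero v, L.zero_mem v⟩
  finite v := by have := M.finite v; infer_instance
  map e x := ⟨M.map e x.1, L.map_mem e x.1 x.2⟩
  map_zero e := by simp [M.map_zero]
  map_inj e x y h h0 := by
    apply Subtype.ext
    apply M.map_inj e x.1 y.1 (congrArg Subtype.val h)
    intro h1; exact h0 (Subtype.ext h1)

open Classical in
/-- Collapsing `L` to the base point. -/
noncomputable def collapse (L : Sub M) (v : V) (x : M.X v) : M.X v :=
  if x ∈ L.carrier v then M.zero v else x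

theorem collapse_of_mem {L : Sub M} {v : V} {x : M.X v} (h : x ∈ L.carrier v) :
    L.collapse v x = M.zero v := if_pos h

theorem collapse_of_notMem {L : Sub M} {v : V} {x : M.X v} (h : x ∉ L.carrier v) :
    L.collapse v x = x := if_neg h

theorem collapse_mem (L : Sub M) (v : V) (x : M.X v) (h : L.collapse v x ∈ L.carrier v) :
    L.collapse v x = M.zero v := by
  by_cases hx : x ∈ L.carrier v
  · exact collapse_of_mem hx
  · rw [collapse_of_notMem hx] at h; exact absurd h hx

theorem collapse_inj {L : Sub M} {v : V} {x y : M.X v} (h : L.collapse v x = L.collapse v y)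
    (h0 : L.collapse v x ≠ M.zero v) : x = y := by
  by_cases hx : x ∈ L.carrier v
  · exact absurd (collapse_of_mem hx) h0
  · by_cases hy : y ∈ L.carrier v
    · rw [h] at h0; exact absurd (collapse_of_mem hy) h0
    · rwa [collapse_of_notMem hx, collapse_of_notMem hy] at h

/-- The quotient representation `M / L`: its elements are the base point and the elements of `M`
outside `L`; elements that are sent into `L` are sent to the base point. -/
noncomputable def quot (L : Sub M) : F1Rep Q where
  X v := {x : M.X v // x ∈ L.carrier v → x = M.zero v}
  zero v := ⟨M.zero v, fun _ => rfl⟩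
  finite v := by have := M.finite v; infer_instance
  map e x := ⟨L.collapse _ (M.map e x.1), L.collapse_mem _ _⟩
  map_zero e := Subtype.ext (collapse_of_mem (by rw [M.map_zero]; exact L.zero_mem _))
  map_inj e x y h h0 := by
    have h1 : M.map e x.1 = M.map e y.1 :=
      collapse_inj (congrArg Subtype.val h) fun h' => h0 (Subtype.ext h')
    refine Subtype.ext (M.map_inj e _ _ h1 fun h' => h0 (Subtype.ext ?_))
    exact collapse_of_mem (by rw [h']; exact L.zero_mem _)

/-- The inclusion of a subrepresentation. -/
def incl (L : Sub M) : Hom L.toRep M where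
  app _ x := x.1
  app_zero _ := rfl
  app_inj _ _ _ h _ := Subtype.ext h
  comm _ _ := rfl

/-- The projection to a quotient. -/
noncomputable def proj (L : Sub M) : Hom M L.quot where
  app v x := ⟨L.collapse v x, L.collapse_mem v x⟩
  app_zero v := Subtype.ext (collapse_of_mem (L.zero_mem v))
  app_inj _ _ _ h h0 :=
    collapse_inj (congrArg Subtype.val h) fun h' => h0 (Subtype.ext h')
  comm e x := by
    apply Subtype.ext
    change L.collapse _ (M.map e x) = L.collapse _ (M.map e (L.collapse _ x))
    by_cases hx : x ∈ L.carrier _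
    · rw [collapse_of_mem (L.map_mem e x hx), collapse_of_mem hx, M.map_zero,
        collapse_of_mem (L.zero_mem _)]
    · rw [collapse_of_notMem hx]

theorem proj_surj (L : Sub M) (v : V) : Function.Surjective (L.proj.app v) := by
  rintro ⟨x, hx⟩
  refine ⟨x, Subtype.ext ?_⟩
  change L.collapse v x = x
  by_cases h : x ∈ L.carrier v
  · rw [collapse_of_mem h, hx h]
  · rw [collapse_of_notMem h]

theorem proj_eq_zero (L : Sub M) (v : V) (x : M.X v) :
    L.proj.app v x = L.quot.zero v ↔ x ∈ L.carrier v := by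
  constructor
  · intro h
    by_contra hx
    have h1 : L.collapse v x = M.zero v := congrArg Subtype.val h
    rw [collapse_of_notMem hx] at h1
    exact hx (h1 ▸ L.zero_mem v)
  · intro h; exact Subtype.ext (collapse_of_mem h)

end Sub

/-- The zero representation. -/
def zeroRep (Q : FQuiver V E) : F1Rep Q where
  X _ := Unit
  zero _ := ()
  finite _ := inferInstance
  map _ _ := ()
  map_zero _ := rfl
  map_inj _ _ _ _ _ := rfl

/-- The direct sum: at every vertex the two pointed sets are glued at their base points, written
as the set of pairs one entry of which is the base point. -/
def dsum (M N : F1Rep Q) : F1Rep Q where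
  X v := {p : M.X v × N.X v // p.1 = M.zero v ∨ p.2 = N.zero v}
  zero v := ⟨(M.zero v, N.zero v), Or.inl rfl⟩
  finite v := by have := M.finite v; have := N.finite v; infer_instance
  map e p := ⟨(M.map e p.1.1, N.map e p.1.2), by
    rcases p.2 with h | h
    · left; rw [h, M.map_zero]
    · right; rw [h, N.map_zero]⟩
  map_zero e := by simp [M.map_zero, N.map_zero]
  map_inj e := by
    rintro ⟨⟨a, b⟩, h⟩ ⟨⟨c, d⟩, h'⟩ h1 h2
    simp only [Subtype.mk.injEq, Prod.mk.injEq, ne_eq] at h1 h2 h h' ⊢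
    by_cases ha : M.map e a = M.zero _
    · have hb : N.map e b ≠ N.zero _ := fun hb => h2 ⟨ha, hb⟩
      have hbd := N.map_inj e _ _ h1.2 hb
      have hb0 : b ≠ N.zero _ := by rintro rfl; exact hb (N.map_zero e)
      exact ⟨(h.resolve_right hb0).trans (h'.resolve_right (hbd ▸ hb0)).symm, hbd⟩
    · have hac := M.map_inj e _ _ h1.1 ha
      have ha0 : a ≠ M.zero _ := by rintro rfl; exact ha (M.map_zero e)
      exact ⟨hac, (h.resolve_left ha0).trans (h'.resolve_left (hac ▸ ha0)).symm⟩


/-! ### Comparison of subobjects and quotients -/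

theorem iso_of_bijective {M N : F1Rep Q} (f : Hom M N)
    (h : ∀ v, Function.Bijective (f.app v)) : Nonempty (Iso M N) :=
  ⟨⟨fun v => Equiv.ofBijective _ (h v), f.app_zero, f.comm⟩⟩

theorem iso_toRep_of {M N : F1Rep Q} (L : Sub M) (f : Hom N M)
    (hf : ∀ v, Function.Injective (f.app v))
    (hr : ∀ v x, x ∈ L.carrier v ↔ ∃ y, f.app v y = x) : Nonempty (Iso N L.toRep) := by
  refine iso_of_bijective (N := L.toRep)
    ⟨fun v y => ⟨f.app v y, (hr v _).2 ⟨y, rfl⟩⟩, fun v => Subtype.ext (f.app_zero v),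
      fun v x y h _ => hf v (congrArg Subtype.val h), fun e x => Subtype.ext (f.comm e x)⟩ ?_
  intro v
  refine ⟨fun x y h => hf v (congrArg Subtype.val h), ?_⟩
  rintro ⟨x, hx⟩
  obtain ⟨y, rfl⟩ := (hr v x).1 hx
  exact ⟨y, rfl⟩

theorem iso_quot_of {M N : F1Rep Q} (L : Sub M) (f : Hom M N)
    (hf : ∀ v, Function.Surjective (f.app v))
    (hk : ∀ v x, f.app v x = N.zero v ↔ x ∈ L.carrier v) : Nonempty (Iso L.quot N) := by
  have key : ∀ v x, f.app v (L.collapse v x) = f.app v x := by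
    intro v x
    by_cases hx : x ∈ L.carrier v
    · rw [Sub.collapse_of_mem hx, f.app_zero, (hk v x).2 hx]
    · rw [Sub.collapse_of_notMem hx]
  have inj : ∀ v (x y : L.quot.X v), f.app v x.1 = f.app v y.1 → x = y := by
    intro v x y h
    apply Subtype.ext
    by_cases h0 : f.app v x.1 = N.zero v
    · rw [x.2 ((hk v _).1 h0), y.2 ((hk v _).1 (h ▸ h0))]
    · exact f.app_inj v _ _ h h0
  refine iso_of_bijective (M := L.quot)
    ⟨fun v x => f.app v x.1, f.app_zero, fun v x y h _ => inj v x y h, fun e x => ?_⟩ ?_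
  · change f.app _ (L.collapse _ (M.map e x.1)) = _
    rw [key, f.comm]
  · intro v
    refine ⟨inj v, fun y => ?_⟩
    obtain ⟨x, rfl⟩ := hf v y
    exact ⟨⟨L.collapse v x, L.collapse_mem v x⟩, key v x⟩

theorem IsNilpotent.of_inj {M N : F1Rep Q} (f : Hom M N)
    (hf : ∀ v, Function.Injective (f.app v)) (h : N.IsNilpotent) : M.IsNilpotent := by
  obtain ⟨k, hk⟩ := h
  refine ⟨k, fun n hn u w p x => hf w ?_⟩
  rw [f.app_act, hk n hn, f.app_zero]

theorem IsNilpotent.of_surj {M N : F1Rep Q} (f : Hom M N)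
    (hf : ∀ v, Function.Surjective (f.app v)) (h : M.IsNilpotent) : N.IsNilpotent := by
  obtain ⟨k, hk⟩ := h
  refine ⟨k, fun n hn u w p y => ?_⟩
  obtain ⟨x, rfl⟩ := hf u y
  rw [← f.app_act, hk n hn, f.app_zero]

theorem IsNilpotent.toRep {M : F1Rep Q} (h : M.IsNilpotent) (L : Sub M) : L.toRep.IsNilpotent :=
  h.of_inj L.incl fun _ _ _ h => Subtype.ext h

theorem IsNilpotent.quot {M : F1Rep Q} (h : M.IsNilpotent) (L : Sub M) : L.quot.IsNilpotent :=
  h.of_surj L.proj L.proj_surj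

theorem isNilpotent_zeroRep : (zeroRep Q).IsNilpotent := ⟨0, fun _ _ _ _ _ _ => rfl⟩

theorem dsum_act {M N : F1Rep Q} {u w : V} {k : ℕ} (p : Q.Path u w k) (x : (dsum M N).X u) :
    ((dsum M N).act p x).1 = (M.act p x.1.1, N.act p x.1.2) := by
  induction p with
  | nil => rfl
  | cons e p ih =>
    change (M.map e ((dsum M N).act p x).1.1, N.map e ((dsum M N).act p x).1.2) = _
    rw [ih]; rfl

theorem IsNilpotent.dsum {M N : F1Rep Q} (hM : M.IsNilpotent) (hN : N.IsNilpotent) :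
    (dsum M N).IsNilpotent := by
  obtain ⟨k, hk⟩ := hM
  obtain ⟨l, hl⟩ := hN
  refine ⟨k + l, fun n hn u w p x => Subtype.ext ?_⟩
  rw [dsum_act, hk n (by omega), hl n (by omega)]
  rfl

/-- Direct sum of morphisms. -/
def Hom.dsum {M M' N N' : F1Rep Q} (f : Hom M M') (g : Hom N N') :
    Hom (dsum M N) (dsum M' N') where
  app v p := ⟨(f.app v p.1.1, g.app v p.1.2), by
    rcases p.2 with h | h
    · left; rw [h, f.app_zero]
    · right; rw [h, g.app_zero]⟩
  app_zero v := Subtype.ext (Prod.ext (f.app_zero v) (g.app_zero v))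
  app_inj v := by
    rintro ⟨⟨a, b⟩, h⟩ ⟨⟨c, d⟩, h'⟩ h1 h2
    have e1 : f.app v a = f.app v c := congrArg (fun z => z.1.1) h1
    have e2 : g.app v b = g.app v d := congrArg (fun z => z.1.2) h1
    refine Subtype.ext (Prod.ext ?_ ?_)
    · change a = c
      by_cases ha : f.app v a = M'.zero v
      · have hb : g.app v b ≠ N'.zero v := fun hb => h2 (Subtype.ext (Prod.ext ha hb))
        have hb0 : b ≠ N.zero v := by rintro rfl; exact hb (g.app_zero v)
        have hbd := g.app_inj v _ _ e2 hb
        exact (h.resolve_right hb0).trans (h'.resolve_right (hbd ▸ hb0)).symm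
      · exact f.app_inj v _ _ e1 ha
    · change b = d
      by_cases hb : g.app v b = N'.zero v
      · have ha : f.app v a ≠ M'.zero v := fun ha => h2 (Subtype.ext (Prod.ext ha hb))
        have ha0 : a ≠ M.zero v := by rintro rfl; exact ha (f.app_zero v)
        have hac := f.app_inj v _ _ e1 ha
        exact (h.resolve_left ha0).trans (h'.resolve_left (hac ▸ ha0)).symm
      · exact g.app_inj v _ _ e2 hb
  comm e p := Subtype.ext (Prod.ext (f.comm e p.1.1) (g.comm e p.1.2))

theorem Hom.dsum_injective {M M' N N' : F1Rep Q} (f : Hom M M') (g : Hom N N')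
    (hf : ∀ v, Function.Injective (f.app v)) (hg : ∀ v, Function.Injective (g.app v)) (v : V) :
    Function.Injective ((Hom.dsum f g).app v) := fun _ _ h =>
  Subtype.ext (Prod.ext (hf v (congrArg (fun z => z.1.1) h)) (hg v (congrArg (fun z => z.1.2) h)))

theorem Hom.dsum_surjective {M M' N N' : F1Rep Q} (f : Hom M M') (g : Hom N N')
    (hf : ∀ v, Function.Surjective (f.app v)) (hg : ∀ v, Function.Surjective (g.app v)) (v : V) :
    Function.Surjective ((Hom.dsum f g).app v) := by
  rintro ⟨⟨a, b⟩, h | h⟩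
  · obtain ⟨y, rfl⟩ := hg v b
    refine ⟨⟨(M.zero v, y), Or.inl rfl⟩, Subtype.ext (Prod.ext ?_ rfl)⟩
    exact (f.app_zero v).trans h.symm
  · obtain ⟨y, rfl⟩ := hf v a
    refine ⟨⟨(y, N.zero v), Or.inr rfl⟩, Subtype.ext (Prod.ext rfl ?_)⟩
    exact (g.app_zero v).trans h.symm

/-- The first summand of a direct sum. -/
def Hom.inl (M N : F1Rep Q) : Hom M (F1Rep.dsum M N) where
  app v x := ⟨(x, N.zero v), Or.inr rfl⟩
  app_zero _ := rfl
  app_inj _ _ _ h _ := congrArg (fun z => z.1.1) h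
  comm e _ := Subtype.ext (Prod.ext rfl (N.map_zero e).symm)

/-- The second summand of a direct sum. -/
def Hom.inr (M N : F1Rep Q) : Hom N (F1Rep.dsum M N) where
  app v x := ⟨(M.zero v, x), Or.inl rfl⟩
  app_zero _ := rfl
  app_inj _ _ _ h _ := congrArg (fun z => z.1.2) h
  comm e _ := Subtype.ext (Prod.ext (M.map_zero e).symm rfl)

theorem iso_dsum {M M' N N' : F1Rep Q} (f : Iso M M') (g : Iso N N') :
    Nonempty (Iso (F1Rep.dsum M N) (F1Rep.dsum M' N')) :=
  iso_of_bijective (Hom.dsum f.toHom g.toHom) fun v =>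
    ⟨Hom.dsum_injective _ _ (fun v => (f.app v).injective) (fun v => (g.app v).injective) v,
      Hom.dsum_surjective _ _ (fun v => (f.app v).surjective) (fun v => (g.app v).surjective) v⟩

namespace Sub

instance finite [Finite V] (M : F1Rep Q) : Finite (Sub M) := by
  have := M.finite
  exact Finite.of_injective (fun L : Sub M => L.carrier) fun L L' h => Sub.ext h

noncomputable instance fintype [Finite V] (M : F1Rep Q) : Fintype (Sub M) := Fintype.ofFinite _

/-- Preimage of a subrepresentation. -/
def comap {M N : F1Rep Q} (f : Hom M N) (L : Sub N) : Sub M where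
  carrier v := {x | f.app v x ∈ L.carrier v}
  zero_mem v := by rw [Set.mem_ofPred_eq, f.app_zero]; exact L.zero_mem v
  map_mem e x hx := by rw [Set.mem_ofPred_eq, f.comm]; exact L.map_mem e _ hx

/-- Image of a subrepresentation. -/
def image {M N : F1Rep Q} (f : Hom M N) (L : Sub M) : Sub N where
  carrier v := {y | ∃ x ∈ L.carrier v, f.app v x = y}
  zero_mem v := ⟨M.zero v, L.zero_mem v, f.app_zero v⟩
  map_mem := by
    rintro e _ ⟨x, hx, rfl⟩
    exact ⟨M.map e x, L.map_mem e x hx, f.comm e x⟩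

/-- Direct sum of subrepresentations. -/
def dsum {M N : F1Rep Q} (L : Sub M) (K : Sub N) : Sub (F1Rep.dsum M N) where
  carrier v := {p | p.1.1 ∈ L.carrier v ∧ p.1.2 ∈ K.carrier v}
  zero_mem v := ⟨L.zero_mem v, K.zero_mem v⟩
  map_mem e _ hp := ⟨L.map_mem e _ hp.1, K.map_mem e _ hp.2⟩

/-- The zero subrepresentation. -/
def bot (M : F1Rep Q) : Sub M where
  carrier v := {M.zero v}
  zero_mem _ := rfl
  map_mem e x hx := by rw [Set.mem_singleton_iff.1 hx, M.map_zero]; rfl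

/-- The whole representation. -/
def top (M : F1Rep Q) : Sub M where
  carrier _ := Set.univ
  zero_mem _ := trivial
  map_mem _ _ _ := trivial

/-- Isomorphic representations have the same subrepresentations. -/
def equivOfIso {M N : F1Rep Q} (f : Iso M N) : Sub M ≃ Sub N where
  toFun := comap f.symm.toHom
  invFun := comap f.toHom
  left_inv L := by
    ext v x
    change (f.app v).symm (f.app v x) ∈ L.carrier v ↔ _
    rw [Equiv.symm_apply_apply]
  right_inv L := by
    ext v x
    change f.app v ((f.app v).symm x) ∈ L.carrier v ↔ _
    rw [Equiv.apply_symm_apply]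

theorem iso_toRep_equivOfIso {M N : F1Rep Q} (f : Iso M N) (L : Sub M) :
    Nonempty (Iso L.toRep (equivOfIso f L).toRep) := by
  refine iso_toRep_of _ (f.toHom.comp L.incl)
    (fun v x y h => Subtype.ext ((f.app v).injective h)) fun v x => ?_
  change (f.app v).symm x ∈ L.carrier v ↔ _
  constructor
  · intro h; exact ⟨⟨_, h⟩, (f.app v).apply_symm_apply x⟩
  · rintro ⟨y, rfl⟩
    change (f.app v).symm (f.app v y.1) ∈ L.carrier v
    rw [Equiv.symm_apply_apply]; exact y.2

theorem iso_quot_equivOfIso {M N : F1Rep Q} (f : Iso M N) (L : Sub M) :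
    Nonempty (Iso L.quot (equivOfIso f L).quot) := by
  refine iso_quot_of _ ((equivOfIso f L).proj.comp f.toHom)
    (fun v => ((equivOfIso f L).proj_surj v).comp (f.app v).surjective) fun v x => ?_
  refine ((equivOfIso f L).proj_eq_zero v _).trans ?_
  change (f.app v).symm (f.app v x) ∈ L.carrier v ↔ _
  rw [Equiv.symm_apply_apply]

/-- Subrepresentations of a direct sum. -/
def dsumEquiv (M N : F1Rep Q) : Sub M × Sub N ≃ Sub (F1Rep.dsum M N) where
  toFun p := dsum p.1 p.2
  invFun L := (comap (Hom.inl M N) L, comap (Hom.inr M N) L)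
  left_inv p := by
    refine Prod.ext (Sub.ext ?_) (Sub.ext ?_)
    · funext v; ext x
      exact ⟨fun h => h.1, fun h => ⟨h, p.2.zero_mem v⟩⟩
    · funext v; ext x
      exact ⟨fun h => h.2, fun h => ⟨p.1.zero_mem v, h⟩⟩
  right_inv L := by
    refine Sub.ext ?_
    funext v; ext ⟨⟨a, b⟩, h⟩
    rcases h with h | h
    · change a = _ at h
      subst h
      exact ⟨fun h => h.2, fun h => ⟨L.zero_mem v, h⟩⟩
    · change b = _ at h
      subst h
      exact ⟨fun h => h.1, fun h => ⟨h, L.zero_mem v⟩⟩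

theorem iso_toRep_dsum {M N : F1Rep Q} (L : Sub M) (K : Sub N) :
    Nonempty (Iso (F1Rep.dsum L.toRep K.toRep) (dsum L K).toRep) := by
  refine iso_toRep_of _ (Hom.dsum L.incl K.incl)
    (Hom.dsum_injective _ _ (fun _ _ _ h => Subtype.ext h) (fun _ _ _ h => Subtype.ext h))
    fun v x => ⟨fun h => ?_, ?_⟩
  · refine ⟨⟨(⟨x.1.1, h.1⟩, ⟨x.1.2, h.2⟩), ?_⟩, rfl⟩
    rcases x.2 with h | h
    · left; exact Subtype.ext h
    · right; exact Subtype.ext h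
  · rintro ⟨y, rfl⟩
    exact ⟨y.1.1.2, y.1.2.2⟩

theorem iso_quot_dsum {M N : F1Rep Q} (L : Sub M) (K : Sub N) :
    Nonempty (Iso (dsum L K).quot (F1Rep.dsum L.quot K.quot)) := by
  refine iso_quot_of _ (Hom.dsum L.proj K.proj)
    (Hom.dsum_surjective _ _ L.proj_surj K.proj_surj) fun v x => ?_
  refine ⟨fun h => ⟨(L.proj_eq_zero v _).1 (congrArg (fun z => z.1.1) h),
    (K.proj_eq_zero v _).1 (congrArg (fun z => z.1.2) h)⟩, fun h => Subtype.ext (Prod.ext ?_ ?_)⟩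
  · exact (L.proj_eq_zero v _).2 h.1
  · exact (K.proj_eq_zero v _).2 h.2

/-- Two-step filtrations, read in two ways. -/
noncomputable def flagEquiv (M : F1Rep Q) :
    (Σ A : Sub M, Sub A.quot) ≃ (Σ B : Sub M, Sub B.toRep) where
  toFun p := ⟨comap p.1.proj p.2, comap (incl _) p.1⟩
  invFun p := ⟨image p.1.incl p.2, image (proj _) p.1⟩
  left_inv := by
    rintro ⟨A, C⟩
    have hA : image (comap A.proj C).incl (comap (comap A.proj C).incl A) = A := by
      ext v x
      constructor
      · rintro ⟨y, hy, rfl⟩; exact hy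
      · intro hx
        refine ⟨⟨x, ?_⟩, hx, rfl⟩
        change A.proj.app v x ∈ C.carrier v
        rw [(A.proj_eq_zero v x).2 hx]; exact C.zero_mem v
    have hC : image A.proj (comap A.proj C) = C := by
      ext v x
      constructor
      · rintro ⟨y, hy, rfl⟩; exact hy
      · intro hx
        obtain ⟨y, rfl⟩ := A.proj_surj v x
        exact ⟨y, hx, rfl⟩
    refine Sigma.ext hA ?_
    change HEq (image (image (comap A.proj C).incl (comap (comap A.proj C).incl A)).proj
      (comap A.proj C)) C
    rw [hA, hC]
  right_inv := by
    rintro ⟨B, D⟩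
    have hB : comap (image B.incl D).proj (image (image B.incl D).proj B) = B := by
      ext v x
      constructor
      · rintro ⟨y, hy, h⟩
        by_cases h0 : (image B.incl D).proj.app v x = (image B.incl D).quot.zero v
        · obtain ⟨z, _, rfl⟩ := ((image B.incl D).proj_eq_zero v x).1 h0
          exact z.2
        · have := (image B.incl D).proj.app_inj v _ _ h (h ▸ h0)
          exact this ▸ hy
      · intro hx; exact ⟨x, hx, rfl⟩
    have hD : comap B.incl (image B.incl D) = D := by
      ext v x
      constructor
      · rintro ⟨y, hy, h⟩
        have : y = x := Subtype.ext h
        exact this ▸ hy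
      · intro hx; exact ⟨x, hx, rfl⟩
    refine Sigma.ext hB ?_
    change HEq (comap (comap (image B.incl D).proj (image (image B.incl D).proj B)).incl
      (image B.incl D)) D
    rw [hB, hD]

theorem iso_flag_top {M : F1Rep Q} (A : Sub M) (C : Sub A.quot) :
    Nonempty (Iso (comap A.proj C).quot C.quot) :=
  iso_quot_of _ (C.proj.comp A.proj) (fun v => (C.proj_surj v).comp (A.proj_surj v))
    fun v x => C.proj_eq_zero v (A.proj.app v x)

theorem iso_flag_mid {M : F1Rep Q} (A : Sub M) (C : Sub A.quot) :
    Nonempty (Iso (comap (comap A.proj C).incl A).quot C.toRep) := by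
  refine iso_quot_of (N := C.toRep) _
    ⟨fun v x => ⟨A.proj.app v x.1, x.2⟩, fun v => Subtype.ext (A.proj.app_zero v),
      fun v x y h h0 => Subtype.ext (A.proj.app_inj v _ _ (congrArg Subtype.val h)
        fun h' => h0 (Subtype.ext h')), fun e x => Subtype.ext (A.proj.comm e x.1)⟩ ?_ ?_
  · rintro v ⟨y, hy⟩
    obtain ⟨x, rfl⟩ := A.proj_surj v y
    exact ⟨⟨x, hy⟩, rfl⟩
  · intro v x
    exact Subtype.ext_iff.trans (A.proj_eq_zero v x.1)

theorem iso_flag_bot {M : F1Rep Q} (A : Sub M) (C : Sub A.quot) :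
    Nonempty (Iso (comap (comap A.proj C).incl A).toRep A.toRep) := by
  refine iso_toRep_of A ((comap A.proj C).incl.comp (incl _))
    (fun v x y h => Subtype.ext (Subtype.ext h)) fun v x => ⟨fun hx => ?_, ?_⟩
  · refine ⟨⟨⟨x, ?_⟩, hx⟩, rfl⟩
    change A.proj.app v x ∈ C.carrier v
    rw [(A.proj_eq_zero v x).2 hx]; exact C.zero_mem v
  · rintro ⟨y, rfl⟩; exact y.2

theorem iso_toRep_top (M : F1Rep Q) : Nonempty (Iso M (top M).toRep) :=
  iso_toRep_of _ (Hom.id M) (fun _ _ _ h => h) fun _ x => ⟨fun _ => ⟨x, rfl⟩, fun _ => trivial⟩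

theorem iso_quot_bot (M : F1Rep Q) : Nonempty (Iso (bot M).quot M) :=
  iso_quot_of _ (Hom.id M) (fun _ x => ⟨x, rfl⟩) fun _ _ => Iff.rfl

theorem iso_zero_toRep_iff {M : F1Rep Q} (L : Sub M) :
    Nonempty (Iso L.toRep (zeroRep Q)) ↔ L = bot M := by
  constructor
  · rintro ⟨f⟩
    ext v x
    constructor
    · intro hx
      exact congrArg Subtype.val ((f.app v).injective (a₁ := ⟨x, hx⟩) (a₂ := L.toRep.zero v) rfl)
    · intro hx
      rw [Set.mem_singleton_iff.1 hx]; exact L.zero_mem v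
  · rintro rfl
    refine iso_of_bijective ⟨fun _ _ => (), fun _ => rfl, fun _ _ _ _ h => absurd rfl h,
      fun _ _ => rfl⟩ fun v => ⟨?_, fun _ => ⟨(bot M).toRep.zero v, rfl⟩⟩
    rintro ⟨x, hx⟩ ⟨y, hy⟩ _
    exact Subtype.ext ((Set.mem_singleton_iff.1 hx).trans (Set.mem_singleton_iff.1 hy).symm)

theorem iso_zero_quot_iff {M : F1Rep Q} (L : Sub M) :
    Nonempty (Iso L.quot (zeroRep Q)) ↔ L = top M := by
  constructor
  · rintro ⟨f⟩
    ext v x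
    refine ⟨fun _ => trivial, fun _ => ?_⟩
    exact (L.proj_eq_zero v x).1 ((f.app v).injective rfl)
  · rintro rfl
    exact iso_quot_of _ ⟨fun _ _ => (), fun _ => rfl, fun _ _ _ _ h => absurd rfl h,
      fun _ _ => rfl⟩ (fun v _ => ⟨M.zero v, rfl⟩) fun _ _ => ⟨fun _ => trivial, fun _ => rfl⟩

end Sub

end F1Rep

/-! ## The nilpotent Hall algebra -/

/-- The nilpotent representations of `Q`. -/
def NilRep {V E : Type} (Q : FQuiver V E) := {M : F1Rep Q // M.IsNilpotent}

instance NilRep.setoid {V E : Type} (Q : FQuiver V E) : Setoid (NilRep Q) where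
  r M N := Nonempty (F1Rep.Iso M.1 N.1)
  iseqv :=
    { refl := fun M => ⟨.refl M.1⟩
      symm := fun h => h.elim fun f => ⟨f.symm⟩
      trans := fun h h' => h.elim fun f => h'.elim fun g => ⟨f.trans g⟩ }

/-- Isomorphism classes of nilpotent representations. -/
def NilIso {V E : Type} (Q : FQuiver V E) := Quotient (NilRep.setoid Q)

namespace NilIso

open F1Rep

variable {V E : Type} {Q : FQuiver V E}

/-- The isomorphism class of a nilpotent representation. -/
def mk (M : F1Rep Q) (h : M.IsNilpotent) : NilIso Q := Quotient.mk _ ⟨M, h⟩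

theorem mk_eq_iff {M N : F1Rep Q} {hM : M.IsNilpotent} {hN : N.IsNilpotent} :
    mk M hM = mk N hN ↔ Nonempty (Iso M N) := Quotient.eq (r := NilRep.setoid Q)

theorem ind {p : NilIso Q → Prop} (h : ∀ M hM, p (mk M hM)) (x : NilIso Q) : p x :=
  Quotient.ind (fun M => h M.1 M.2) x

/-- The dimension vector, shifted by one: the cardinalities of the pointed sets. -/
noncomputable def dim (x : NilIso Q) : V → ℕ :=
  Quotient.lift (s := NilRep.setoid Q) (fun M : NilRep Q => fun v => Nat.card (M.1.X v))
    (fun _ _ h => h.elim fun f => funext fun v => Nat.card_congr (f.app v)) x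

/-- The class of the direct sum. -/
def dsum (x y : NilIso Q) : NilIso Q :=
  Quotient.lift₂ (s₁ := NilRep.setoid Q) (s₂ := NilRep.setoid Q) (fun M N : NilRep Q => mk (F1Rep.dsum M.1 N.1) (M.2.dsum N.2))
    (fun _ _ _ _ h h' => h.elim fun f => h'.elim fun g => mk_eq_iff.2 (iso_dsum f g)) x y

theorem dim_mk_toRep_quot {M : F1Rep Q} (h : M.IsNilpotent) (L : Sub M) :
    (mk M h).dim + 1 = (mk _ (h.toRep L)).dim + (mk _ (h.quot L)).dim := by
  classical
  funext v
  change Nat.card (M.X v) + 1 =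
    Nat.card {x : M.X v // x ∈ L.carrier v} +
      Nat.card {x : M.X v // x ∈ L.carrier v → x = M.zero v}
  have := M.finite v
  have := Fintype.ofFinite (M.X v)
  simp only [Nat.card_eq_fintype_card, Fintype.card_subtype]
  rw [← Finset.card_union_add_card_inter, ← Finset.card_univ]
  congr 1
  · congr 1
    ext x
    simp only [Finset.mem_univ, Finset.mem_union, Finset.mem_filter, true_and, true_iff]
    by_cases h : x ∈ L.carrier v
    · exact Or.inl h
    · exact Or.inr fun h' => absurd h' h
  · symm
    rw [Finset.card_eq_one]
    refine ⟨M.zero v, ?_⟩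
    ext x
    simp only [Finset.mem_inter, Finset.mem_filter, Finset.mem_univ, true_and,
      Finset.mem_singleton]
    exact ⟨fun h => h.2 h.1, fun h => by subst h; exact ⟨L.zero_mem v, fun _ => rfl⟩⟩

theorem finite_dim_eq [Finite V] [Finite E] (d : V → ℕ) : {x : NilIso Q | x.dim = d}.Finite := by
  classical
  let P : Type := (∀ v, Fin (d v)) × (∀ e, Fin (d (Q.src e)) → Fin (d (Q.tgt e)))
  let S : P → NilIso Q → Prop := fun p x => ∃ (M : F1Rep Q) (hM : M.IsNilpotent),
    x = mk M hM ∧ ∃ f : ∀ v, M.X v ≃ Fin (d v), (∀ v, f v (M.zero v) = p.1 v) ∧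
      ∀ e y, f _ (M.map e y) = p.2 e (f _ y)
  have hS : ∀ p x y, S p x → S p y → x = y := by
    rintro p _ _ ⟨M, hM, rfl, f, hf, hf'⟩ ⟨N, hN, rfl, g, hg, hg'⟩
    refine mk_eq_iff.2 ⟨⟨fun v => (f v).trans (g v).symm, fun v => ?_, fun e y => ?_⟩⟩
    · rw [Equiv.trans_apply, Equiv.symm_apply_eq, hf, hg]
    · simp only [Equiv.trans_apply]
      rw [Equiv.symm_apply_eq, hf', hg', Equiv.apply_symm_apply]
  have hfin : Finite P := inferInstance
  have hex : ∀ x : {x : NilIso Q | x.dim = d}, ∃ p, S p x.1 := by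
    rintro ⟨x, hx⟩
    induction x using NilIso.ind with
    | h M hM =>
      have h1 : ∀ v, Nonempty (M.X v ≃ Fin (d v)) := fun v => by
        have := M.finite v
        exact ⟨Finite.equivFinOfCardEq (congrFun hx v)⟩
      let f := fun v => (h1 v).some
      refine ⟨⟨fun v => f v (M.zero v), fun e y => f _ (M.map e ((f _).symm y))⟩, M, hM, rfl, f,
        fun _ => rfl, fun e y => ?_⟩
      simp only [Equiv.symm_apply_apply]
  choose p hp using hex
  have : Function.Injective p := fun x y h =>
    Subtype.ext (hS (p x) _ _ (hp x) (h ▸ hp y))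
  exact Set.finite_coe_iff.1 (Finite.of_injective p this)

/-- The zero representation. -/
def zero (Q : FQuiver V E) : NilIso Q := mk (zeroRep Q) isNilpotent_zeroRep

end NilIso

/-- The Hall algebra of nilpotent representations: finitely supported functions on the set of
isomorphism classes. -/
def Hall {V E : Type} (Q : FQuiver V E) := NilIso Q →₀ ℂ

namespace Hall

open F1Rep

variable {V E : Type} {Q : FQuiver V E}

noncomputable instance : AddCommGroup (Hall Q) := inferInstanceAs (AddCommGroup (NilIso Q →₀ ℂ))
noncomputable instance : Module ℂ (Hall Q) := inferInstanceAs (Module ℂ (NilIso Q →₀ ℂ))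
instance : FunLike (Hall Q) (NilIso Q) ℂ := inferInstanceAs (FunLike (NilIso Q →₀ ℂ) _ _)

@[ext] theorem ext {f g : Hall Q} (h : ∀ M hM, f (.mk M hM) = g (.mk M hM)) : f = g :=
  Finsupp.ext fun x => NilIso.ind (p := fun x => f x = g x) h x

@[simp] theorem add_apply (f g : Hall Q) (x : NilIso Q) : (f + g) x = f x + g x := rfl
@[simp] theorem sub_apply (f g : Hall Q) (x : NilIso Q) : (f - g) x = f x - g x := rfl
@[simp] theorem zero_apply (x : NilIso Q) : (0 : Hall Q) x = 0 := rfl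
@[simp] theorem smul_apply (c : ℂ) (f : Hall Q) (x : NilIso Q) : (c • f) x = c * f x := rfl

/-- The delta function of the class of a nilpotent representation. -/
noncomputable def cls (M : F1Rep Q) (h : M.IsNilpotent) : Hall Q :=
  Finsupp.single (NilIso.mk M h) 1

theorem congr_iso (f : Hall Q) {M N : F1Rep Q} (hM : M.IsNilpotent) (hN : N.IsNilpotent)
    (h : Nonempty (Iso M N)) : f (.mk M hM) = f (.mk N hN) :=
  congrArg f (NilIso.mk_eq_iff.2 h)

/-- The Hall product of two functions, evaluated at a class:
`(f * g)(R) = ∑ f(R / L) g(L)`, the sum being over all subrepresentations `L` of `R`. -/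
noncomputable def mulFun [Finite V] (f g : Hall Q) (x : NilIso Q) : ℂ :=
  Quotient.lift (s := NilRep.setoid Q) (fun R : NilRep Q =>
    ∑ L : Sub R.1, f (.mk _ (R.2.quot L)) * g (.mk _ (R.2.toRep L)))
    (fun _ _ h => h.elim fun e => Fintype.sum_equiv (Sub.equivOfIso e) _ _ fun L =>
      congrArg₂ _ (f.congr_iso _ _ (Sub.iso_quot_equivOfIso e L))
        (g.congr_iso _ _ (Sub.iso_toRep_equivOfIso e L))) x

theorem mulFun_finite [Finite V] [Finite E] (f g : Hall Q) :
    (Function.support (mulFun f g)).Finite := by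
  have hD : (Set.image2 (fun a b : V → ℕ => a + b - 1)
      (NilIso.dim '' Function.support f) (NilIso.dim '' Function.support g)).Finite :=
    .image2 _ ((Finsupp.hasFiniteSupport (f : NilIso Q →₀ ℂ)).image _)
      ((Finsupp.hasFiniteSupport (g : NilIso Q →₀ ℂ)).image _)
  refine (hD.biUnion fun d _ => NilIso.finite_dim_eq (Q := Q) d).subset fun x hx => ?_
  induction x using NilIso.ind with
  | h R hR =>
    obtain ⟨L, -, hL⟩ := Finset.exists_ne_zero_of_sum_ne_zero (Function.mem_support.1 hx)
    refine Set.mem_biUnion (x := (NilIso.mk R hR).dim) ?_ rfl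
    refine ⟨_, ⟨_, left_ne_zero_of_mul hL, rfl⟩, _,
      ⟨_, right_ne_zero_of_mul hL, rfl⟩, ?_⟩
    change _ + _ - 1 = _
    rw [add_comm, ← NilIso.dim_mk_toRep_quot hR L]
    funext v
    exact Nat.add_sub_cancel _ 1

/-- The unit is the class of the zero representation. -/
noncomputable instance : One (Hall Q) := ⟨cls (zeroRep Q) isNilpotent_zeroRep⟩

open Classical in
theorem one_apply (M : F1Rep Q) (hM : M.IsNilpotent) :
    (1 : Hall Q) (.mk M hM) = if Nonempty (Iso M (zeroRep Q)) then 1 else 0 := by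
  change (Finsupp.single (NilIso.mk _ isNilpotent_zeroRep) (1 : ℂ) : NilIso Q →₀ ℂ) _ = _
  rw [Finsupp.single_apply, eq_comm (a := NilIso.mk _ _), NilIso.mk_eq_iff]

/-- The coproduct `Δ(f)([M], [N]) = f([M ⊕ N])`, the tensor square of the Hall algebra being
regarded as a space of functions of two classes. -/
def comul (f : Hall Q) : NilIso Q × NilIso Q → ℂ := fun p => f (p.1.dsum p.2)

/-- The elementary tensor `f ⊗ g` as a function of two classes. -/
def tensor (f g : Hall Q) : NilIso Q × NilIso Q → ℂ := fun p => f p.1 * g p.2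

/-- Primitive elements: `Δ(f) = f ⊗ 1 + 1 ⊗ f`. -/
def IsPrimitive (f : Hall Q) : Prop := f.comul = f.tensor 1 + tensor 1 f

theorem isPrimitive_iff (f : Hall Q) : f.IsPrimitive ↔
    ∀ M hM N hN, f (.mk (dsum M N) (IsNilpotent.dsum hM hN)) =
      f (.mk M hM) * (1 : Hall Q) (.mk N hN) + (1 : Hall Q) (.mk M hM) * f (.mk N hN) := by
  constructor
  · intro h M hM N hN
    exact congrFun h (.mk M hM, .mk N hN)
  · intro h
    funext ⟨x, y⟩
    induction x using NilIso.ind with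
    | h M hM =>
      induction y using NilIso.ind with
      | h N hN => exact h M hM N hN

variable [Finite V] [Finite E]

noncomputable instance : Mul (Hall Q) :=
  ⟨fun f g => (Finsupp.ofSupportFinite (mulFun f g) (mulFun_finite f g) : NilIso Q →₀ ℂ)⟩

theorem mul_apply (f g : Hall Q) (R : F1Rep Q) (hR : R.IsNilpotent) :
    (f * g) (.mk R hR) = ∑ L : Sub R, f (.mk _ (hR.quot L)) * g (.mk _ (hR.toRep L)) := rfl

open Classical in
/-- On delta functions the product is given by the Hall numbers: the coefficient of `[R]` in
`[M] [N]` is the number of subrepresentations `L` of `R` with `L ≅ N` and `R / L ≅ M`. -/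
theorem cls_mul_cls_apply (M N R : F1Rep Q) (hM : M.IsNilpotent) (hN : N.IsNilpotent)
    (hR : R.IsNilpotent) : (cls M hM * cls N hN) (.mk R hR) =
      Nat.card {L : Sub R // Nonempty (Iso L.toRep N) ∧ Nonempty (Iso L.quot M)} := by
  have h : ∀ (A B : F1Rep Q) (hA : A.IsNilpotent) (hB : B.IsNilpotent),
      cls A hA (.mk B hB) = if Nonempty (Iso B A) then 1 else 0 := by
    intro A B hA hB
    change (Finsupp.single (NilIso.mk A hA) (1 : ℂ) : NilIso Q →₀ ℂ) _ = _
    rw [Finsupp.single_apply, eq_comm (a := NilIso.mk _ _), NilIso.mk_eq_iff]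
  rw [mul_apply, Nat.card_eq_fintype_card, Fintype.card_subtype, Finset.card_filter]
  push_cast
  refine Finset.sum_congr rfl fun L _ => ?_
  rw [h, h, ite_zero_mul_ite_zero, mul_one]
  simp only [and_comm]

protected theorem mul_assoc (f g h : Hall Q) : f * g * h = f * (g * h) := by
  ext R hR
  simp only [mul_apply, Finset.sum_mul, Finset.mul_sum]
  rw [← Fintype.sum_sigma', ← Fintype.sum_sigma']
  refine Fintype.sum_equiv (Sub.flagEquiv R) _ _ ?_
  rintro ⟨A, C⟩
  rw [mul_assoc]
  exact congrArg₂ _ (f.congr_iso _ _ ((Sub.iso_flag_top A C).map Iso.symm))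
    (congrArg₂ _ (g.congr_iso _ _ ((Sub.iso_flag_mid A C).map Iso.symm))
      (h.congr_iso _ _ ((Sub.iso_flag_bot A C).map Iso.symm)))

protected theorem one_mul (f : Hall Q) : 1 * f = f := by
  classical
  ext R hR
  rw [mul_apply, Finset.sum_eq_single (Sub.top R)]
  · rw [one_apply, if_pos ((Sub.iso_zero_quot_iff _).2 rfl), one_mul]
    exact f.congr_iso _ _ ((Sub.iso_toRep_top R).map Iso.symm)
  · intro L _ hL
    rw [one_apply, if_neg (mt (Sub.iso_zero_quot_iff _).1 hL), zero_mul]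
  · intro h; exact absurd (Finset.mem_univ _) h

protected theorem mul_one (f : Hall Q) : f * 1 = f := by
  classical
  ext R hR
  rw [mul_apply, Finset.sum_eq_single (Sub.bot R)]
  · rw [one_apply, if_pos ((Sub.iso_zero_toRep_iff _).2 rfl), mul_one]
    exact f.congr_iso _ _ (Sub.iso_quot_bot R)
  · intro L _ hL
    rw [one_apply, if_neg (mt (Sub.iso_zero_toRep_iff _).1 hL), mul_zero]
  · intro h; exact absurd (Finset.mem_univ _) h

noncomputable instance : Ring (Hall Q) where
  __ := (inferInstance : AddCommGroup (Hall Q))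
  mul_assoc := Hall.mul_assoc
  one_mul := Hall.one_mul
  mul_one := Hall.mul_one
  left_distrib f g h := by
    ext R hR; simp only [mul_apply, add_apply, mul_add, Finset.sum_add_distrib]
  right_distrib f g h := by
    ext R hR; simp only [mul_apply, add_apply, add_mul, Finset.sum_add_distrib]
  zero_mul f := by ext R hR; simp only [mul_apply, zero_apply, zero_mul, Finset.sum_const_zero]
  mul_zero f := by ext R hR; simp only [mul_apply, zero_apply, mul_zero, Finset.sum_const_zero]

noncomputable instance : Algebra ℂ (Hall Q) :=
  Algebra.ofModule
    (fun c f g => by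
      ext R hR; simp only [mul_apply, smul_apply, mul_assoc, Finset.mul_sum])
    (fun c f g => by
      ext R hR; simp only [mul_apply, smul_apply, mul_left_comm, Finset.mul_sum])

/-- The Hall algebra as a Lie algebra, with the commutator bracket. -/
noncomputable instance : LieRing (Hall Q) := LieRing.ofAssociativeRing

noncomputable instance : LieAlgebra ℂ (Hall Q) := LieAlgebra.ofAssociativeAlgebra

theorem IsPrimitive.mul_dsum {f g : Hall Q} (hf : f.IsPrimitive) (hg : g.IsPrimitive)
    (M : F1Rep Q) (hM : M.IsNilpotent) (N : F1Rep Q) (hN : N.IsNilpotent) :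
    (f * g) (.mk (dsum M N) (hM.dsum hN)) =
      (f * g) (.mk M hM) * (1 : Hall Q) (.mk N hN) + f (.mk M hM) * g (.mk N hN) +
      g (.mk M hM) * f (.mk N hN) + (1 : Hall Q) (.mk M hM) * (f * g) (.mk N hN) := by
  have key : ∀ a b c d : Hall Q, (a * b) (.mk M hM) * (c * d) (.mk N hN) =
      ∑ p : Sub M × Sub N, (a (.mk _ (hM.quot p.1)) * b (.mk _ (hM.toRep p.1))) *
        (c (.mk _ (hN.quot p.2)) * d (.mk _ (hN.toRep p.2))) := by
    intro a b c d
    rw [mul_apply, mul_apply, Fintype.sum_mul_sum, Fintype.sum_prod_type]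
  have e1 := key f g 1 1
  have e2 := key f 1 1 g
  have e3 := key 1 g f 1
  have e4 := key 1 1 f g
  simp only [Hall.mul_one, Hall.one_mul] at e1 e2 e3 e4
  rw [e1, e2, e3, e4, ← Finset.sum_add_distrib, ← Finset.sum_add_distrib,
    ← Finset.sum_add_distrib, mul_apply]
  refine (Fintype.sum_equiv (Sub.dsumEquiv M N) _ _ fun p => ?_).symm
  have h1 := (isPrimitive_iff f).1 hf _ (hM.quot p.1) _ (hN.quot p.2)
  have h2 := (isPrimitive_iff g).1 hg _ (hM.toRep p.1) _ (hN.toRep p.2)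
  have h3 := f.congr_iso ((hM.dsum hN).quot (Sub.dsum p.1 p.2)) ((hM.quot p.1).dsum (hN.quot p.2))
    (Sub.iso_quot_dsum p.1 p.2)
  have h4 := g.congr_iso ((hM.toRep p.1).dsum (hN.toRep p.2))
    ((hM.dsum hN).toRep (Sub.dsum p.1 p.2)) (Sub.iso_toRep_dsum p.1 p.2)
  change _ = f (.mk _ ((hM.dsum hN).quot (Sub.dsum p.1 p.2))) *
    g (.mk _ ((hM.dsum hN).toRep (Sub.dsum p.1 p.2)))
  rw [h3, ← h4, h1, h2]
  ring

end Hall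

/-- The Lie algebra `n_Q` of primitive elements of the nilpotent Hall algebra of `Q`, with the
commutator bracket. -/
noncomputable def hallLie {V E : Type} [Finite V] [Finite E] (Q : FQuiver V E) :
    LieSubalgebra ℂ (Hall Q) where
  carrier := {f | f.IsPrimitive}
  zero_mem' := (Hall.isPrimitive_iff _).2 fun M hM N hN => by simp
  add_mem' {f g} hf hg := (Hall.isPrimitive_iff _).2 fun M hM N hN => by
    simp only [Hall.add_apply]
    rw [(Hall.isPrimitive_iff f).1 hf M hM N hN, (Hall.isPrimitive_iff g).1 hg M hM N hN]; ring
  smul_mem' c f hf := (Hall.isPrimitive_iff _).2 fun M hM N hN => by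
    simp only [Hall.smul_apply]
    rw [(Hall.isPrimitive_iff f).1 hf M hM N hN]; ring
  lie_mem' {f g} hf hg := (Hall.isPrimitive_iff _).2 fun M hM N hN => by
    simp only [LieRing.of_associative_ring_bracket, Hall.sub_apply]
    rw [Hall.IsPrimitive.mul_dsum hf hg M hM N hN, Hall.IsPrimitive.mul_dsum hg hf M hM N hN]; ring

/-! ## Representations given by coefficient quivers -/

/-- A winding `S → Q`: a morphism of quivers such that distinct arrows of `S` with the same source,
or with the same target, have distinct images. -/
structure Winding {V' E' V E : Type} (S : FQuiver V' E') (Q : FQuiver V E) where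
  vmap : V' → V
  emap : E' → E
  src_comm : ∀ a, Q.src (emap a) = vmap (S.src a)
  tgt_comm : ∀ a, Q.tgt (emap a) = vmap (S.tgt a)
  src_inj : ∀ a b, S.src a = S.src b → emap a = emap b → a = b
  tgt_inj : ∀ a b, S.tgt a = S.tgt b → emap a = emap b → a = b

namespace Winding

variable {V' E' V E : Type} {S : FQuiver V' E'} {Q : FQuiver V E}

open Classical in
/-- The representation of `Q` with coefficient quiver `S`: the nonzero elements at `v` are the
vertices of `S` over `v`, and an arrow `e` sends `x` to `y` if there is an arrow `x → y` over `e`,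
and to the base point if there is no arrow over `e` with source `x`. -/
noncomputable def rep [Finite V'] (c : Winding S Q) : F1Rep Q where
  X v := Option {x : V' // c.vmap x = v}
  zero _ := none
  finite _ := inferInstance
  map e
    | none => none
    | some x => if h : ∃ a, c.emap a = e ∧ S.src a = x.1 then
        some ⟨S.tgt h.choose, by rw [← c.tgt_comm, h.choose_spec.1]⟩ else none
  map_zero _ := rfl
  map_inj e x y h h0 := by
    match x, y with
    | none, _ => exact absurd rfl h0
    | some x, none => exact absurd h h0
    | some x, some y =>
      simp only at h h0
      by_cases hx : ∃ a, c.emap a = e ∧ S.src a = x.1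
      · by_cases hy : ∃ a, c.emap a = e ∧ S.src a = y.1
        · rw [dif_pos hx, dif_pos hy] at h
          have h1 : S.tgt hx.choose = S.tgt hy.choose :=
            congrArg Subtype.val (Option.some.inj h)
          have h2 := c.tgt_inj _ _ h1 (hx.choose_spec.1.trans hy.choose_spec.1.symm)
          rw [Option.some.injEq, Subtype.ext_iff, ← hx.choose_spec.2, ← hy.choose_spec.2, h2]
        · rw [h] at h0; exact absurd (dif_neg hy) h0
      · exact absurd (dif_neg hx) h0

end Winding

/-! ## Trees -/

namespace FQuiver

variable {V E : Type}

/-- `Q` is an orientation of the simple graph `T`: the arrows of `Q` correspond bijectively to the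
edges of `T` by forgetting their directions. -/
def IsOrientation (Q : FQuiver V E) (T : SimpleGraph V) : Prop :=
  Function.Injective Q.ends ∧ Set.range Q.ends = T.edgeSet

/-- The inclusion into `Q` of the subquiver with underlying graph `S`. -/
def subWinding (Q : FQuiver V E) {T : SimpleGraph V} (S : T.Subgraph) :
    Winding (V' := S.verts) (E' := {e : E // Q.ends e ∈ S.edgeSet})
      ⟨fun e => ⟨Q.src e.1, S.mem_verts_of_mem_edge e.2 (Sym2.mem_mk_left _ _)⟩,
        fun e => ⟨Q.tgt e.1, S.mem_verts_of_mem_edge e.2 (Sym2.mem_mk_right _ _)⟩⟩ Q where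
  vmap v := v.1
  emap e := e.1
  src_comm _ := rfl
  tgt_comm _ := rfl
  src_inj _ _ _ h := Subtype.ext h
  tgt_inj _ _ _ h := Subtype.ext h

/-- The thin representation of `Q` supported on a subgraph `S`. -/
noncomputable def thin [Finite V] (Q : FQuiver V E) {T : SimpleGraph V} (S : T.Subgraph) :
    F1Rep Q := (Q.subWinding S).rep

/-- The number of edges of `S` to which `Q` and `Q'` give opposite directions. -/
noncomputable def numReversed {E' : Type} (Q : FQuiver V E) (Q' : FQuiver V E')
    {T : SimpleGraph V} (S : T.Subgraph) : ℕ :=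
  Nat.card {e : E // Q.ends e ∈ S.edgeSet ∧ ∃ e' : E', Q'.src e' = Q.tgt e ∧ Q'.tgt e' = Q.src e}

end FQuiver

/-! ## Cyclic quivers -/

/-- A labelling of `Q` as a quiver of type `Ã_n`: the vertices and arrows are numbered by
`ℤ / n` in such a way that the `k`-th arrow joins the vertices `k` and `k + 1`, in one of the two
directions. -/
structure CyclicLabelling {V E : Type} (Q : FQuiver V E) (n : ℕ) where
  vert : ZMod n ≃ V
  edge : ZMod n ≃ E
  ends_edge : ∀ k, Q.ends (edge k) = s(vert k, vert (k + 1))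

namespace CyclicLabelling

variable {V E : Type} {Q : FQuiver V E} {n : ℕ}

/-- The `k`-th arrow goes from `k` to `k + 1`. -/
def Forward (c : CyclicLabelling Q n) (k : ZMod n) : Prop :=
  Q.src (c.edge k) = c.vert k ∧ Q.tgt (c.edge k) = c.vert (k + 1)

/-- The `k`-th arrow goes from `k + 1` to `k`. -/
def Backward (c : CyclicLabelling Q n) (k : ZMod n) : Prop :=
  Q.src (c.edge k) = c.vert (k + 1) ∧ Q.tgt (c.edge k) = c.vert k

theorem backward_of_not_forward (c : CyclicLabelling Q n) {k : ZMod n} (h : ¬ c.Forward k) :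
    c.Backward k :=
  (Sym2.eq_iff.1 (c.ends_edge k)).resolve_left h

/-- All arrows go around the cycle in the same direction. -/
def Equioriented (c : CyclicLabelling Q n) : Prop := (∀ k, c.Forward k) ∨ ∀ k, c.Backward k

/-- The reduction `ℤ / dn → ℤ / n`. -/
def red (n d : ℕ) : ZMod (d * n) →+* ZMod n := ZMod.castHom (dvd_mul_left n d) (ZMod n)

open Classical in
/-- The `d`-fold cyclic covering of a quiver of type `Ã_n`, a quiver of type `Ã_{dn}`. -/
noncomputable def cover (c : CyclicLabelling Q n) (d : ℕ) :
    FQuiver (ZMod (d * n)) (ZMod (d * n)) where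
  src y := if c.Forward (red n d y) then y else y + 1
  tgt y := if c.Forward (red n d y) then y + 1 else y

/-- The covering map, as a winding. -/
noncomputable def coverWinding (c : CyclicLabelling Q n) (d : ℕ) : Winding (c.cover d) Q where
  vmap x := c.vert (red n d x)
  emap y := c.edge (red n d y)
  src_comm y := by
    by_cases h : c.Forward (red n d y)
    · simp only [cover, if_pos h]; exact h.1
    · simp only [cover, if_neg h, map_add, map_one]; exact (c.backward_of_not_forward h).1
  tgt_comm y := by
    by_cases h : c.Forward (red n d y)
    · simp only [cover, if_pos h, map_add, map_one]; exact h.2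
    · simp only [cover, if_neg h]; exact (c.backward_of_not_forward h).2
  src_inj a b h h' := by
    have h1 := c.edge.injective h'
    by_cases hb : c.Forward (red n d b)
    · simpa only [cover, if_pos hb, if_pos (h1 ▸ hb : c.Forward (red n d a))] using h
    · simpa only [cover, if_neg hb, if_neg (h1 ▸ hb : ¬ c.Forward (red n d a)),
        add_left_inj] using h
  tgt_inj a b h h' := by
    have h1 := c.edge.injective h'
    by_cases hb : c.Forward (red n d b)
    · simpa only [cover, if_pos hb, if_pos (h1 ▸ hb : c.Forward (red n d a)),
        add_left_inj] using h
    · simpa only [cover, if_neg hb, if_neg (h1 ▸ hb : ¬ c.Forward (red n d a))] using h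

/-- The band representation `Ĩ_d`, whose coefficient quiver is the `d`-fold cyclic covering. -/
noncomputable def band [NeZero n] (c : CyclicLabelling Q n) (d : ℕ) [NeZero d] : F1Rep Q :=
  (c.coverWinding d).rep

/-- The band classes `[Ĩ_d]`, `d ≥ 1`, in the Lie algebra `n_Q`. -/
def bandClasses [NeZero n] [Finite V] [Finite E] (c : CyclicLabelling Q n) : Set (hallLie Q) :=
  {x | ∃ (d : ℕ) (_ : NeZero d) (h : (c.band d).IsNilpotent), (x : Hall Q) = Hall.cls (c.band d) h}

end CyclicLabelling

/-! ## The affine Lie algebra of `gl_n` and its positive part -/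

namespace AffineGl

open LieAlgebra LieAlgebra.LoopAlgebra Matrix

attribute [local instance 100] LieRing.ofAssociativeRing

/-- The Lie algebra `gl_n(ℂ)`. -/
abbrev Gl (n : ℕ) := Matrix (Fin n) (Fin n) ℂ

/-- The trace form `(x, y) ↦ tr(xy)` on `gl_n(ℂ)`. -/
noncomputable def trForm (n : ℕ) : LinearMap.BilinForm ℂ (Gl n) :=
  (LinearMap.mul ℂ (Gl n)).compr₂ (Matrix.traceLinearMap (Fin n) ℂ ℂ)

theorem trForm_apply (n : ℕ) (x y : Gl n) : trForm n x y = (x * y).trace := rfl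

theorem trForm_invariant (n : ℕ) : (trForm n).lieInvariant (Gl n) := by
  intro x y z
  simp only [trForm_apply, LieRing.of_associative_ring_bracket, sub_mul, mul_sub, trace_sub]
  rw [mul_assoc, Matrix.trace_mul_comm x, mul_assoc, mul_assoc]
  ring

theorem trForm_symm (n : ℕ) : (trForm n).IsSymm :=
  ⟨fun x y => Matrix.trace_mul_comm x y⟩

/-- The affine Lie algebra `gl_n(ℂ)[t, t⁻¹] ⊕ ℂ c`, with bracket
`[x t^p, y t^q] = [x, y] t^(p+q) + q δ_{q,-p} tr(xy) c` and `c` central. -/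
abbrev Affine (n : ℕ) :=
  LieAlgebra.ofTwoCocycle
    (twoCocycleOfBilinear ℂ ℤ (Gl n) (trForm n) (trForm_invariant n) (trForm_symm n))

/-- The element `x t^m` of the affine Lie algebra. -/
noncomputable def mon {n : ℕ} (x : Gl n) (m : ℤ) : Affine n :=
  ofProd _ (AddMonoidAlgebra.single m 1 ⊗ₜ[ℂ] x, 0)

/-- The central element `c`. -/
noncomputable def central (n : ℕ) : Affine n :=
  ofProd _ (0, (TrivialLieModule.equiv ℂ (loopAlgebra ℂ ℤ (Gl n)) ℂ).symm 1)

theorem lie_mon_mon {n : ℕ} (x y : Gl n) (p q : ℤ) :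
    ⁅mon x p, mon y q⁆ = mon ⁅x, y⁆ (p + q) +
      (if p = -q then (q : ℂ) * (x * y).trace else 0) • central n := by
  have h : residuePairing ℂ ℤ (Gl n) (trForm n) (AddMonoidAlgebra.single p 1 ⊗ₜ[ℂ] x)
      (AddMonoidAlgebra.single q 1 ⊗ₜ[ℂ] y) = if p = -q then (q : ℂ) * (x * y).trace else 0 := by
    rw [residuePairing_apply_apply, toFinsupp_single_tmul, toFinsupp_single_tmul,
      Finsupp.sum_single_index (by simp), Finsupp.single_apply]
    split_ifs <;> simp [trForm_apply]
  rw [bracket_ofTwoCocycle]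
  simp only [mon, central, Equiv.symm_apply_apply, trivial_lie_zero, add_zero, sub_zero]
  rw [← of_smul, ← of_add]
  refine congrArg _ (Prod.ext ?_ ?_)
  · refine (LieAlgebra.ExtendScalars.bracket_tmul ..).trans ?_
    rw [AddMonoidAlgebra.single_mul_single, mul_one]
    change _ = _ + _ • (0 : loopAlgebra ℂ ℤ (Gl n))
    rw [smul_zero, add_zero]
  · refine Eq.trans ?_ (zero_add _).symm
    refine h.trans ?_
    exact (mul_one _).symm

/-- The elements `x t^m` with `m ≥ 1`, and those with `m = 0` and `x` strictly upper triangular. -/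
def posGen (n : ℕ) : Set (Affine n) :=
  {a | ∃ (x : Gl n) (m : ℕ), a = mon x m ∧ (m = 0 → ∀ i j, j ≤ i → x i j = 0)}

/-- The positive part `a_+ = t gl_n(ℂ)[t] ⊕ N_+` of the affine Lie algebra, where `N_+` consists of
the strictly upper triangular matrices. -/
noncomputable def aPlus (n : ℕ) : LieSubalgebra ℂ (Affine n) where
  __ := Submodule.span ℂ (posGen n)
  lie_mem' {a b} ha hb := by
    change ⁅a, b⁆ ∈ Submodule.span ℂ (posGen n)
    induction ha, hb using Submodule.span_induction₂ with
    | mem_mem a b ha hb =>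
      obtain ⟨x, p, rfl, hx⟩ := ha
      obtain ⟨y, q, rfl, hy⟩ := hb
      have h0 : (if (p : ℤ) = -(q : ℤ) then (((q : ℤ) : ℂ)) * (x * y).trace else 0) = 0 := by
        split_ifs with h
        · have : q = 0 := by omega
          simp [this]
        · rfl
      rw [lie_mon_mon, h0, zero_smul, add_zero]
      refine Submodule.subset_span ⟨⁅x, y⁆, p + q, by push_cast; rfl, fun h i j hij => ?_⟩
      have hx' := hx (by omega)
      have hy' := hy (by omega)
      rw [LieRing.of_associative_ring_bracket, Matrix.sub_apply, Matrix.mul_apply,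
        Matrix.mul_apply, ← Finset.sum_sub_distrib]
      refine Finset.sum_eq_zero fun k _ => ?_
      rcases le_total k i with hk | hk
      · rw [hx' i k hk, hy' i k hk, zero_mul, zero_mul, sub_zero]
      · rw [hx' k j (hij.trans hk), hy' k j (hij.trans hk), mul_zero, mul_zero, sub_zero]
    | zero_left => rw [zero_lie]; exact Submodule.zero_mem _
    | zero_right => rw [lie_zero]; exact Submodule.zero_mem _
    | add_left a b c _ _ _ h h' => rw [add_lie]; exact Submodule.add_mem _ h h'
    | add_right a b c _ _ _ h h' => rw [lie_add]; exact Submodule.add_mem _ h h'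
    | smul_left r a b _ _ h => rw [smul_lie]; exact Submodule.smul_mem _ _ h
    | smul_right r a b _ _ h => rw [lie_smul]; exact Submodule.smul_mem _ _ h

end AffineGl

/-!
Representations of a quiver over the field with one element are encoded by their coefficient
quivers (`Coef`): the nonzero elements are the vertices, and subrepresentations are the vertex sets
closed under the arrows (`F1Rep.Sub.equivClosed`). An element `f` of the Hall algebra can thus be
evaluated at any coefficient quiver `D` (`Hall.ev`), and the product becomes a sum over closed
vertex sets (`Hall.ev_mul`). Primitive elements are the ones supported on connected coefficient
quivers (`hallLie.ev_eq_zero`, `hallLie.cls_mem`), so `n_Q` has the classes of the connected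
nilpotent representations as a basis. The value of `⁅f, g⁆` at `D` is a sum over the ways to cut `D`
into a subrepresentation and a quotient (`Hall.ev_lie`), where only cuts into two connected pieces
matter.

For a tree, a connected coefficient quiver is a connected subgraph `S`
(`FQuiver.IsOrientation.exists_iso_subCoef`). If `S` is cut into two connected pieces, exactly one edge of
`S` joins them, and its direction alone decides which piece is the subrepresentation, that is, the
sign of the term. Reversing that edge changes the sign of the term, and reversing any other edge
does not; this is what the factor `(-1) ^ r` compensates for (`FQuiver.IsOrientation.sign_eq`).

For a cycle, forgetting the directions of the arrows turns coefficient quivers into chains over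
`ℤ / n` (`Chain`), and the connected chains are the strings and the finite coverings of the cycle
(`Chain.exists_iso_string_or_complete`, `Chain.exists_iso_cycle`). Cutting a string at an arrow
gives two strings, so the same sign argument shows that the string that runs from `a` to `b` behaves,
up to a sign, like the matrix unit at position `(a, b + 1)` among the matrices periodic under
`(n, n)`, that is, among the matrices over `ℂ[t]`: this is the homomorphism
`CyclicLabelling.toAffine`. Its image is the positive part of the affine Lie algebra, on which the
cocycle vanishes because no negative degrees occur. Its kernel consists of the elements that
vanish at all strings, so it is spanned by the classes of the coverings, if these are nilpotent. A
covering of the cycle inside a connected coefficient quiver has no arrows to the rest, so it is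
everything and never occurs as a proper piece of a cut; hence the kernel is central. If all arrows
have the same direction, the coverings are not nilpotent and the homomorphism is injective.
-/

/-! ### Coefficient quivers -/

/-- A coefficient quiver over `Q` with vertex set `X`: the vertices of `X` lie over vertices of `Q`,
and `arr e x y` says that there is an arrow `x → y` over `e`. The last two conditions are those of
a winding. In this relational form, restriction to subsets of `X` involves no choices. -/
structure Coef {V E : Type} (Q : FQuiver V E) (X : Type) where
  pos : X → V
  arr : E → X → X → Prop
  pos_src : ∀ {e x y}, arr e x y → pos x = Q.src e
  pos_tgt : ∀ {e x y}, arr e x y → pos y = Q.tgt e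
  right_unique : ∀ {e x y z}, arr e x y → arr e x z → y = z
  left_unique : ∀ {e x y z}, arr e x z → arr e y z → x = y

namespace Coef

variable {V E : Type} {Q : FQuiver V E} {X Y Z : Type}

/-- An isomorphism of coefficient quivers. -/
structure Iso (D : Coef Q X) (D' : Coef Q Y) where
  toEquiv : X ≃ Y
  pos_eq : ∀ x, D'.pos (toEquiv x) = D.pos x
  arr_iff : ∀ e x y, D'.arr e (toEquiv x) (toEquiv y) ↔ D.arr e x y

namespace Iso

/-- The arrows have to be compared only between vertices over the right vertices of `Q`. -/
def ofEquiv {D : Coef Q X} {D' : Coef Q Y} (f : X ≃ Y) (hp : ∀ x, D'.pos (f x) = D.pos x)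
    (h : ∀ e x y, D.pos x = Q.src e → D.pos y = Q.tgt e →
      (D'.arr e (f x) (f y) ↔ D.arr e x y)) : Iso D D' where
  toEquiv := f
  pos_eq := hp
  arr_iff e x y :=
    ⟨fun h' => (h e x y ((hp x).symm.trans (D'.pos_src h'))
      ((hp y).symm.trans (D'.pos_tgt h'))).1 h',
    fun h' => (h e x y (D.pos_src h') (D.pos_tgt h')).2 h'⟩

def refl (D : Coef Q X) : Iso D D := ⟨Equiv.refl X, fun _ => rfl, fun _ _ _ => Iff.rfl⟩

def symm {D : Coef Q X} {D' : Coef Q Y} (f : Iso D D') : Iso D' D where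
  toEquiv := f.toEquiv.symm
  pos_eq x := by rw [← f.pos_eq, Equiv.apply_symm_apply]
  arr_iff e x y := by rw [← f.arr_iff, Equiv.apply_symm_apply, Equiv.apply_symm_apply]

def trans {D : Coef Q X} {D' : Coef Q Y} {D'' : Coef Q Z} (f : Iso D D') (g : Iso D' D'') :
    Iso D D'' where
  toEquiv := f.toEquiv.trans g.toEquiv
  pos_eq x := by rw [Equiv.trans_apply, g.pos_eq, f.pos_eq]
  arr_iff e x y := by rw [Equiv.trans_apply, Equiv.trans_apply, g.arr_iff, f.arr_iff]

end Iso

/-- The full coefficient subquiver on a set of vertices. -/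
def restrict (D : Coef Q X) (A : Set X) : Coef Q A where
  pos x := D.pos x
  arr e x y := D.arr e x y
  pos_src h := D.pos_src h
  pos_tgt h := D.pos_tgt h
  right_unique h h' := Subtype.ext (D.right_unique h h')
  left_unique h h' := Subtype.ext (D.left_unique h h')

/-- The disjoint union of two coefficient quivers. -/
def sum (D : Coef Q X) (D' : Coef Q Y) : Coef Q (X ⊕ Y) where
  pos := Sum.elim D.pos D'.pos
  arr e
    | .inl x, .inl y => D.arr e x y
    | .inr x, .inr y => D'.arr e x y
    | _, _ => False
  pos_src {e x y} h := by
    rcases x with x | x <;> rcases y with y | y <;> first | exact h.elim | skip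
    exacts [D.pos_src h, D'.pos_src h]
  pos_tgt {e x y} h := by
    rcases x with x | x <;> rcases y with y | y <;> first | exact h.elim | skip
    exacts [D.pos_tgt h, D'.pos_tgt h]
  right_unique {e x y z} h h' := by
    rcases x with x | x <;> rcases y with y | y <;> rcases z with z | z <;>
      first | exact h.elim | exact h'.elim | skip
    exacts [congrArg _ (D.right_unique h h'), congrArg _ (D'.right_unique h h')]
  left_unique {e x y z} h h' := by
    rcases x with x | x <;> rcases y with y | y <;> rcases z with z | z <;>
      first | exact h.elim | exact h'.elim | skip
    exacts [congrArg _ (D.left_unique h h'), congrArg _ (D'.left_unique h h')]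

/-- Vertex sets closed under the arrows; these are the subrepresentations. -/
def Closed (D : Coef Q X) (A : Set X) : Prop := ∀ e x y, D.arr e x y → x ∈ A → y ∈ A

/-- Vertex sets that are unions of connected components. -/
def Separating (D : Coef Q X) (A : Set X) : Prop := ∀ e x y, D.arr e x y → (x ∈ A ↔ y ∈ A)

/-- Connected coefficient quivers (the empty one is not connected). -/
def Conn (D : Coef Q X) : Prop := Nonempty X ∧ ∀ A, D.Separating A → A = ∅ ∨ A = Set.univ

/-- A coefficient quiver is the disjoint union of a separating set and its complement. -/
noncomputable def Iso.sumRestrict {D : Coef Q X} {A : Set X} (h : D.Separating A) :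
    Iso ((D.restrict A).sum (D.restrict Aᶜ)) D := by
  classical
  exact
  { toEquiv := Equiv.Set.sumCompl A
    pos_eq := by rintro (x | x) <;> simp [sum, restrict]
    arr_iff := by
      rintro e (x | x) (y | y)
      · simp [sum, restrict]
      · simp only [sum, iff_false]
        intro h'
        exact y.2 ((h _ _ _ h').1 x.2)
      · simp only [sum, iff_false]
        intro h'
        exact x.2 ((h _ _ _ h').2 y.2)
      · simp [sum, restrict] }

def Iso.sumCongr {X' Y' : Type} {D : Coef Q X} {D' : Coef Q X'} {C : Coef Q Y} {C' : Coef Q Y'}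
    (f : Iso D D') (g : Iso C C') : Iso (D.sum C) (D'.sum C') where
  toEquiv := Equiv.sumCongr f.toEquiv g.toEquiv
  pos_eq := by
    rintro (x | x)
    exacts [f.pos_eq x, g.pos_eq x]
  arr_iff := by
    rintro e (x | x) (y | y)
    exacts [f.arr_iff _ _ _, Iff.rfl, Iff.rfl, g.arr_iff _ _ _]

theorem Closed.preimage {D : Coef Q X} {D' : Coef Q Y} (f : Iso D D') {A : Set Y}
    (h : D'.Closed A) : D.Closed (f.toEquiv ⁻¹' A) := fun e x y hxy hx =>
  h e _ _ ((f.arr_iff e x y).2 hxy) hx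

theorem Separating.preimage {D : Coef Q X} {D' : Coef Q Y} (f : Iso D D') {A : Set Y}
    (h : D'.Separating A) : D.Separating (f.toEquiv ⁻¹' A) := fun e x y hxy =>
  h e _ _ ((f.arr_iff e x y).2 hxy)

theorem Conn.of_iso {D : Coef Q X} {D' : Coef Q Y} (f : Iso D D') (h : D.Conn) : D'.Conn := by
  refine ⟨h.1.map f.toEquiv, fun A hA => ?_⟩
  rcases h.2 _ (hA.preimage f) with h' | h'
  · left; exact (Set.preimage_eq_empty_iff.1 h').eq_bot_of_le (by simp [f.toEquiv.range_eq_univ])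
  · right
    rw [Set.preimage_eq_univ_iff, f.toEquiv.range_eq_univ] at h'
    exact Set.univ_subset_iff.1 h'

theorem conn_iff_of_iso {D : Coef Q X} {D' : Coef Q Y} (f : Iso D D') : D.Conn ↔ D'.Conn :=
  ⟨.of_iso f, .of_iso f.symm⟩

def Iso.restrict {D : Coef Q X} {D' : Coef Q Y} (f : Iso D D') (A : Set Y) :
    Iso (D.restrict (f.toEquiv ⁻¹' A)) (D'.restrict A) where
  toEquiv := f.toEquiv.subtypeEquiv fun _ => Iff.rfl
  pos_eq x := f.pos_eq x
  arr_iff e x y := f.arr_iff e x y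

end Coef

namespace Winding

variable {V' E' V E : Type} {S : FQuiver V' E'} {Q : FQuiver V E}

/-- A winding as a coefficient quiver. -/
def coef (c : Winding S Q) : Coef Q V' where
  pos := c.vmap
  arr e x y := ∃ a, c.emap a = e ∧ S.src a = x ∧ S.tgt a = y
  pos_src := by rintro _ _ _ ⟨a, rfl, rfl, rfl⟩; exact (c.src_comm a).symm
  pos_tgt := by rintro _ _ _ ⟨a, rfl, rfl, rfl⟩; exact (c.tgt_comm a).symm
  right_unique := by
    rintro _ _ _ _ ⟨a, rfl, rfl, rfl⟩ ⟨b, h, h', rfl⟩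
    rw [c.src_inj b a h' h]
  left_unique := by
    rintro _ _ _ _ ⟨a, rfl, rfl, rfl⟩ ⟨b, h, rfl, h'⟩
    rw [c.tgt_inj b a h' h]

end Winding

namespace Coef

variable {V E : Type} {Q : FQuiver V E} {X Y : Type}

/-- A coefficient quiver as a winding. -/
def winding (D : Coef Q X) : Winding (V' := X) (E' := {t : E × X × X // D.arr t.1 t.2.1 t.2.2})
    ⟨fun t => t.1.2.1, fun t => t.1.2.2⟩ Q where
  vmap := D.pos
  emap t := t.1.1
  src_comm t := (D.pos_src t.2).symm
  tgt_comm t := (D.pos_tgt t.2).symm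
  src_inj := by
    rintro ⟨⟨e, x, y⟩, h⟩ ⟨⟨e', x', y'⟩, h'⟩ h1 h2
    simp only at h h' h1 h2
    subst h1 h2
    obtain rfl := D.right_unique h h'
    rfl
  tgt_inj := by
    rintro ⟨⟨e, x, y⟩, h⟩ ⟨⟨e', x', y'⟩, h'⟩ h1 h2
    simp only at h h' h1 h2
    subst h1 h2
    obtain rfl := D.left_unique h h'
    rfl

/-- The representation with a given coefficient quiver. -/
noncomputable def rep [Finite X] (D : Coef Q X) : F1Rep Q := D.winding.rep

def windingIso (D : Coef Q X) : Iso D.winding.coef D where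
  toEquiv := Equiv.refl X
  pos_eq _ := rfl
  arr_iff e x y :=
    ⟨fun h => ⟨⟨(e, x, y), h⟩, rfl, rfl, rfl⟩, by rintro ⟨t, rfl, rfl, rfl⟩; exact t.2⟩

end Coef

namespace F1Rep

variable {V E : Type} {Q : FQuiver V E}

/-- The nonzero elements of a representation. -/
def El (M : F1Rep Q) : Type := {p : Σ v, M.X v // p.2 ≠ M.zero p.1}

instance [Finite V] (M : F1Rep Q) : Finite M.El := by
  have := M.finite
  exact inferInstanceAs (Finite {p : Σ v, M.X v // p.2 ≠ M.zero p.1})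

/-- A nonzero element, together with its vertex. -/
def El.mk (M : F1Rep Q) {v : V} (x : M.X v) (h : x ≠ M.zero v) : M.El := ⟨⟨v, x⟩, h⟩

/-- The coefficient quiver of a representation. -/
def coef (M : F1Rep Q) : Coef Q M.El where
  pos p := p.1.1
  arr e p q := ∃ x, p.1 = ⟨Q.src e, x⟩ ∧ q.1 = ⟨Q.tgt e, M.map e x⟩
  pos_src := by rintro e p q ⟨x, h, -⟩; rw [h]
  pos_tgt := by rintro e p q ⟨x, -, h⟩; rw [h]
  right_unique := by
    rintro e p q r ⟨x, h1, h2⟩ ⟨y, h3, h4⟩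
    obtain rfl := sigma_mk_injective (h1.symm.trans h3)
    exact Subtype.ext (h2.trans h4.symm)
  left_unique := by
    rintro e p q r ⟨x, h1, h2⟩ ⟨y, h3, h4⟩
    have h5 := sigma_mk_injective (h2.symm.trans h4)
    have h6 : M.map e x ≠ M.zero _ := by
      have := r.2
      rwa [h2] at this
    obtain rfl := M.map_inj e x y h5 h6
    exact Subtype.ext (h1.trans h3.symm)

theorem coef_arr_mk (M : F1Rep Q) {e : E} {x : M.X (Q.src e)} {y : M.X (Q.tgt e)}
    {hx : x ≠ M.zero _} {hy : y ≠ M.zero _} :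
    M.coef.arr e (El.mk M x hx) (El.mk M y hy) ↔ M.map e x = y := by
  constructor
  · rintro ⟨z, h1, h2⟩
    rw [sigma_mk_injective h1]
    exact (sigma_mk_injective h2).symm
  · rintro rfl
    exact ⟨x, rfl, rfl⟩

/-- Every arrow of the coefficient quiver has this form. -/
theorem coef_arr_cases (M : F1Rep Q) {e : E} {p q : M.El} (h : M.coef.arr e p q) :
    ∃ x hx hy, p = El.mk M x hx ∧ q = El.mk M (M.map e x) hy := by
  obtain ⟨⟨v, x⟩, hx⟩ := p
  obtain ⟨⟨w, y⟩, hy⟩ := q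
  obtain ⟨z, h1, h2⟩ := h
  cases h1
  cases h2
  exact ⟨_, hx, hy, rfl, rfl⟩

/-- Isomorphic representations have isomorphic coefficient quivers. -/
def Iso.coef {M N : F1Rep Q} (f : Iso M N) : Coef.Iso M.coef N.coef :=
  .ofEquiv
    { toFun p := El.mk N (f.app _ p.1.2) fun h =>
        p.2 ((f.app _).injective (h.trans (f.app_zero _).symm))
      invFun p := El.mk M ((f.app _).symm p.1.2) fun h => p.2 <| by
        rw [Equiv.symm_apply_eq, f.app_zero] at h
        exact h
      left_inv p := Subtype.ext (congrArg (Sigma.mk p.1.1) ((f.app _).symm_apply_apply p.1.2))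
      right_inv p := Subtype.ext (congrArg (Sigma.mk p.1.1) ((f.app _).apply_symm_apply p.1.2)) }
    (fun _ => rfl) <| by
    rintro e ⟨⟨v, x⟩, hx⟩ ⟨⟨w, y⟩, hy⟩ rfl rfl
    refine (N.coef_arr_mk).trans (Iff.trans ?_ (M.coef_arr_mk (hx := hx) (hy := hy)).symm)
    change N.map e (f.app _ x) = f.app _ y ↔ _
    rw [← f.comm, (f.app _).injective.eq_iff]

/-- Representations with isomorphic coefficient quivers are isomorphic. -/
theorem nonempty_iso_of_coef {M N : F1Rep Q} (f : Coef.Iso M.coef N.coef) :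
    Nonempty (Iso M N) := by
  -- `R v z w` says that `z` and `w` correspond to each other.
  let R : ∀ v, M.X v → N.X v → Prop := fun v z w => (z = M.zero v ∧ w = N.zero v) ∨
    ∃ (hz : z ≠ M.zero v) (hw : w ≠ N.zero v), f.toEquiv (El.mk M z hz) = El.mk N w hw
  have left : ∀ v z w w', R v z w → R v z w' → w = w' := by
    rintro v z w w' (⟨h1, h2⟩ | ⟨hz, hw, h⟩) (⟨h3, h4⟩ | ⟨hz', hw', h'⟩)
    · rw [h2, h4]
    · exact absurd h1 hz'
    · exact absurd h3 hz
    · have := h.symm.trans h'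
      exact sigma_mk_injective (congrArg Subtype.val this)
  have right : ∀ v z z' w, R v z w → R v z' w → z = z' := by
    rintro v z z' w (⟨h1, h2⟩ | ⟨hz, hw, h⟩) (⟨h3, h4⟩ | ⟨hz', hw', h'⟩)
    · rw [h1, h3]
    · exact absurd h2 hw'
    · exact absurd h4 hw
    · have := f.toEquiv.injective (h.trans h'.symm)
      exact sigma_mk_injective (congrArg Subtype.val this)
  have ex : ∀ v z, ∃ w, R v z w := by
    intro v z
    by_cases hz : z = M.zero v
    · exact ⟨_, Or.inl ⟨hz, rfl⟩⟩
    · have hv := f.pos_eq (El.mk M z hz)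
      obtain ⟨⟨⟨v', w⟩, hw⟩, h⟩ : ∃ q, f.toEquiv (El.mk M z hz) = q := ⟨_, rfl⟩
      rw [h] at hv
      change v' = v at hv
      subst hv
      exact ⟨w, Or.inr ⟨hz, hw, h⟩⟩
  have ex' : ∀ v w, ∃ z, R v z w := by
    intro v w
    by_cases hw : w = N.zero v
    · exact ⟨_, Or.inl ⟨rfl, hw⟩⟩
    · have hv := f.symm.pos_eq (El.mk N w hw)
      obtain ⟨⟨⟨v', z⟩, hz⟩, h⟩ : ∃ q, f.toEquiv.symm (El.mk N w hw) = q := ⟨_, rfl⟩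
      change M.coef.pos (f.toEquiv.symm _) = _ at hv
      rw [h] at hv
      change v' = v at hv
      subst hv
      exact ⟨z, Or.inr ⟨hz, hw, (f.toEquiv.symm_apply_eq.1 h).symm⟩⟩
  have comm : ∀ e z w, R (Q.src e) z w → R (Q.tgt e) (M.map e z) (N.map e w) := by
    rintro e z w (⟨rfl, rfl⟩ | ⟨hz, hw, h⟩)
    · exact Or.inl ⟨M.map_zero e, N.map_zero e⟩
    · obtain ⟨w', hw'⟩ := ex _ (M.map e z)
      obtain ⟨z', hz'⟩ := ex' _ (N.map e w)
      by_cases h0 : M.map e z = M.zero _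
      · left
        refine ⟨h0, ?_⟩
        rcases hz' with ⟨-, h'⟩ | ⟨h1, h2, h3⟩
        · exact h'
        · have h4 : N.coef.arr e (El.mk N w hw) (El.mk N _ h2) := N.coef_arr_mk.2 rfl
          rw [← h, ← h3, f.arr_iff, M.coef_arr_mk] at h4
          exact absurd (h4.symm.trans h0) h1
      · rcases hw' with ⟨h', -⟩ | ⟨h1, h2, h3⟩
        · exact absurd h' h0
        · have h4 : M.coef.arr e (El.mk M z hz) (El.mk M _ h1) := M.coef_arr_mk.2 rfl
          rw [← f.arr_iff, h, h3, N.coef_arr_mk] at h4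
          subst h4
          exact Or.inr ⟨h1, h2, h3⟩
  choose F hF using ex
  have inj : ∀ v x y, F v x = F v y → x = y := fun v x y h =>
    right _ _ _ _ (hF v x) (h ▸ hF v y)
  refine iso_of_bijective ⟨F, fun v => left _ _ _ _ (hF _ _) (Or.inl ⟨rfl, rfl⟩),
    fun v x y h _ => inj v x y h,
    fun e x => left _ _ _ _ (hF _ _) (comm _ _ _ (hF _ _))⟩ fun v =>
    ⟨fun x y h => inj v x y h, fun w => ?_⟩
  obtain ⟨z, hz⟩ := ex' v w
  exact ⟨z, left _ _ _ _ (hF _ _) hz⟩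

/-- The set of nonzero elements of a subrepresentation. -/
def Sub.set {M : F1Rep Q} (L : Sub M) : Set M.El := {p | p.1.2 ∈ L.carrier p.1.1}

/-- The coefficient quiver of a subrepresentation. -/
def Sub.coefIso {M : F1Rep Q} (L : Sub M) : Coef.Iso (M.coef.restrict L.set) L.toRep.coef :=
  .ofEquiv
    { toFun p := El.mk L.toRep ⟨p.1.1.2, p.2⟩ fun h => p.1.2 (congrArg Subtype.val h)
      invFun p := ⟨El.mk M p.1.2.1 fun h => p.2 (Subtype.ext h), p.1.2.2⟩
      left_inv _ := rfl
      right_inv _ := rfl }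
    (fun _ => rfl) <| by
    rintro e ⟨⟨⟨v, x⟩, hx⟩, hx'⟩ ⟨⟨⟨w, y⟩, hy⟩, hy'⟩ rfl rfl
    exact L.toRep.coef_arr_mk.trans
      (Subtype.ext_iff.trans (M.coef_arr_mk (hx := hx) (hy := hy)).symm)

/-- The coefficient quiver of a quotient. -/
noncomputable def Sub.coefIsoQuot {M : F1Rep Q} (L : Sub M) :
    Coef.Iso (M.coef.restrict L.setᶜ) L.quot.coef :=
  .ofEquiv
    { toFun p := El.mk L.quot ⟨p.1.1.2, fun h => absurd h p.2⟩
        fun h => p.1.2 (congrArg Subtype.val h)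
      invFun p := ⟨El.mk M p.1.2.1 fun h => p.2 (Subtype.ext h),
        fun h => p.2 (Subtype.ext (p.1.2.2 h))⟩
      left_inv _ := rfl
      right_inv _ := rfl }
    (fun _ => rfl) <| by
    rintro e ⟨⟨⟨v, x⟩, hx⟩, hx'⟩ ⟨⟨⟨w, y⟩, hy⟩, hy'⟩ rfl rfl
    refine L.quot.coef_arr_mk.trans (Subtype.ext_iff.trans (Iff.trans ?_
      (M.coef_arr_mk (hx := hx) (hy := hy)).symm))
    change L.collapse _ (M.map e x) = y ↔ M.map e x = y
    by_cases h5 : M.map e x ∈ L.carrier _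
    · rw [collapse_of_mem h5]
      exact ⟨fun h => absurd h.symm hy, fun h => absurd (h ▸ h5) hy'⟩
    · rw [collapse_of_notMem h5]

/-- Subrepresentations are the same as closed sets of nonzero elements. -/
noncomputable def Sub.equivClosed (M : F1Rep Q) : Sub M ≃ {A : Set M.El // M.coef.Closed A} where
  toFun L := ⟨L.set, fun e p q h hp => by
    obtain ⟨x, hx, hy, rfl, rfl⟩ := M.coef_arr_cases h
    exact L.map_mem e x hp⟩
  invFun A :=
    { carrier v := {x | ∀ h : x ≠ M.zero v, El.mk M x h ∈ A.1}
      zero_mem v h := absurd rfl h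
      map_mem e x hx h := by
        have h0 : x ≠ M.zero _ := by rintro rfl; exact h (M.map_zero e)
        exact A.2 e _ _ (M.coef_arr_mk.2 rfl) (hx h0) }
  left_inv L := by
    ext v x
    refine ⟨fun h => ?_, fun h _ => h⟩
    by_cases h0 : x = M.zero v
    · rw [h0]; exact L.zero_mem v
    · exact h h0
  right_inv A := Subtype.ext (Set.ext fun p => ⟨fun h => h p.2, fun h _ => h⟩)

/-- The coefficient quiver of a direct sum. -/
noncomputable def dsumCoefIso (M N : F1Rep Q) :
    Coef.Iso (M.coef.sum N.coef) (dsum M N).coef :=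
  .ofEquiv (Equiv.ofBijective (Sum.elim
      (fun p => El.mk (dsum M N) ⟨(p.1.2, N.zero _), Or.inr rfl⟩
        fun h => p.2 (congrArg (fun z => z.1.1) h))
      (fun p => El.mk (dsum M N) ⟨(M.zero _, p.1.2), Or.inl rfl⟩
        fun h => p.2 (congrArg (fun z => z.1.2) h))) <| by
    constructor
    · have key : ∀ {p q : (dsum M N).El}, p = q → (⟨p.1.1, p.1.2.1⟩ : Σ v, M.X v × N.X v) =
          ⟨q.1.1, q.1.2.1⟩ := by rintro p _ rfl; rfl
      refine Function.Injective.sumElim ?_ ?_ ?_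
      · rintro ⟨⟨v, x⟩, hx⟩ ⟨⟨w, y⟩, hy⟩ h
        cases key h
        rfl
      · rintro ⟨⟨v, x⟩, hx⟩ ⟨⟨w, y⟩, hy⟩ h
        cases key h
        rfl
      · rintro ⟨⟨v, x⟩, hx⟩ ⟨⟨w, y⟩, hy⟩ h
        have h1 := key h
        obtain rfl : v = w := congrArg Sigma.fst h1
        have h2 : (x, N.zero v) = (M.zero v, y) := sigma_mk_injective (β := fun v => M.X v × N.X v) h1
        exact hx (congrArg Prod.fst h2)
    · rintro ⟨⟨v, ⟨x, y⟩, h⟩, h'⟩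
      rcases h with h | h
      · simp only at h
        subst h
        refine ⟨.inr (El.mk N y ?_), rfl⟩
        rintro rfl
        exact h' rfl
      · simp only at h
        subst h
        refine ⟨.inl (El.mk M x ?_), rfl⟩
        rintro rfl
        exact h' rfl)
    (by rintro (x | x) <;> rfl) <| by
    rintro e (⟨⟨v, x⟩, hx⟩ | ⟨⟨v, x⟩, hx⟩) (⟨⟨w, y⟩, hy⟩ | ⟨⟨w, y⟩, hy⟩) rfl rfl <;>
      refine (coef_arr_mk _).trans ((Subtype.ext_iff.trans Prod.ext_iff).trans ?_)
    · exact (and_iff_left (N.map_zero e)).trans (M.coef_arr_mk (hx := hx) (hy := hy)).symm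
    · exact ⟨fun h => absurd (h.2.symm.trans (N.map_zero e)) hy, fun h => h.elim⟩
    · exact ⟨fun h => absurd (h.1.symm.trans (M.map_zero e)) hy, fun h => h.elim⟩
    · exact (and_iff_right (M.map_zero e)).trans (N.coef_arr_mk (hx := hx) (hy := hy)).symm

end F1Rep

namespace Winding

variable {V' E' V E : Type} {S : FQuiver V' E'} {Q : FQuiver V E}

open Classical in
theorem rep_map_some [Finite V'] (c : Winding S Q) (e : E) (x : {x : V' // c.vmap x = Q.src e})
    (y : {y : V' // c.vmap y = Q.tgt e}) :
    c.rep.map e (some x) = some y ↔ c.coef.arr e x y := by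
  have h1 : c.rep.map e (some x) = if h : ∃ a, c.emap a = e ∧ S.src a = x.1 then
        some ⟨S.tgt h.choose, by rw [← c.tgt_comm, h.choose_spec.1]⟩ else none := rfl
  rw [h1]
  constructor
  · split_ifs with h
    · intro h2
      exact ⟨h.choose, h.choose_spec.1, h.choose_spec.2,
        congrArg Subtype.val (Option.some.inj h2)⟩
    · intro h2; exact h2.elim
  · rintro ⟨a, h2, h3, h4⟩
    have h : ∃ a, c.emap a = e ∧ S.src a = x.1 := ⟨a, h2, h3⟩
    rw [dif_pos h]
    refine congrArg some (Subtype.ext (Eq.trans ?_ h4))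
    exact congrArg S.tgt (c.src_inj _ _ (h.choose_spec.2.trans h3.symm)
      (h.choose_spec.1.trans h2.symm))

/-- A representation given by a winding has that winding as its coefficient quiver. -/
noncomputable def coefIso [Finite V'] (c : Winding S Q) : Coef.Iso c.rep.coef c.coef :=
  have key : ∀ p : c.rep.El, ∃ x : {x : V' // c.vmap x = p.1.1}, p.1.2 = some x := by
    rintro ⟨⟨v, x⟩, h⟩
    exact Option.ne_none_iff_exists'.1 h
  have hk : ∀ v (x y : {x : V' // c.vmap x = v}) h, (key ⟨⟨v, some x⟩, h⟩).choose = x :=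
    fun v x y h => (Option.some.inj (key ⟨⟨v, some x⟩, h⟩).choose_spec).symm
  have hk' : ∀ v (x y : {x : V' // c.vmap x = v}), y = x → ∀ h,
      F1Rep.El.mk c.rep (v := c.vmap y.1) (some ⟨y.1, rfl⟩) (Option.some_ne_none _) =
        ⟨⟨v, some x⟩, h⟩ := by
    rintro _ ⟨x, rfl⟩ _ rfl _
    rfl
  .ofEquiv
    { toFun p := (key p).choose.1
      invFun x := F1Rep.El.mk c.rep (v := c.vmap x) (some ⟨x, rfl⟩) (Option.some_ne_none _)
      left_inv := by
        rintro ⟨⟨v, x⟩, h⟩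
        match x, h with
        | none, h => exact absurd rfl h
        | some y, h => exact hk' v y _ (hk v y y h) h
      right_inv x := congrArg Subtype.val (hk _ ⟨x, rfl⟩ ⟨x, rfl⟩ _) }
    (fun p => (key p).choose.2) <| by
    rintro e ⟨⟨v, x⟩, hx⟩ ⟨⟨w, y⟩, hy⟩ rfl rfl
    match x, hx, y, hy with
    | none, hx, _, _ => exact absurd rfl hx
    | some x, hx, none, hy => exact absurd rfl hy
    | some x, hx, some y, hy =>
      refine Iff.trans ?_ (c.rep.coef_arr_mk (hx := hx) (hy := hy)).symm
      refine Iff.trans ?_ (c.rep_map_some e x y).symm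
      change c.coef.arr e (key _).choose.1 (key _).choose.1 ↔ _
      rw [hk _ x x, hk _ y y]

end Winding

/-- The coefficient quiver of the representation given by a coefficient quiver. -/
noncomputable def Coef.repCoefIso {V E X : Type} {Q : FQuiver V E} [Finite X] (D : Coef Q X) :
    Iso D.rep.coef D :=
  D.winding.coefIso.trans D.windingIso

/-! ### Evaluating elements of the Hall algebra at coefficient quivers -/

namespace F1Rep

variable {V E : Type} {Q : FQuiver V E}

theorem IsNilpotent.of_iso {M N : F1Rep Q} (h : M.IsNilpotent) (f : Nonempty (Iso M N)) :
    N.IsNilpotent :=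
  f.elim fun f => h.of_inj f.symm.toHom fun v => (f.app v).symm.injective

theorem nonempty_iso_iff {M N : F1Rep Q} : Nonempty (Iso M N) ↔ Nonempty (M.coef.Iso N.coef) :=
  ⟨fun ⟨f⟩ => ⟨f.coef⟩, fun ⟨f⟩ => nonempty_iso_of_coef f⟩

theorem nonempty_iso_rep {X : Type} [Finite X] {M : F1Rep Q} {D : Coef Q X} (f : M.coef.Iso D) :
    Nonempty (Iso M D.rep) :=
  nonempty_iso_of_coef (f.trans D.repCoefIso.symm)

instance : IsEmpty (zeroRep Q).El := ⟨fun p => p.2 rfl⟩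

end F1Rep

namespace Coef

variable {V E : Type} {Q : FQuiver V E} {X Y : Type}

theorem nonempty_iso_rep [Finite X] [Finite Y] {D : Coef Q X} {D' : Coef Q Y} (f : D.Iso D') :
    Nonempty (F1Rep.Iso D.rep D'.rep) :=
  F1Rep.nonempty_iso_rep (D.repCoefIso.trans f)

def Iso.ofIsEmpty [IsEmpty X] [IsEmpty Y] (D : Coef Q X) (D' : Coef Q Y) : D.Iso D' where
  toEquiv := Equiv.equivOfIsEmpty X Y
  pos_eq := isEmptyElim
  arr_iff _ := isEmptyElim

def Iso.sumIsEmpty [IsEmpty Y] (D : Coef Q X) (D' : Coef Q Y) : (D.sum D').Iso D where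
  toEquiv := Equiv.sumEmpty X Y
  pos_eq := by
    rintro (x | x)
    · rfl
    · exact isEmptyElim x
  arr_iff := by
    rintro e (x | x) (y | y)
    · rfl
    all_goals first | exact isEmptyElim x | exact isEmptyElim y

def Iso.isEmptySum [IsEmpty X] (D : Coef Q X) (D' : Coef Q Y) : (D.sum D').Iso D' where
  toEquiv := Equiv.emptySum X Y
  pos_eq := by
    rintro (x | x)
    · exact isEmptyElim x
    · rfl
  arr_iff := by
    rintro e (x | x) (y | y)
    · exact isEmptyElim x
    · exact isEmptyElim x
    · exact isEmptyElim y
    · rfl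

theorem not_conn_sum [Nonempty X] [Nonempty Y] (D : Coef Q X) (D' : Coef Q Y) :
    ¬ (D.sum D').Conn := by
  intro h
  obtain ⟨x⟩ := ‹Nonempty X›
  obtain ⟨y⟩ := ‹Nonempty Y›
  have hsep : (D.sum D').Separating (Set.range Sum.inl) := by
    rintro e (x | x) (y | y) h
    · exact iff_of_true ⟨x, rfl⟩ ⟨y, rfl⟩
    · exact h.elim
    · exact h.elim
    · simp
  rcases h.2 _ hsep with h' | h'
  · exact (Set.eq_empty_iff_forall_notMem.1 h') _ ⟨x, rfl⟩
  · obtain ⟨z, hz⟩ := (Set.eq_univ_iff_forall.1 h') (Sum.inr y)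
    exact Sum.inl_ne_inr hz

end Coef

namespace Hall

open F1Rep

variable {V E : Type} {Q : FQuiver V E} {X Y : Type}

open Classical in
/-- The value of an element of the Hall algebra at the class of the representation with coefficient
quiver `D`; it is `0` if that representation is not nilpotent. -/
noncomputable def ev (f : Hall Q) [Finite X] (D : Coef Q X) : ℂ :=
  if h : D.rep.IsNilpotent then f (.mk D.rep h) else 0

theorem ev_congr (f : Hall Q) [Finite X] [Finite Y] {D : Coef Q X} {D' : Coef Q Y}
    (i : D.Iso D') : f.ev D = f.ev D' := by
  have h := Coef.nonempty_iso_rep i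
  by_cases hD : D.rep.IsNilpotent
  · have hD' := hD.of_iso h
    rw [ev, ev, dif_pos hD, dif_pos hD']
    exact f.congr_iso _ _ h
  · have hD' : ¬ D'.rep.IsNilpotent := fun h' => hD (h'.of_iso (h.map Iso.symm))
    rw [ev, ev, dif_neg hD, dif_neg hD']

theorem apply_mk (f : Hall Q) [Finite X] {D : Coef Q X} {M : F1Rep Q} (hM : M.IsNilpotent)
    (i : M.coef.Iso D) : f (.mk M hM) = f.ev D := by
  have h := nonempty_iso_rep i
  rw [ev, dif_pos (hM.of_iso h)]
  exact f.congr_iso _ _ h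

theorem ev_add (f g : Hall Q) [Finite X] (D : Coef Q X) : (f + g).ev D = f.ev D + g.ev D := by
  unfold ev
  split_ifs
  · rfl
  · exact (add_zero 0).symm

theorem ev_smul (c : ℂ) (f : Hall Q) [Finite X] (D : Coef Q X) : (c • f).ev D = c * f.ev D := by
  unfold ev
  split_ifs
  · rfl
  · exact (mul_zero c).symm

theorem ev_zero [Finite X] (D : Coef Q X) : (0 : Hall Q).ev D = 0 := by
  unfold ev
  split_ifs <;> rfl

open Classical in
theorem cls_apply (M N : F1Rep Q) (hM : M.IsNilpotent) (hN : N.IsNilpotent) :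
    cls M hM (.mk N hN) = if Nonempty (Iso N M) then 1 else 0 := by
  change (Finsupp.single (NilIso.mk M hM) (1 : ℂ) : NilIso Q →₀ ℂ) _ = _
  rw [Finsupp.single_apply, eq_comm (a := NilIso.mk _ _), NilIso.mk_eq_iff]

open Classical in
theorem ev_cls (M : F1Rep Q) (hM : M.IsNilpotent) [Finite X] (D : Coef Q X) :
    (cls M hM).ev D = if Nonempty (D.Iso M.coef) then 1 else 0 := by
  have h : Nonempty (Iso D.rep M) ↔ Nonempty (D.Iso M.coef) :=
    nonempty_iso_iff.trans ⟨fun ⟨i⟩ => ⟨D.repCoefIso.symm.trans i⟩,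
      fun ⟨i⟩ => ⟨D.repCoefIso.trans i⟩⟩
  unfold ev
  split_ifs with h1 h2 h2
  · rw [cls_apply, if_pos (h.2 h2)]
  · rw [cls_apply, if_neg (mt h.1 h2)]
  · exact absurd (hM.of_iso ((h.2 h2).map Iso.symm)) h1
  · rfl

open Classical in
theorem one_apply_mk (M : F1Rep Q) (hM : M.IsNilpotent) :
    (1 : Hall Q) (.mk M hM) = if IsEmpty M.El then 1 else 0 := by
  rw [one_apply]
  refine if_congr (nonempty_iso_iff.trans ⟨fun ⟨i⟩ => ?_, fun h => ⟨.ofIsEmpty _ _⟩⟩) rfl rfl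
  exact i.toEquiv.isEmpty

variable [Finite V] [Finite E]

open Classical in
/-- The product of the Hall algebra, as a sum over closed vertex sets of a coefficient quiver. -/
theorem ev_mul (f g : Hall Q) [Fintype X] {D : Coef Q X} (hD : D.rep.IsNilpotent) :
    (f * g).ev D = ∑ A : Set X,
      if D.Closed A then f.ev (D.restrict Aᶜ) * g.ev (D.restrict A) else 0 := by
  rw [ev, dif_pos hD, mul_apply, ← Finset.sum_filter]
  let i := D.repCoefIso.symm
  refine Finset.sum_bij (fun L _ => i.toEquiv ⁻¹' L.set) ?_ ?_ ?_ ?_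
  · intro L _
    exact Finset.mem_filter.2 ⟨Finset.mem_univ _, ((Sub.equivClosed _ L).2).preimage i⟩
  · intro L _ L' _ h
    have h1 : L.set = L'.set := i.toEquiv.surjective.preimage_injective h
    exact (Sub.equivClosed _).injective (Subtype.ext h1)
  · intro A hA
    have hA' := (Finset.mem_filter.1 hA).2.preimage i.symm
    obtain ⟨L, hL⟩ := (Sub.equivClosed D.rep).surjective ⟨_, hA'⟩
    refine ⟨L, Finset.mem_univ _, ?_⟩
    have h1 : L.set = i.symm.toEquiv ⁻¹' A := congrArg Subtype.val hL
    rw [h1, ← Set.preimage_comp]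
    change (fun x => i.toEquiv.symm (i.toEquiv x)) ⁻¹' A = A
    simp
  · intro L _
    rw [apply_mk f (hD.quot L) (L.coefIsoQuot.symm.trans (i.restrict _).symm),
      apply_mk g (hD.toRep L) (L.coefIso.symm.trans (i.restrict _).symm)]
    rfl

open Classical in
theorem ev_lie (f g : Hall Q) [Fintype X] {D : Coef Q X} (hD : D.rep.IsNilpotent) :
    ⁅f, g⁆.ev D = ∑ A : Set X, if D.Closed A then
      f.ev (D.restrict Aᶜ) * g.ev (D.restrict A) - g.ev (D.restrict Aᶜ) * f.ev (D.restrict A)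
        else 0 := by
  have h : ⁅f, g⁆ = f * g + (-1 : ℂ) • (g * f) := by
    rw [LieRing.of_associative_ring_bracket, neg_one_smul, sub_eq_add_neg]
  rw [h, ev_add, ev_smul, ev_mul f g hD, ev_mul g f hD, Finset.mul_sum,
    ← Finset.sum_add_distrib]
  refine Finset.sum_congr rfl fun A _ => ?_
  split_ifs <;> ring

open Classical in
/-- The bracket as a sum over all ways to cut a coefficient quiver into two pieces, each pair of
pieces occurring twice. -/
theorem two_mul_ev_lie (f g : Hall Q) [Fintype X] {D : Coef Q X} (hD : D.rep.IsNilpotent) :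
    2 * ⁅f, g⁆.ev D = ∑ A : Set X,
      ((if D.Closed Aᶜ then 1 else 0) - (if D.Closed A then 1 else 0)) *
        (f.ev (D.restrict A) * g.ev (D.restrict Aᶜ) -
          g.ev (D.restrict A) * f.ev (D.restrict Aᶜ)) := by
  have h1 := ev_lie f g hD
  have h2 : ⁅f, g⁆.ev D = ∑ A : Set X, if D.Closed Aᶜ then
      f.ev (D.restrict A) * g.ev (D.restrict Aᶜ) - g.ev (D.restrict A) * f.ev (D.restrict Aᶜ)
        else 0 := by
    rw [h1]
    refine Fintype.sum_equiv (compl_involutive (α := Set X)).toPerm _ _ fun A => ?_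
    change _ = if D.Closed Aᶜᶜ then _ * g.ev (D.restrict Aᶜᶜ) - _ * f.ev (D.restrict Aᶜᶜ) else 0
    rw [compl_compl]
    rfl
  rw [two_mul]
  -- Each cut is counted once for `A` and once for the complement of `A`.
  nth_rewrite 1 [h2]
  rw [h1, ← Finset.sum_add_distrib]
  refine Finset.sum_congr rfl fun A _ => ?_
  split_ifs <;> ring

end Hall

namespace hallLie

open F1Rep

variable {V E : Type} {Q : FQuiver V E} {X Y : Type} [Finite V] [Finite E]

/-- Primitive elements are supported on the connected representations. -/
theorem ev_eq_zero {f : Hall Q} (hf : f ∈ hallLie Q) [Finite X] {D : Coef Q X}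
    (h : ¬ D.Conn) : f.ev D = 0 := by
  classical
  have hp := (Hall.isPrimitive_iff f).1 hf
  by_cases hD : D.rep.IsNilpotent
  swap
  · exact dif_neg hD
  rcases isEmpty_or_nonempty X with hX | hX
  · have h1 := hp _ hD _ hD
    have hE : IsEmpty D.rep.El := D.repCoefIso.toEquiv.isEmpty
    rw [Hall.one_apply_mk, if_pos hE, Hall.apply_mk f _ (D := D)
      ((dsumCoefIso _ _).symm.trans ((Coef.Iso.sumIsEmpty _ _).trans D.repCoefIso)),
      Hall.apply_mk f hD D.repCoefIso] at h1
    linear_combination -h1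
  · simp only [Coef.Conn, hX, true_and, not_forall, not_or] at h
    obtain ⟨A, hA, hA1, hA2⟩ := h
    have i := Coef.nonempty_iso_rep (Coef.Iso.sumRestrict hA)
    have j : ((dsum (D.restrict A).rep (D.restrict Aᶜ).rep).coef).Iso D :=
      (dsumCoefIso _ _).symm.trans ((Coef.Iso.sumCongr (Coef.repCoefIso _)
        (Coef.repCoefIso _)).trans (Coef.Iso.sumRestrict hA))
    have hN : (dsum (D.restrict A).rep (D.restrict Aᶜ).rep).IsNilpotent :=
      hD.of_iso ((nonempty_iso_rep j).map Iso.symm)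
    have h1 : (D.restrict A).rep.IsNilpotent :=
      hN.of_inj (Hom.inl _ _) fun v x y h => congrArg (fun z => z.1.1) h
    have h2 : (D.restrict Aᶜ).rep.IsNilpotent :=
      hN.of_inj (Hom.inr _ _) fun v x y h => congrArg (fun z => z.1.2) h
    have h3 := hp _ h1 _ h2
    have e1 : ¬ IsEmpty (D.restrict A).rep.El := fun h => by
      have := (Coef.repCoefIso (D.restrict A)).toEquiv.symm.isEmpty
      exact hA1 (Set.isEmpty_coe_sort.1 this)
    have e2 : ¬ IsEmpty (D.restrict Aᶜ).rep.El := fun h => by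
      have := (Coef.repCoefIso (D.restrict Aᶜ)).toEquiv.symm.isEmpty
      exact hA2 (Set.compl_empty_iff.1 (Set.isEmpty_coe_sort.1 this))
    rwa [Hall.one_apply_mk, Hall.one_apply_mk, if_neg e1, if_neg e2, mul_zero, zero_mul, add_zero,
      Hall.apply_mk f _ j] at h3

/-- Classes of connected representations are primitive. -/
theorem cls_mem {M : F1Rep Q} (hM : M.IsNilpotent) (h : M.coef.Conn) :
    Hall.cls M hM ∈ hallLie Q := by
  classical
  refine (Hall.isPrimitive_iff _).2 fun A hA B hB => ?_
  have h0 : ∀ C hC, IsEmpty C.El → Hall.cls M hM (.mk C hC) = 0 := fun C hC hE => by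
    rw [Hall.apply_mk _ hC (.refl _), Hall.ev_cls, if_neg]
    rintro ⟨i⟩
    exact h.1.elim fun x => hE.elim (i.toEquiv.symm x)
  have hsum : Hall.cls M hM (.mk (dsum A B) (hA.dsum hB)) =
      if Nonempty ((A.coef.sum B.coef).Iso M.coef) then 1 else 0 := by
    rw [Hall.apply_mk _ _ (dsumCoefIso A B).symm, Hall.ev_cls]
  have hc : ∀ C hC, Hall.cls M hM (.mk C hC) = if Nonempty (C.coef.Iso M.coef) then 1 else 0 :=
    fun C hC => by rw [Hall.cls_apply, nonempty_iso_iff]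
  rcases isEmpty_or_nonempty A.El with hA' | hA'
  · rw [h0 _ hA hA', zero_mul, zero_add, Hall.one_apply_mk, if_pos hA', one_mul, hsum, hc]
    exact if_congr ⟨fun ⟨i⟩ => ⟨(Coef.Iso.isEmptySum _ _).symm.trans i⟩,
      fun ⟨i⟩ => ⟨(Coef.Iso.isEmptySum _ _).trans i⟩⟩ rfl rfl
  rcases isEmpty_or_nonempty B.El with hB' | hB'
  · rw [h0 _ hB hB', mul_zero, add_zero, Hall.one_apply_mk, if_pos hB', mul_one, hsum, hc]
    exact if_congr ⟨fun ⟨i⟩ => ⟨(Coef.Iso.sumIsEmpty _ _).symm.trans i⟩,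
      fun ⟨i⟩ => ⟨(Coef.Iso.sumIsEmpty _ _).trans i⟩⟩ rfl rfl
  · rw [hsum, if_neg fun ⟨i⟩ => Coef.not_conn_sum _ _ (h.of_iso i.symm), Hall.one_apply_mk,
      Hall.one_apply_mk, if_neg (not_isEmpty_iff.2 hA'), if_neg (not_isEmpty_iff.2 hB')]
    ring

/-- A primitive element is a combination of the classes of connected representations at which it
does not vanish. -/
theorem mem_span (f : hallLie Q) (P : Set (hallLie Q))
    (h : ∀ M hM (hc : M.coef.Conn), f.1 (.mk M hM) ≠ 0 →
      (⟨Hall.cls M hM, cls_mem hM hc⟩ : hallLie Q) ∈ P) : f ∈ Submodule.span ℂ P := by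
  have key : (f : Hall Q) ∈ (Submodule.span ℂ P).map (hallLie Q).toSubmodule.subtype := by
    have h1 : (f : Hall Q) =
        ((f : Hall Q) : NilIso Q →₀ ℂ).sum fun x c => c • (Finsupp.single x 1 : NilIso Q →₀ ℂ) := by
      simp only [Finsupp.smul_single, smul_eq_mul, mul_one]
      exact (Finsupp.sum_single _).symm
    rw [h1]
    refine Submodule.sum_mem _ fun x hx => Submodule.smul_mem _ _ ?_
    have hx' : f.1 x ≠ 0 := Finsupp.mem_support_iff.1 hx
    induction x using NilIso.ind with
    | h M hM =>
      have hc : M.coef.Conn := by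
        by_contra hc
        exact hx' ((Hall.apply_mk f.1 hM (.refl _)).trans (ev_eq_zero f.2 hc))
      exact ⟨_, Submodule.subset_span (h M hM hc hx'), rfl⟩
  obtain ⟨g, hg, hfg⟩ := key
  obtain rfl : g = f := Subtype.ext hfg
  exact hg

/-- Primitive elements that agree at all connected representations are equal. -/
theorem ext_conn {f g : hallLie Q}
    (h : ∀ M : F1Rep Q, M.IsNilpotent → M.coef.Conn → f.1.ev M.coef = g.1.ev M.coef) :
    f = g := by
  refine Subtype.ext (Hall.ext fun M hM => ?_)
  rw [Hall.apply_mk f.1 hM (.refl _), Hall.apply_mk g.1 hM (.refl _)]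
  by_cases hc : M.coef.Conn
  · exact h M hM hc
  · rw [ev_eq_zero f.2 hc, ev_eq_zero g.2 hc]

end hallLie

/-! ### Thin representations of trees -/

namespace FQuiver

open F1Rep

variable {V E : Type} {T : SimpleGraph V} {Q : FQuiver V E}

namespace IsOrientation

theorem adj (hQ : Q.IsOrientation T) (e : E) : T.Adj (Q.src e) (Q.tgt e) := by
  have h : Q.ends e ∈ T.edgeSet := hQ.2 ▸ ⟨e, rfl⟩
  exact h

theorem exists_arrow (hQ : Q.IsOrientation T) {v w : V} (h : T.Adj v w) :
    ∃ e, Q.ends e = s(v, w) := by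
  have h' : s(v, w) ∈ Set.range Q.ends := hQ.2 ▸ h
  exact h'

/-- An oriented path is a walk without backtracking. -/
theorem exists_walk (hQ : Q.IsOrientation T) {u w : V} {k : ℕ} (p : Q.Path u w k) :
    ∃ q : T.Walk w u, q.length = k ∧ q.edges.IsChain (· ≠ ·) ∧
      ∀ x ∈ q.edges.head?, ∃ e, Q.ends e = x ∧ Q.tgt e = w := by
  induction p with
  | nil => exact ⟨.nil, rfl, by simp, by simp⟩
  | cons e p ih =>
    obtain ⟨q, h1, h2, h3⟩ := ih
    refine ⟨.cons (hQ.adj e).symm q, by simp [h1], ?_, ?_⟩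
    · rw [SimpleGraph.Walk.edges_cons, List.isChain_cons]
      refine ⟨fun y hy h => ?_, h2⟩
      obtain ⟨e', rfl, h'⟩ := h3 y hy
      have : e = e' := hQ.1 (Sym2.eq_swap.trans h)
      subst this
      exact (hQ.adj e).ne h'.symm
    · intro x hx
      simp only [SimpleGraph.Walk.edges_cons, List.head?_cons, Option.mem_some_iff] at hx
      exact ⟨e, Sym2.eq_swap.trans hx, rfl⟩

/-- Representations of trees are nilpotent, as there are no long paths. -/
theorem isNilpotent [Finite V] (hQ : Q.IsOrientation T) (hT : T.IsAcyclic) (M : F1Rep Q) :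
    M.IsNilpotent := by
  cases nonempty_fintype V
  refine ⟨Fintype.card V, fun k hk u w p => ?_⟩
  obtain ⟨q, h1, h2, -⟩ := hQ.exists_walk p
  have h3 := ((hT.isPath_iff_isChain q).2 h2).length_lt
  omega

end IsOrientation

/-- The coefficient quiver of a thin representation. -/
def subCoef (Q : FQuiver V E) (S : T.Subgraph) : Coef Q S.verts := (Q.subWinding S).coef

theorem subCoef_arr {S : T.Subgraph} {e : E} {x y : S.verts} :
    (Q.subCoef S).arr e x y ↔ S.Adj (Q.src e) (Q.tgt e) ∧ Q.src e = x ∧ Q.tgt e = y := by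
  constructor
  · rintro ⟨⟨e, h⟩, rfl, rfl, rfl⟩
    exact ⟨h, rfl, rfl⟩
  · rintro ⟨h1, h2, h3⟩
    exact ⟨⟨e, h1⟩, rfl, Subtype.ext h2, Subtype.ext h3⟩

/-- The coefficient quiver of a thin representation remembers the subgraph. -/
theorem IsOrientation.eq_of_iso (hQ : Q.IsOrientation T) {S S' : T.Subgraph}
    (i : (Q.subCoef S).Iso (Q.subCoef S')) : S = S' := by
  have key : ∀ {S S' : T.Subgraph} (i : (Q.subCoef S).Iso (Q.subCoef S')), S ≤ S' := by
    intro S S' i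
    have hp : ∀ x, (i.toEquiv x : V) = x := i.pos_eq
    refine ⟨fun v hv => Set.mem_of_eq_of_mem (hp ⟨v, hv⟩).symm (i.toEquiv ⟨v, hv⟩).2, fun v w h => ?_⟩
    obtain ⟨e, he⟩ := hQ.exists_arrow h.adj_sub
    have h1 : Q.ends e ∈ S.edgeSet := he ▸ h
    have h2 : (Q.subCoef S).arr e ⟨Q.src e, S.edge_vert h1⟩ ⟨Q.tgt e, S.edge_vert h1.symm⟩ :=
      subCoef_arr.2 ⟨h1, rfl, rfl⟩
    have h3 : Q.ends e ∈ S'.edgeSet := (subCoef_arr.1 ((i.arr_iff _ _ _).2 h2)).1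
    rwa [he] at h3
  exact le_antisymm (key i) (key i.symm)

/-- A thin representation is connected if and only if its support is. -/
theorem IsOrientation.conn_iff (hQ : Q.IsOrientation T) (S : T.Subgraph) :
    (Q.subCoef S).Conn ↔ S.Connected := by
  rw [SimpleGraph.Subgraph.connected_iff', SimpleGraph.connected_iff, and_comm, Coef.Conn]
  refine and_congr_right fun hne => ⟨fun h x => ?_, fun h A hA => ?_⟩
  · have hsep : (Q.subCoef S).Separating {y | S.coe.Reachable x y} := by
      intro e y z hyz
      have h1 := subCoef_arr.1 hyz
      have h2 : S.coe.Adj y z := by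
        change S.Adj y z
        rw [← h1.2.1, ← h1.2.2]
        exact h1.1
      exact ⟨fun h => h.trans h2.reachable, fun h => h.trans h2.symm.reachable⟩
    rcases h _ hsep with h' | h'
    · exact absurd (SimpleGraph.Reachable.refl x) (Set.eq_empty_iff_forall_notMem.1 h' x)
    · exact Set.eq_univ_iff_forall.1 h'
  · have hstep : ∀ x y, S.coe.Adj x y → (x ∈ A ↔ y ∈ A) := by
      intro x y hxy
      have hxy' : S.Adj x y := hxy
      obtain ⟨e, he⟩ := hQ.exists_arrow hxy'.adj_sub
      have h1 : Q.ends e ∈ S.edgeSet := he ▸ hxy'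
      rcases Sym2.eq_iff.1 he with ⟨h2, h3⟩ | ⟨h2, h3⟩
      · exact hA e x y (subCoef_arr.2 ⟨h1, h2, h3⟩)
      · exact (hA e y x (subCoef_arr.2 ⟨h1, h2, h3⟩)).symm
    rcases A.eq_empty_or_nonempty with h' | ⟨x, hx⟩
    · exact Or.inl h'
    · right
      rw [Set.eq_univ_iff_forall]
      intro y
      obtain ⟨p⟩ := h x y
      clear h
      induction p with
      | nil => exact hx
      | cons h p ih => exact ih ((hstep _ _ h).1 hx)

/-- Restricting a thin representation amounts to restricting the support. -/
def subCoefRestrict (Q : FQuiver V E) (S : T.Subgraph) (A : Set S.verts) :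
    ((Q.subCoef S).restrict A).Iso (Q.subCoef (S.induce (Subtype.val '' A))) where
  toEquiv :=
    { toFun x := ⟨x.1.1, x.1, x.2, rfl⟩
      invFun x := ⟨⟨x.1, by obtain ⟨y, -, h⟩ := x.2; exact h ▸ y.2⟩, by
        obtain ⟨y, hy, h⟩ := x.2
        have : y = ⟨x.1, h ▸ y.2⟩ := Subtype.ext h
        exact this ▸ hy⟩
      left_inv _ := rfl
      right_inv _ := rfl }
  pos_eq _ := rfl
  arr_iff e x y := by
    refine subCoef_arr.trans (Iff.trans ?_ subCoef_arr.symm)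
    refine and_congr_left fun h => ?_
    rw [SimpleGraph.Subgraph.induce_adj]
    exact ⟨fun h => h.2.2, fun h' => ⟨⟨x.1, x.2, h.1.symm⟩, ⟨y.1, y.2, h.2.symm⟩, h'⟩⟩

section Classification

variable {X : Type} (hQ : Q.IsOrientation T) (D : Coef Q X)

/-- The underlying graph of a coefficient quiver over a tree. -/
def IsOrientation.graph : SimpleGraph X where
  Adj x y := ∃ e, D.arr e x y ∨ D.arr e y x
  symm := ⟨fun _ _ ⟨e, h⟩ => ⟨e, h.symm⟩⟩
  loopless := ⟨fun x ⟨e, h⟩ => by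
    have h := h.elim id id
    exact (hQ.adj e).ne ((D.pos_src h).symm.trans (D.pos_tgt h))⟩

theorem IsOrientation.ends_eq {D : Coef Q X} {e : E} {x y : X} (h : D.arr e x y ∨ D.arr e y x) :
    Q.ends e = s(D.pos x, D.pos y) := by
  rcases h with h | h
  · rw [D.pos_src h, D.pos_tgt h]; rfl
  · rw [D.pos_src h, D.pos_tgt h]; exact Sym2.eq_swap

/-- The projection of the coefficient quiver to the tree. -/
def IsOrientation.graphHom : hQ.graph D →g T where
  toFun := D.pos
  map_rel' {x y} := by
    rintro ⟨e, h⟩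
    have h1 : Q.ends e ∈ T.edgeSet := hQ.adj e
    rwa [ends_eq h] at h1

/-- As the projection to the tree is locally injective, it maps paths to walks without
backtracking. -/
theorem IsOrientation.isChain_map {x y : X} (p : (hQ.graph D).Walk x y) (hp : p.IsPath) :
    (p.map (hQ.graphHom D)).edges.IsChain (· ≠ ·) := by
  induction p with
  | nil => simp
  | @cons u v w h p ih =>
    rw [SimpleGraph.Walk.cons_isPath_iff] at hp
    rw [SimpleGraph.Walk.map_cons, SimpleGraph.Walk.edges_cons, List.isChain_cons]
    refine ⟨fun z hz hne => ?_, ih hp.1⟩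
    match p, hp.2, hz with
    | .nil, _, hz => simp at hz
    | .cons (v := t) h' p', h2, hz =>
      simp only [SimpleGraph.Walk.map_cons, SimpleGraph.Walk.edges_cons, List.head?_cons,
        Option.mem_some_iff] at hz
      subst hz
      obtain ⟨e, he⟩ := h
      obtain ⟨e', he'⟩ := h'
      have : e = e' := hQ.1 ((ends_eq he).trans (hne.trans (ends_eq he').symm))
      subst this
      have hut : u ≠ t := by
        rintro rfl
        exact h2 (List.mem_cons_of_mem _ p'.start_mem_support)
      have hl : Q.src e ≠ Q.tgt e := (hQ.adj e).ne
      rcases he with he | he <;> rcases he' with he' | he'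
      · exact hl ((D.pos_src he').symm.trans (D.pos_tgt he))
      · exact hut (D.left_unique he he')
      · exact hut (D.right_unique he he')
      · exact hl ((D.pos_src he).symm.trans (D.pos_tgt he'))

theorem IsOrientation.pos_injective (hQ : Q.IsOrientation T) (hT : T.IsAcyclic) {D : Coef Q X}
    (hD : D.Conn) : Function.Injective D.pos := by
  intro x y hxy
  have hsep : D.Separating {z | (hQ.graph D).Reachable x z} := by
    intro e u v huv
    have h2 : (hQ.graph D).Adj u v := ⟨e, Or.inl huv⟩
    exact ⟨fun h => h.trans h2.reachable, fun h => h.trans h2.symm.reachable⟩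
  have hr : (hQ.graph D).Reachable x y := by
    rcases hD.2 _ hsep with h' | h'
    · exact absurd (SimpleGraph.Reachable.refl x) (Set.eq_empty_iff_forall_notMem.1 h' x)
    · exact Set.eq_univ_iff_forall.1 h' y
  obtain ⟨p, hp⟩ := hr.exists_isPath
  have h1 := (hT.isPath_iff_isChain _).2 (hQ.isChain_map D p hp)
  have h2 : ∀ {v w} (q : T.Walk v w), v = w → q.IsPath → q.length = 0 := by
    rintro v _ q rfl h
    exact SimpleGraph.Walk.length_eq_zero_iff.2 (SimpleGraph.Walk.isPath_iff_nil.1 h)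
  have h3 : (p.map (hQ.graphHom D)).length = 0 := h2 _ hxy h1
  exact SimpleGraph.Walk.eq_of_length_eq_zero ((SimpleGraph.Walk.length_map _ _).symm.trans h3)

/-- The image of a coefficient quiver in the tree. -/
def IsOrientation.support : T.Subgraph where
  verts := Set.range D.pos
  Adj v w := ∃ e x y, D.arr e x y ∧ Q.ends e = s(v, w)
  adj_sub {v w} := by
    rintro ⟨e, x, y, -, h⟩
    have h1 : Q.ends e ∈ T.edgeSet := hQ.adj e
    rwa [h] at h1
  edge_vert {v w} := by
    rintro ⟨e, x, y, h, h'⟩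
    rw [ends_eq (Or.inl h)] at h'
    rcases Sym2.eq_iff.1 h' with ⟨h1, -⟩ | ⟨-, h1⟩
    exacts [⟨x, h1⟩, ⟨y, h1⟩]
  symm := ⟨fun v w ⟨e, x, y, h, h'⟩ => ⟨e, x, y, h, h'.trans Sym2.eq_swap⟩⟩

/-- Connected representations of trees are thin. -/
theorem IsOrientation.exists_iso_subCoef (hQ : Q.IsOrientation T) (hT : T.IsAcyclic) {D : Coef Q X}
    (hD : D.Conn) : ∃ S : T.Subgraph, S.Connected ∧ Nonempty (D.Iso (Q.subCoef S)) := by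
  have hinj := hQ.pos_injective hT hD
  have i : D.Iso (Q.subCoef (hQ.support D)) :=
    { toEquiv := Equiv.ofInjective D.pos hinj
      pos_eq := fun _ => rfl
      arr_iff := fun e x y => by
        rw [subCoef_arr]
        constructor
        · rintro ⟨⟨e', x', y', h, he⟩, h1, h2⟩
          obtain rfl : e' = e := hQ.1 he
          obtain rfl : x' = x := hinj ((D.pos_src h).trans h1)
          obtain rfl : y' = y := hinj ((D.pos_tgt h).trans h2)
          exact h
        · intro h
          exact ⟨⟨e, x, y, h, rfl⟩, (D.pos_src h).symm, (D.pos_tgt h).symm⟩ }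
  exact ⟨_, (hQ.conn_iff _).1 (hD.of_iso i), ⟨i⟩⟩

end Classification

/-! ### Reversing arrows of a tree -/

/-- If a connected subgraph of a tree is cut into two connected pieces, then exactly one edge
joins the pieces. -/
theorem IsOrientation.exists_unique_crossing (hQ : Q.IsOrientation T) (hT : T.IsAcyclic)
    {S : T.Subgraph} (hS : S.Connected) {A : Set S.verts} (hA : ((Q.subCoef S).restrict A).Conn)
    (hA' : ((Q.subCoef S).restrict Aᶜ).Conn) :
    ∃ x ∈ A, ∃ y ∉ A, S.Adj x y ∧ ∀ x' ∈ A, ∀ y' ∉ A, S.Adj x' y' → x' = x ∧ y' = y := by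
  have hcross : ∃ x ∈ A, ∃ y ∉ A, S.Adj x y := by
    by_contra! hno
    have hsep : (Q.subCoef S).Separating A := by
      intro e x y h
      have h1 := subCoef_arr.1 h
      rw [h1.2.1, h1.2.2] at h1
      by_contra hne
      by_cases hx : x ∈ A
      · exact hno x hx y (fun hy => hne (iff_of_true hx hy)) h1.1
      · exact hno y (by_contra fun hy => hne (iff_of_false hx hy)) x hx h1.1.symm
    rcases ((hQ.conn_iff S).2 hS).2 A hsep with h | h
    · obtain ⟨x⟩ := hA.1
      exact (Set.eq_empty_iff_forall_notMem.1 h) x x.2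
    · obtain ⟨x⟩ := hA'.1
      exact x.2 (Set.eq_univ_iff_forall.1 h x)
  obtain ⟨x, hx, y, hy, hxy⟩ := hcross
  refine ⟨x, hx, y, hy, hxy, fun x' hx' y' hy' hxy' => ?_⟩
  -- A second edge would connect `x` to `y` in the tree without the edge `xy`.
  let G := T.deleteEdges {s((x : V), (y : V))}
  have hbr : ¬ G.Reachable x y := SimpleGraph.isBridge_iff.1
    (SimpleGraph.isAcyclic_iff_forall_adj_isBridge.1 hT hxy.adj_sub)
  have hreach : ∀ (B : Set S.verts), ((Q.subCoef S).restrict B).Conn →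
      (x ∉ B ∨ y ∉ B) → ∀ u v, u ∈ B → v ∈ B → G.Reachable u v := by
    intro B hB hxB u v hu hv
    have hsep : ((Q.subCoef S).restrict B).Separating {z | G.Reachable u z.1} := by
      intro e z w h
      have h1 := subCoef_arr.1 h
      rw [h1.2.1, h1.2.2] at h1
      have h2 : G.Adj z.1 w.1 := by
        refine SimpleGraph.deleteEdges_adj.2 ⟨h1.1.adj_sub, fun h' => ?_⟩
        rcases Sym2.eq_iff.1 h' with ⟨h3, h4⟩ | ⟨h3, h4⟩
        · have h5 := Subtype.ext h3
          have h6 := Subtype.ext h4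
          exact hxB.elim (fun h => h (h5 ▸ z.2)) fun h => h (h6 ▸ w.2)
        · have h5 := Subtype.ext h3
          have h6 := Subtype.ext h4
          exact hxB.elim (fun h => h (h6 ▸ w.2)) fun h => h (h5 ▸ z.2)
      exact ⟨fun h => h.trans h2.reachable, fun h => h.trans h2.symm.reachable⟩
    rcases hB.2 _ hsep with h' | h'
    · exact absurd (SimpleGraph.Reachable.refl _)
        (Set.eq_empty_iff_forall_notMem.1 h' ⟨u, hu⟩)
    · exact Set.eq_univ_iff_forall.1 h' ⟨v, hv⟩
  by_contra hne
  refine hbr ((hreach A hA (Or.inr hy) x x' hx hx').trans (SimpleGraph.Reachable.trans ?_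
    (hreach Aᶜ hA' (Or.inl fun h => h hx) y' y hy' hy)))
  refine SimpleGraph.Adj.reachable (SimpleGraph.deleteEdges_adj.2 ⟨hxy'.adj_sub, fun h => ?_⟩)
  rcases Sym2.eq_iff.1 h with ⟨h3, h4⟩ | ⟨h3, h4⟩
  · exact hne ⟨Subtype.ext h3, Subtype.ext h4⟩
  · exact hy (Subtype.ext h3 ▸ hx')

/-- If there is only one edge from `A` to its complement, then its direction decides which of the
two sets is closed. -/
theorem IsOrientation.closed_iff_of_crossing (hQ : Q.IsOrientation T) {S : T.Subgraph}
    {A : Set S.verts} {x y : S.verts} (hx : x ∈ A) (hy : y ∉ A)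
    (huniq : ∀ x' ∈ A, ∀ y' ∉ A, S.Adj x' y' → x' = x ∧ y' = y) (hxy : S.Adj x y)
    {e : E} (he : Q.ends e = s(↑x, ↑y)) :
    ((Q.subCoef S).Closed Aᶜ ↔ Q.src e = x) ∧ ((Q.subCoef S).Closed A ↔ Q.src e ≠ x) := by
  have hne : (x : V) ≠ y := hxy.adj_sub.ne
  have hadj : S.Adj (Q.src e) (Q.tgt e) := by
    have h : Q.ends e ∈ S.edgeSet := he ▸ hxy
    exact h
  have hend := Sym2.eq_iff.1 he
  have huniq' : ∀ e', ∀ x' y' : S.verts, (Q.subCoef S).arr e' x' y' ∨ (Q.subCoef S).arr e' y' x' →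
      x' ∈ A → y' ∉ A → e' = e ∧ x' = x ∧ y' = y := by
    intro e' x' y' h hx' hy'
    have h1 : S.Adj x' y' ∧ Q.ends e' = s(↑x', ↑y') := by
      refine ⟨?_, IsOrientation.ends_eq h⟩
      rcases h with h | h
      · have := subCoef_arr.1 h
        rw [← this.2.1, ← this.2.2]; exact this.1
      · have := subCoef_arr.1 h
        rw [← this.2.1, ← this.2.2]; exact this.1.symm
    obtain ⟨rfl, rfl⟩ := huniq x' hx' y' hy' h1.1
    exact ⟨hQ.1 (h1.2.trans he.symm), rfl, rfl⟩
  refine ⟨⟨fun h => ?_, fun h e' u v huv hu hv => ?_⟩, ⟨fun h h' => ?_, fun h e' u v huv hu => ?_⟩⟩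
  · rcases hend with h' | h'
    · exact h'.1
    · exact absurd hx (h e y x (subCoef_arr.2 ⟨hadj, h'.1, h'.2⟩) hy)
  · obtain ⟨rfl, rfl, rfl⟩ := huniq' e' v u (Or.inr huv) hv hu
    exact hne (h.symm.trans (subCoef_arr.1 huv).2.1)
  · rcases hend with h'' | h''
    · exact hy (h e x y (subCoef_arr.2 ⟨hadj, h''.1, h''.2⟩) hx)
    · exact hne (h'.symm.trans h''.1)
  · by_contra hv
    obtain ⟨rfl, rfl, rfl⟩ := huniq' e' u v (Or.inl huv) hu hv
    exact h (subCoef_arr.1 huv).2.1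

variable {E' : Type} {Q' : FQuiver V E'}

/-- The reversed edges of a subgraph that is cut in two: those of the pieces, and possibly the edge
joining them. -/
theorem IsOrientation.numReversed_eq [Finite E] (hQ : Q.IsOrientation T)
    {S : T.Subgraph}
    {A : Set S.verts} {x y : S.verts} (hx : x ∈ A) (hy : y ∉ A)
    (huniq : ∀ x' ∈ A, ∀ y' ∉ A, S.Adj x' y' → x' = x ∧ y' = y) (hxy : S.Adj x y)
    {e : E} (he : Q.ends e = s(↑x, ↑y))
    [Decidable (∃ e' : E', Q'.src e' = Q.tgt e ∧ Q'.tgt e' = Q.src e)] :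
    Q.numReversed Q' S = Q.numReversed Q' (S.induce (Subtype.val '' A)) +
      Q.numReversed Q' (S.induce (Subtype.val '' Aᶜ)) +
      if ∃ e' : E', Q'.src e' = Q.tgt e ∧ Q'.tgt e' = Q.src e then 1 else 0 := by
  let rev : E → Prop := fun e => ∃ e' : E', Q'.src e' = Q.tgt e ∧ Q'.tgt e' = Q.src e
  let R : T.Subgraph → Set E := fun S => {e | Q.ends e ∈ S.edgeSet ∧ rev e}
  let C : Set E := {e' | e' = e ∧ rev e}
  have hR : ∀ S, Q.numReversed Q' S = (R S).ncard := fun S => rfl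
  have hmem : ∀ (B : Set S.verts) e, Q.ends e ∈ (S.induce (Subtype.val '' B)).edgeSet ↔
      ∃ u ∈ B, ∃ v ∈ B, Q.src e = u ∧ Q.tgt e = v ∧ S.Adj u v := by
    intro B e
    refine SimpleGraph.Subgraph.mem_edgeSet.trans ?_
    rw [SimpleGraph.Subgraph.induce_adj]
    constructor
    · rintro ⟨⟨u, hu, h1⟩, ⟨v, hv, h2⟩, h⟩
      exact ⟨u, hu, v, hv, h1.symm, h2.symm, by rw [h1, h2]; exact h⟩
    · rintro ⟨u, hu, v, hv, h1, h2, h⟩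
      exact ⟨⟨u, hu, h1.symm⟩, ⟨v, hv, h2.symm⟩, by rw [h1, h2]; exact h⟩
  have hunion : R S = (R (S.induce (Subtype.val '' A)) ∪ R (S.induce (Subtype.val '' Aᶜ))) ∪ C := by
    ext e'
    constructor
    · rintro ⟨h1, h2⟩
      have h1' : S.Adj (Q.src e') (Q.tgt e') := h1
      obtain ⟨u, hu⟩ : ∃ u : S.verts, Q.src e' = u := ⟨⟨_, S.edge_vert h1'⟩, rfl⟩
      obtain ⟨v, hv⟩ : ∃ u : S.verts, Q.tgt e' = u := ⟨⟨_, S.edge_vert h1'.symm⟩, rfl⟩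
      rw [hu, hv] at h1'
      by_cases huA : u ∈ A <;> by_cases hvA : v ∈ A
      · exact Or.inl (Or.inl ⟨(hmem _ _).2 ⟨u, huA, v, hvA, hu, hv, h1'⟩, h2⟩)
      · obtain ⟨rfl, rfl⟩ := huniq u huA v hvA h1'
        have : e' = e := hQ.1 ((congrArg₂ _ hu hv).trans he.symm)
        exact Or.inr ⟨this, this ▸ h2⟩
      · obtain ⟨rfl, rfl⟩ := huniq v hvA u huA h1'.symm
        have : e' = e := hQ.1 ((congrArg₂ _ hu hv).trans (Sym2.eq_swap.trans he.symm))
        exact Or.inr ⟨this, this ▸ h2⟩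
      · exact Or.inl (Or.inr ⟨(hmem _ _).2 ⟨u, huA, v, hvA, hu, hv, h1'⟩, h2⟩)
    · have hsub : ∀ B : Set S.verts, R (S.induce (Subtype.val '' B)) ⊆ R S := by
        rintro B e' ⟨h1, h2⟩
        obtain ⟨u, -, v, -, h3, h4, h⟩ := (hmem _ _).1 h1
        refine ⟨?_, h2⟩
        change S.Adj (Q.src e') (Q.tgt e')
        rw [h3, h4]; exact h
      rintro ((h | h) | ⟨rfl, h⟩)
      · exact hsub _ h
      · exact hsub _ h
      · exact ⟨he ▸ hxy, h⟩
  have hnotC : ∀ B : Set S.verts, (x ∉ B ∨ y ∉ B) → e ∉ R (S.induce (Subtype.val '' B)) := by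
    rintro B hB ⟨h1, -⟩
    obtain ⟨u, hu, v, hv, h3, h4, h⟩ := (hmem _ _).1 h1
    have h5 : s((u : V), (v : V)) = s(↑x, ↑y) := (congrArg₂ _ h3 h4).symm.trans he
    rcases Sym2.eq_iff.1 h5 with ⟨h6, h7⟩ | ⟨h6, h7⟩
    · exact hB.elim (fun h => h (Subtype.ext h6 ▸ hu)) fun h => h (Subtype.ext h7 ▸ hv)
    · exact hB.elim (fun h => h (Subtype.ext h7 ▸ hv)) fun h => h (Subtype.ext h6 ▸ hu)
  rw [hR, hR, hR, hunion, Set.ncard_union_eq, Set.ncard_union_eq]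
  · congr 1
    split_ifs with h
    · rw [Set.ncard_eq_one]
      exact ⟨e, Set.ext fun e' => ⟨fun h' => h'.1, fun h' => ⟨h', h⟩⟩⟩
    · rw [Set.ncard_eq_zero]
      exact Set.eq_empty_iff_forall_notMem.2 fun e' h' => h h'.2
  · rw [Set.disjoint_left]
    rintro e' ⟨h1, -⟩ ⟨h2, -⟩
    obtain ⟨u, hu, v, hv, h3, h4, h⟩ := (hmem _ _).1 h1
    obtain ⟨u', hu', v', hv', h3', h4', h'⟩ := (hmem _ _).1 h2
    exact hu' (Subtype.ext (h3'.symm.trans h3) ▸ hu)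
  · rw [Set.disjoint_left]
    rintro e' h1 ⟨rfl, h2⟩
    rcases h1 with h1 | h1
    · exact hnotC A (Or.inr hy) h1
    · exact hnotC Aᶜ (Or.inl fun h => h hx) h1

open Classical in
/-- The direction of the edge between the two pieces of a subgraph, as a sign, changes by the
difference of the signs `(-1) ^ r` of the subgraph and its pieces. -/
theorem IsOrientation.sign_eq [Finite E] (hQ : Q.IsOrientation T) (hQ' : Q'.IsOrientation T)
    (hT : T.IsAcyclic) {S : T.Subgraph} (hS : S.Connected) {A : Set S.verts}
    (hA : ((Q.subCoef S).restrict A).Conn) (hA' : ((Q.subCoef S).restrict Aᶜ).Conn) :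
    (-1 : ℂ) ^ Q.numReversed Q' S * ((if (Q.subCoef S).Closed Aᶜ then 1 else 0) -
      (if (Q.subCoef S).Closed A then 1 else 0)) =
    (-1) ^ Q.numReversed Q' (S.induce (Subtype.val '' A)) *
      (-1) ^ Q.numReversed Q' (S.induce (Subtype.val '' Aᶜ)) *
      ((if (Q'.subCoef S).Closed Aᶜ then 1 else 0) -
        (if (Q'.subCoef S).Closed A then 1 else 0)) := by
  obtain ⟨x, hx, y, hy, hxy, huniq⟩ := hQ.exists_unique_crossing hT hS hA hA'
  obtain ⟨e, he⟩ := hQ.exists_arrow hxy.adj_sub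
  obtain ⟨e', he'⟩ := hQ'.exists_arrow hxy.adj_sub
  have h1 := hQ.closed_iff_of_crossing hx hy huniq hxy he
  have h2 := hQ'.closed_iff_of_crossing hx hy huniq hxy he'
  rw [hQ.numReversed_eq (Q' := Q') hx hy huniq hxy he]
  simp only [h1, h2]
  have hne : (x : V) ≠ y := hxy.adj_sub.ne
  have hrev : (∃ e' : E', Q'.src e' = Q.tgt e ∧ Q'.tgt e' = Q.src e) ↔
      ¬ (Q.src e = x ↔ Q'.src e' = x) := by
    constructor
    · rintro ⟨e'', h3, h4⟩ h
      have h5 : Q'.ends e'' = Q'.ends e' :=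
        (Sym2.eq_iff.2 (Or.inr ⟨h3, h4⟩) : s(_, _) = s(_, _)).trans (he.trans he'.symm)
      obtain rfl := hQ'.1 h5
      rcases Sym2.eq_iff.1 he with ⟨h6, h7⟩ | ⟨h6, h7⟩
      · exact hne ((h.1 h6).symm.trans (h3.trans h7))
      · exact hne ((h.2 (h3.trans h7)).symm.trans h6)
    · intro h
      refine ⟨e', ?_⟩
      rcases Sym2.eq_iff.1 he with ⟨h6, h7⟩ | ⟨h6, h7⟩ <;>
        rcases Sym2.eq_iff.1 he' with ⟨h8, h9⟩ | ⟨h8, h9⟩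
      · exact absurd (iff_of_true h6 h8) h
      · exact ⟨h8.trans h7.symm, h9.trans h6.symm⟩
      · exact ⟨h8.trans h7.symm, h9.trans h6.symm⟩
      · exact absurd (iff_of_false (h6 ▸ hne.symm) (h8 ▸ hne.symm)) h
  simp only [hrev]
  by_cases h3 : Q.src e = x <;> by_cases h4 : Q'.src e' = x <;> simp [h3, h4, pow_succ, pow_add]

end FQuiver

/-! ### The Lie algebra of a tree -/

namespace FQuiver

open F1Rep

variable {V E E' : Type} {T : SimpleGraph V} {Q : FQuiver V E} {Q' : FQuiver V E'}
  [Finite V]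

open Classical in
theorem IsOrientation.ev_cls_thin (hQ : Q.IsOrientation T) (S S' : T.Subgraph)
    (h : (Q.thin S).IsNilpotent) :
    (Hall.cls (Q.thin S) h).ev (Q.subCoef S') = if S' = S then 1 else 0 := by
  rw [Hall.ev_cls]
  refine if_congr ⟨fun ⟨i⟩ => hQ.eq_of_iso (i.trans (Q.subWinding S).coefIso), ?_⟩ rfl rfl
  rintro rfl
  exact ⟨(Q.subWinding S').coefIso.symm⟩

variable [Finite E] [Finite E']

variable (Q T) in
/-- The class of a thin representation, as an element of the Lie algebra. -/
noncomputable def thinCls (hQ : Q.IsOrientation T) (hT : T.IsAcyclic)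
    (S : {S : T.Subgraph // S.Connected}) : hallLie Q :=
  ⟨Hall.cls (Q.thin S.1) (hQ.isNilpotent hT _), hallLie.cls_mem _
    (((hQ.conn_iff S.1).2 S.2).of_iso (Q.subWinding S.1).coefIso.symm)⟩

variable (Q T) in
/-- The classes of the thin representations with connected support form a basis. -/
noncomputable def thinBasis (hQ : Q.IsOrientation T) (hT : T.IsAcyclic) :
    Module.Basis {S : T.Subgraph // S.Connected} ℂ (hallLie Q) :=
  .mk (v := thinCls T Q hQ hT) (by
    have hinj : Function.Injective fun S : {S : T.Subgraph // S.Connected} =>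
        NilIso.mk (Q.thin S.1) (hQ.isNilpotent hT _) := by
      intro S S' h
      obtain ⟨i⟩ := nonempty_iso_iff.1 (NilIso.mk_eq_iff.1 h)
      exact Subtype.ext (hQ.eq_of_iso ((Q.subWinding S.1).coefIso.symm.trans
        (i.trans (Q.subWinding S'.1).coefIso)))
    have h1 := (Finsupp.basisSingleOne (R := ℂ) (ι := NilIso Q)).linearIndependent.comp _ hinj
    have h2 : LinearIndependent ℂ fun S : {S : T.Subgraph // S.Connected} =>
        ((hallLie Q).toSubmodule.subtype (thinCls T Q hQ hT S) : Hall Q) := by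
      rw [Finsupp.coe_basisSingleOne] at h1
      exact h1
    exact LinearIndependent.of_comp _ h2) (by
    intro f _
    refine hallLie.mem_span f _ fun M hM hc _ => ?_
    obtain ⟨S, hS, ⟨i⟩⟩ := hQ.exists_iso_subCoef hT hc
    refine ⟨⟨S, hS⟩, Subtype.ext ?_⟩
    have h : NilIso.mk (Q.thin S) (hQ.isNilpotent hT _) = NilIso.mk M hM :=
      NilIso.mk_eq_iff.2 (nonempty_iso_of_coef ((Q.subWinding S).coefIso.trans i.symm))
    exact congrArg (fun x => (Finsupp.single x 1 : NilIso Q →₀ ℂ)) h)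

theorem thinBasis_apply (hQ : Q.IsOrientation T) (hT : T.IsAcyclic)
    (S : {S : T.Subgraph // S.Connected}) : thinBasis T Q hQ hT S = thinCls T Q hQ hT S :=
  Module.Basis.mk_apply _ _ _

/-- The linear isomorphism reversing arrows, with the sign `(-1) ^ r` on the thin representation
with support `S`. -/
noncomputable def reverseLin (hQ : Q.IsOrientation T) (hQ' : Q'.IsOrientation T)
    (hT : T.IsAcyclic) : hallLie Q ≃ₗ[ℂ] hallLie Q' :=
  (thinBasis T Q hQ hT).equiv ((thinBasis T Q' hQ' hT).unitsSMul
    fun S => (-1) ^ Q.numReversed Q' S.1) (Equiv.refl _)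

theorem reverseLin_thinBasis (hQ : Q.IsOrientation T) (hQ' : Q'.IsOrientation T)
    (hT : T.IsAcyclic) (S : {S : T.Subgraph // S.Connected}) :
    reverseLin hQ hQ' hT (thinBasis T Q hQ hT S) =
      (-1 : ℂ) ^ Q.numReversed Q' S.1 • thinBasis T Q' hQ' hT S := by
  rw [reverseLin, Module.Basis.equiv_apply, Module.Basis.unitsSMul_apply, Equiv.refl_apply,
    Units.smul_def]
  simp

theorem ev_reverseLin (hQ : Q.IsOrientation T) (hQ' : Q'.IsOrientation T)
    (hT : T.IsAcyclic) (f : hallLie Q) (S : T.Subgraph) :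
    (reverseLin hQ hQ' hT f).1.ev (Q'.subCoef S) =
      (-1) ^ Q.numReversed Q' S * f.1.ev (Q.subCoef S) := by
  classical
  have hf : f ∈ Submodule.span ℂ (Set.range (thinBasis T Q hQ hT)) :=
    (thinBasis T Q hQ hT).span_eq ▸ Submodule.mem_top
  induction hf using Submodule.span_induction with
  | mem f hf =>
    obtain ⟨S', rfl⟩ := hf
    rw [reverseLin_thinBasis, thinBasis_apply, thinBasis_apply]
    change ((-1 : ℂ) ^ Q.numReversed Q' S'.1 • Hall.cls (Q'.thin S'.1) _).ev _ =
      _ * (Hall.cls (Q.thin S'.1) _).ev _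
    rw [Hall.ev_smul, hQ.ev_cls_thin, hQ'.ev_cls_thin]
    split_ifs with h
    · rw [h]
    · rw [mul_zero, mul_zero]
  | zero =>
    rw [_root_.map_zero]
    change (0 : Hall Q').ev _ = _ * (0 : Hall Q).ev _
    rw [Hall.ev_zero, Hall.ev_zero, mul_zero]
  | add f g _ _ hf hg =>
    rw [map_add]
    change (_ + _ : Hall Q').ev _ = _ * (_ + _ : Hall Q).ev _
    rw [Hall.ev_add, Hall.ev_add, hf, hg, mul_add]
  | smul c f _ hf =>
    rw [map_smul]
    change (c • _ : Hall Q').ev _ = _ * (c • _ : Hall Q).ev _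
    rw [Hall.ev_smul, Hall.ev_smul, hf, mul_left_comm]

theorem reverseLin_lie (hQ : Q.IsOrientation T) (hQ' : Q'.IsOrientation T)
    (hT : T.IsAcyclic) (f g : hallLie Q) :
    reverseLin hQ hQ' hT ⁅f, g⁆ = ⁅reverseLin hQ hQ' hT f, reverseLin hQ hQ' hT g⁆ := by
  classical
  refine hallLie.ext_conn fun M hM hc => ?_
  obtain ⟨S, hS, ⟨i⟩⟩ := hQ'.exists_iso_subCoef hT hc
  rw [Hall.ev_congr _ i, Hall.ev_congr _ i, ev_reverseLin]
  rw [LieSubalgebra.coe_bracket, LieSubalgebra.coe_bracket]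
  have := Fintype.ofFinite S.verts
  refine mul_left_cancel₀ (two_ne_zero (α := ℂ)) ?_
  rw [mul_left_comm, Hall.two_mul_ev_lie _ _ (hQ.isNilpotent hT _),
    Hall.two_mul_ev_lie _ _ (hQ'.isNilpotent hT _), Finset.mul_sum]
  refine Finset.sum_congr rfl fun A _ => ?_
  have key : ∀ (f : hallLie Q) (B : Set S.verts),
      (reverseLin hQ hQ' hT f).1.ev ((Q'.subCoef S).restrict B) =
        (-1) ^ Q.numReversed Q' (S.induce (Subtype.val '' B)) *
          f.1.ev ((Q.subCoef S).restrict B) := fun f B => by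
    rw [Hall.ev_congr _ (Q'.subCoefRestrict S B), Hall.ev_congr _ (Q.subCoefRestrict S B),
      ev_reverseLin]
  rw [key, key, key, key]
  by_cases hA : ((Q.subCoef S).restrict A).Conn
  · by_cases hA' : ((Q.subCoef S).restrict Aᶜ).Conn
    · rw [← mul_assoc, hQ.sign_eq hQ' hT hS hA hA']
      ring
    · rw [hallLie.ev_eq_zero f.2 hA', hallLie.ev_eq_zero g.2 hA']
      ring
  · rw [hallLie.ev_eq_zero f.2 hA, hallLie.ev_eq_zero g.2 hA]
    ring

/-- Two orientations of a tree have isomorphic Lie algebras. -/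
noncomputable def reverseLie (hQ : Q.IsOrientation T) (hQ' : Q'.IsOrientation T)
    (hT : T.IsAcyclic) : hallLie Q ≃ₗ⁅ℂ⁆ hallLie Q' where
  __ := reverseLin hQ hQ' hT
  map_lie' := reverseLin_lie hQ hQ' hT _ _

end FQuiver

/-! ### Coefficient quivers over a cycle -/

/-- A coefficient quiver over a cycle with `n` vertices, with the directions of the arrows
forgotten: `next x y` says that some arrow over the `k`-th edge joins `x` over `k` to `y` over
`k + 1`, in whatever direction. -/
structure Chain (n : ℕ) (X : Type) where
  deg : X → ZMod n
  next : X → X → Prop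
  deg_next : ∀ {x y}, next x y → deg y = deg x + 1
  right_unique : ∀ {x y z}, next x y → next x z → y = z
  left_unique : ∀ {x y z}, next x z → next y z → x = y

namespace Chain

variable {n : ℕ} {X Y : Type}

/-- An isomorphism of chains. -/
structure Iso (K : Chain n X) (K' : Chain n Y) where
  toEquiv : X ≃ Y
  deg_eq : ∀ x, K'.deg (toEquiv x) = K.deg x
  next_iff : ∀ x y, K'.next (toEquiv x) (toEquiv y) ↔ K.next x y

/-- The full subchain on a subset. -/
def restrict (K : Chain n X) (A : Set X) : Chain n A where
  deg x := K.deg x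
  next x y := K.next x y
  deg_next h := K.deg_next h
  right_unique h h' := Subtype.ext (K.right_unique h h')
  left_unique h h' := Subtype.ext (K.left_unique h h')

/-- Connected chains. -/
def Conn (K : Chain n X) : Prop :=
  Nonempty X ∧ ∀ A : Set X, (∀ x y, K.next x y → (x ∈ A ↔ y ∈ A)) → A = ∅ ∨ A = Set.univ

/-- Chains in which every vertex has both neighbours: the disjoint unions of cycles. -/
def Complete (K : Chain n X) : Prop := (∀ x, ∃ y, K.next x y) ∧ ∀ y, ∃ x, K.next x y

/-- The string with `l` vertices that starts over the vertex `a` of the cycle. -/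
def string (n : ℕ) (a : ZMod n) (l : ℕ) : Chain n (Fin l) where
  deg i := a + (i : ℕ)
  next i j := (i : ℕ) + 1 = j
  deg_next {i j} h := by rw [← h]; push_cast; ring
  right_unique h h' := Fin.ext (h.symm.trans h')
  left_unique h h' := Fin.ext (Nat.succ_injective (h.trans h'.symm))

/-- The cycle that covers the given cycle `d` times. -/
def cycle (n d : ℕ) : Chain n (ZMod (d * n)) where
  deg := CyclicLabelling.red n d
  next x y := y = x + 1
  deg_next h := by rw [h, map_add, map_one]
  right_unique h h' := h.trans h'.symm
  left_unique h h' := add_right_cancel (h.symm.trans h')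

/-- The initial segment of a string. -/
def stringRestrictLE (a : ZMod n) {l p : ℕ} (hp : p < l) :
    Iso ((string n a (l + 1)).restrict {i : Fin (l + 1) | (i : ℕ) ≤ p}) (string n a (p + 1)) where
  toEquiv :=
    { toFun i := ⟨i.1, Nat.lt_succ_of_le i.2⟩
      invFun i := ⟨⟨i, by omega⟩, Nat.le_of_lt_succ i.2⟩
      left_inv _ := rfl
      right_inv _ := rfl }
  deg_eq _ := rfl
  next_iff _ _ := Iff.rfl

/-- The final segment of a string. -/
def stringRestrictGT (a : ZMod n) {l p : ℕ} (hp : p < l) :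
    Iso ((string n a (l + 1)).restrict {i : Fin (l + 1) | p < (i : ℕ)})
      (string n (a + p + 1) (l - 1 - p + 1)) where
  toEquiv :=
    { toFun i := ⟨i.1 - (p + 1), by have h1 : p < (i.1 : ℕ) := i.2; have h2 := i.1.2; omega⟩
      invFun i := ⟨⟨i + (p + 1), by omega⟩, by
        change p < (i : ℕ) + (p + 1)
        omega⟩
      left_inv i := by
        have h1 : p < (i.1 : ℕ) := i.2
        refine Subtype.ext (Fin.ext ?_)
        change (i.1 : ℕ) - (p + 1) + (p + 1) = i.1
        omega
      right_inv i := by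
        refine Fin.ext ?_
        change (i : ℕ) + (p + 1) - (p + 1) = i
        omega }
  deg_eq i := by
    have h1 : p < (i.1 : ℕ) := i.2
    change a + p + 1 + (((i.1 : ℕ) - (p + 1) : ℕ) : ZMod n) = a + ((i.1 : ℕ) : ZMod n)
    rw [Nat.cast_sub h1]
    push_cast
    ring
  next_iff i j := by
    have h1 : p < (i.1 : ℕ) := i.2
    have h2 : p < (j.1 : ℕ) := j.2
    change (i.1 : ℕ) - (p + 1) + 1 = (j.1 : ℕ) - (p + 1) ↔ (i.1 : ℕ) + 1 = j.1
    omega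

theorem conn_string (a : ZMod n) (l : ℕ) : (string n a (l + 1)).Conn := by
  refine ⟨⟨0⟩, fun A hA => ?_⟩
  have key : ∀ i (hi : i < l + 1), (⟨i, hi⟩ : Fin (l + 1)) ∈ A ↔ 0 ∈ A := by
    intro i
    induction i with
    | zero => exact fun _ => Iff.rfl
    | succ i ih => exact fun hi => (hA ⟨i, by omega⟩ ⟨i + 1, hi⟩ rfl).symm.trans (ih _)
  by_cases h0 : 0 ∈ A
  · exact Or.inr (Set.eq_univ_of_forall fun i => (key i i.2).2 h0)
  · exact Or.inl (Set.eq_empty_of_forall_notMem fun i hi => h0 ((key i i.2).1 hi))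

/-- Strings are determined by their length and their starting point. -/
theorem eq_of_string_iso {a b : ZMod n} {l m : ℕ}
    (i : Iso (string n a (l + 1)) (string n b (m + 1))) : a = b ∧ l = m := by
  have hl : l = m := Nat.succ_injective (Fin.equiv_iff_eq.1 ⟨i.toEquiv⟩)
  subst hl
  refine ⟨?_, rfl⟩
  have h0 : i.toEquiv 0 = 0 := by
    by_contra h
    obtain ⟨j, hj⟩ := i.toEquiv.surjective ⟨(i.toEquiv 0 : ℕ) - 1, by omega⟩
    have h1 : (i.toEquiv 0 : ℕ) ≠ 0 := fun h' => h (Fin.ext h')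
    have h2 : (string n b (l + 1)).next (i.toEquiv j) (i.toEquiv 0) := by
      rw [hj]
      change (i.toEquiv 0 : ℕ) - 1 + 1 = i.toEquiv 0
      omega
    have h3 : (j : ℕ) + 1 = 0 := (i.next_iff _ _).1 h2
    omega
  have h1 := i.deg_eq 0
  rw [h0] at h1
  simpa [string] using h1.symm

theorem not_complete_string (a : ZMod n) (l : ℕ) : ¬ (string n a (l + 1)).Complete := by
  rintro ⟨-, h⟩
  obtain ⟨i, hi⟩ := h 0
  exact Nat.succ_ne_zero _ hi

theorem Complete.of_iso {K : Chain n X} {K' : Chain n Y} (i : Iso K K') (h : K.Complete) :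
    K'.Complete := by
  refine ⟨fun x => ?_, fun x => ?_⟩
  · obtain ⟨y, hy⟩ := h.1 (i.toEquiv.symm x)
    refine ⟨i.toEquiv y, ?_⟩
    rwa [← i.next_iff, Equiv.apply_symm_apply] at hy
  · obtain ⟨y, hy⟩ := h.2 (i.toEquiv.symm x)
    refine ⟨i.toEquiv y, ?_⟩
    rwa [← i.next_iff, Equiv.apply_symm_apply] at hy

theorem complete_cycle (n d : ℕ) : (cycle n d).Complete :=
  ⟨fun x => ⟨x + 1, rfl⟩, fun x => ⟨x - 1, (sub_add_cancel x 1).symm⟩⟩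

theorem conn_cycle (n d : ℕ) : (cycle n d).Conn := by
  refine ⟨⟨0⟩, fun A hA => ?_⟩
  have key : ∀ k : ℤ, (k : ZMod (d * n)) ∈ A ↔ 0 ∈ A := by
    intro k
    induction k using Int.induction_on with
    | zero => simp
    | succ k ih =>
      rw [← ih]
      exact (hA _ _ (by change _ = _; push_cast; ring)).symm
    | pred k ih =>
      rw [← ih]
      exact hA _ _ (by change _ = _; push_cast; ring)
  by_cases h0 : 0 ∈ A
  · refine Or.inr (Set.eq_univ_of_forall fun i => ?_)
    obtain ⟨k, rfl⟩ := ZMod.intCast_surjective i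
    exact (key k).2 h0
  · refine Or.inl (Set.eq_empty_of_forall_notMem fun i hi => ?_)
    obtain ⟨k, rfl⟩ := ZMod.intCast_surjective i
    exact h0 ((key k).1 hi)

/-- If a string is cut into two connected pieces, then one is the initial segment. -/
theorem eq_initial_segment (a : ZMod n) (l : ℕ) {A : Set (Fin (l + 1))} (h0 : 0 ∈ A)
    (hA : ((string n a (l + 1)).restrict A).Conn) (hA' : Aᶜ.Nonempty) :
    ∃ p < l, A = {i : Fin (l + 1) | (i : ℕ) ≤ p} := by
  classical
  have hex : ∃ m, ∃ h : m < l + 1, (⟨m, h⟩ : Fin (l + 1)) ∉ A :=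
    hA'.elim fun i hi => ⟨i, i.2, hi⟩
  obtain ⟨hm, hmA⟩ := Nat.find_spec hex
  have hmin := fun i => Nat.find_min hex (m := i)
  set m := Nat.find hex with hmdef
  have hm0 : m ≠ 0 := fun h => by
    have h1 : (⟨m, hm⟩ : Fin (l + 1)) = 0 := Fin.ext h
    exact hmA (h1 ▸ h0)
  have hlt : ∀ i : Fin (l + 1), (i : ℕ) < m → i ∈ A := fun i hi => by
    by_contra h
    exact hmin i hi ⟨i.2, h⟩
  have hgt : ∀ i ∈ A, (i : ℕ) < m := by
    have h1 := hA.2 {i | (i.1 : ℕ) < m} (fun i j hij => by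
      have hij' : (i.1 : ℕ) + 1 = j.1 := hij
      have hj : (j.1 : ℕ) ≠ m := fun h => hmA (by
        have : j.1 = ⟨m, hm⟩ := Fin.ext h
        exact this ▸ j.2)
      change (i.1 : ℕ) < m ↔ (j.1 : ℕ) < m
      omega)
    rcases h1 with h1 | h1
    · exact absurd (Nat.pos_of_ne_zero hm0) (Set.eq_empty_iff_forall_notMem.1 h1 ⟨0, h0⟩)
    · exact fun i hi => Set.eq_univ_iff_forall.1 h1 ⟨i, hi⟩
  refine ⟨m - 1, by omega, Set.ext fun i => ⟨fun hi => ?_, fun hi => ?_⟩⟩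
  · have := hgt i hi
    change (i : ℕ) ≤ m - 1
    omega
  · have hi' : (i : ℕ) ≤ m - 1 := hi
    exact hlt i (by omega)

/-- `K.dist x₀ k x` says that `x` is reached from `x₀` in `k` steps. -/
def dist (K : Chain n X) (x₀ : X) : ℕ → X → Prop
  | 0, x => x = x₀
  | k + 1, y => ∃ x, K.dist x₀ k x ∧ K.next x y

/-- A connected chain one vertex of which has no predecessor is a string. -/
theorem exists_iso_string [Finite X] {K : Chain n X} (hK : K.Conn) {x₀ : X}
    (h0 : ∀ y, ¬ K.next y x₀) :
    ∃ l, Nonempty (Iso K (string n (K.deg x₀) (l + 1))) := by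
  -- The distance from `x₀` identifies the vertices with an initial segment of the naturals.
  have hfun : ∀ k x y, K.dist x₀ k x → K.dist x₀ k y → x = y := by
    intro k
    induction k with
    | zero => exact fun x y h h' => h.trans h'.symm
    | succ k ih =>
      rintro x y ⟨z, hz, hzx⟩ ⟨w, hw, hwy⟩
      obtain rfl := ih _ _ hz hw
      exact K.right_unique hzx hwy
  have hlev : ∀ k j x, K.dist x₀ k x → K.dist x₀ j x → k = j := by
    intro k
    induction k with
    | zero =>
      rintro (_ | j) x h h'
      · rfl
      · obtain ⟨z, -, hz⟩ := h'
        obtain rfl : x = x₀ := h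
        exact absurd hz (h0 z)
    | succ k ih =>
      rintro (_ | j) x ⟨z, hz, hzx⟩ h'
      · obtain rfl : x = x₀ := h'
        exact absurd hzx (h0 z)
      · obtain ⟨w, hw, hwx⟩ := h'
        obtain rfl := K.left_unique hzx hwx
        rw [ih j _ hz hw]
  have hall : ∀ x, ∃ k, K.dist x₀ k x := by
    have h1 := hK.2 {x | ∃ k, K.dist x₀ k x} (fun x y hxy => by
      constructor
      · rintro ⟨k, hk⟩
        exact ⟨k + 1, x, hk, hxy⟩
      · rintro ⟨_ | k, hk⟩
        · obtain rfl : y = x₀ := hk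
          exact absurd hxy (h0 x)
        · obtain ⟨z, hz, hzy⟩ := hk
          obtain rfl := K.left_unique hxy hzy
          exact ⟨k, hz⟩)
    rcases h1 with h1 | h1
    · exact absurd ⟨0, rfl⟩ (Set.eq_empty_iff_forall_notMem.1 h1 x₀)
    · exact Set.eq_univ_iff_forall.1 h1
  choose lev hl using hall
  have hinj : Function.Injective lev := fun x y h => hfun _ _ _ (hl x) (h ▸ hl y)
  have hnext : ∀ x y, lev x + 1 = lev y ↔ K.next x y := by
    intro x y
    constructor
    · intro h
      have h1 := hl y
      rw [← h] at h1
      obtain ⟨z, hz, hzy⟩ := h1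
      exact hfun _ _ _ (hl x) hz ▸ hzy
    · exact fun h => hlev _ _ y ⟨x, hl x, h⟩ (hl y)
  have hdown : ∀ k x, K.dist x₀ k x → ∀ m ≤ k, ∃ y, K.dist x₀ m y := by
    intro k
    induction k with
    | zero => exact fun x h m hm => ⟨x, (Nat.le_zero.1 hm) ▸ h⟩
    | succ k ih =>
      rintro x ⟨z, hz, hzx⟩ m hm
      rcases Nat.lt_or_eq_of_le hm with h | rfl
      · exact ih z hz m (by omega)
      · exact ⟨x, z, hz, hzx⟩
  have hdeg : ∀ k x, K.dist x₀ k x → K.deg x = K.deg x₀ + (k : ℕ) := by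
    intro k
    induction k with
    | zero =>
      rintro x rfl
      simp
    | succ k ih =>
      rintro x ⟨z, hz, hzx⟩
      rw [K.deg_next hzx, ih z hz]
      push_cast
      ring
  have hlt : ∀ x, lev x < Nat.card X := by
    intro x
    choose g hg using fun m : Fin (lev x + 1) => hdown _ _ (hl x) m (Nat.le_of_lt_succ m.2)
    have hgi : Function.Injective g := fun m m' h =>
      Fin.ext (hlev _ _ _ (hg m) (h ▸ hg m'))
    have := Nat.card_le_card_of_injective g hgi
    rw [Nat.card_fin] at this
    omega
  obtain ⟨l, hcard⟩ : ∃ l, Nat.card X = l + 1 := by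
    have := hK.1
    exact Nat.exists_eq_succ_of_ne_zero Nat.card_pos.ne'
  refine ⟨l, ⟨⟨Equiv.ofBijective (fun x => ⟨lev x, hcard ▸ hlt x⟩ : X → Fin (l + 1)) ?_,
    fun x => (hdeg _ _ (hl x)).symm, fun x y => hnext x y⟩⟩⟩
  exact (Nat.bijective_iff_injective_and_card _).2
    ⟨fun x y h => hinj (congrArg Fin.val h), by rw [hcard, Nat.card_fin]⟩

/-- In a finite chain, it is enough that every vertex has a predecessor. -/
theorem complete_of_pred [Finite X] {K : Chain n X} (h : ∀ y, ∃ x, K.next x y) : K.Complete := by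
  refine ⟨fun x => ?_, h⟩
  choose p hp using h
  have hinj : Function.Injective p := fun x y hxy => K.right_unique (hp x) (hxy ▸ hp y)
  obtain ⟨y, rfl⟩ := (Finite.injective_iff_surjective.1 hinj) x
  exact ⟨y, hp y⟩

theorem exists_iso_string_or_complete [Finite X] {K : Chain n X} (hK : K.Conn) :
    (∃ a l, Nonempty (Iso K (string n a (l + 1)))) ∨ K.Complete := by
  by_cases h : ∀ y, ∃ x, K.next x y
  · exact Or.inr (complete_of_pred h)
  · push Not at h
    obtain ⟨x₀, h0⟩ := h
    exact Or.inl ⟨_, exists_iso_string hK h0⟩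

/-- A connected complete chain is a covering of the cycle. -/
theorem exists_iso_cycle [NeZero n] [Finite X] {K : Chain n X} (hK : K.Conn) (hc : K.Complete) :
    ∃ d, d ≠ 0 ∧ Nonempty (Iso (cycle n d) K) := by
  choose f hf using hc.1
  have hinj : Function.Injective f := fun x y hxy => K.left_unique (hf x) (hxy ▸ hf y)
  let s : Equiv.Perm X := Equiv.ofBijective f (Finite.injective_iff_bijective.1 hinj)
  have hs : ∀ x y, K.next x y ↔ y = s x := fun x y =>
    ⟨fun h => K.right_unique h (hf x), fun h => h ▸ hf x⟩
  have hdeg : ∀ (k : ℤ) x, K.deg ((s ^ k) x) = K.deg x + k := by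
    intro k x
    induction k using Int.induction_on with
    | zero => simp
    | succ k ih =>
      rw [add_comm (k : ℤ), zpow_add, zpow_one, Equiv.Perm.mul_apply,
        K.deg_next ((hs _ _).2 rfl), ih]
      push_cast
      ring
    | pred k ih =>
      have h1 : (s ^ (-(k : ℤ))) x = s ((s ^ (-(k : ℤ) - 1)) x) := by
        rw [← Equiv.Perm.mul_apply, ← zpow_one_add]
        congr 2
        ring
      rw [h1, K.deg_next ((hs _ _).2 rfl)] at ih
      have := eq_sub_of_add_eq ih
      rw [this]
      push_cast
      ring
  obtain ⟨x₁⟩ := hK.1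
  obtain ⟨x₀, hx₀⟩ : ∃ x₀, K.deg x₀ = 0 := by
    refine ⟨(s ^ (-((K.deg x₁).val : ℤ))) x₁, ?_⟩
    rw [hdeg]
    simp
  obtain ⟨N, hN, e, he⟩ : ∃ N, N ≠ 0 ∧ ∃ e : ZMod N ≃ X, ∀ k : ℤ, e k = (s ^ k) x₀ := by
    have horb : ∀ x, x ∈ MulAction.orbit (Subgroup.zpowers s) x₀ := by
      have h1 := hK.2 (MulAction.orbit (Subgroup.zpowers s) x₀) (fun x y hxy => by
        rw [hs] at hxy
        subst hxy
        let g : Subgroup.zpowers s := ⟨s, Subgroup.mem_zpowers s⟩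
        refine ⟨fun h => MulAction.mem_orbit_of_mem_orbit g h, fun h => ?_⟩
        have h1 := MulAction.mem_orbit_of_mem_orbit g⁻¹ h
        exact inv_smul_smul g x ▸ h1)
      rcases h1 with h1 | h1
      · exact absurd (MulAction.mem_orbit_self x₀) (Set.eq_empty_iff_forall_notMem.1 h1 x₀)
      · exact Set.eq_univ_iff_forall.1 h1
    refine ⟨_, ?_, (MulAction.orbitZPowersEquiv s x₀).symm.trans (Equiv.subtypeUnivEquiv horb),
      fun k => ?_⟩
    · have := MulAction.minimalPeriod_pos s x₀
      exact NeZero.ne _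
    · rw [Equiv.trans_apply, MulAction.orbitZPowersEquiv_symm_apply']
      rfl
  have hdvd : n ∣ N := by
    have h1 : (s ^ (N : ℤ)) x₀ = x₀ := by
      rw [← he]
      have := he 0
      rw [zpow_zero, Equiv.Perm.one_apply] at this
      rw [← this]
      simp
    have h2 := hdeg N x₀
    rw [h1, hx₀, zero_add] at h2
    rw [← ZMod.natCast_eq_zero_iff]
    exact_mod_cast h2.symm
  obtain ⟨d, rfl⟩ : ∃ d, N = d * n := hdvd.imp fun d h => h.trans (mul_comm _ _)
  refine ⟨d, left_ne_zero_of_mul hN, ⟨⟨e, fun z => ?_, fun z w => ?_⟩⟩⟩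
  · obtain ⟨k, rfl⟩ := ZMod.intCast_surjective z
    rw [he, hdeg, hx₀, zero_add]
    exact (map_intCast (CyclicLabelling.red n d) k).symm
  · obtain ⟨k, rfl⟩ := ZMod.intCast_surjective z
    have h1 : s (e k) = e ((k : ZMod (d * n)) + 1) := by
      have h2 := he (k + 1)
      rw [Int.cast_add, Int.cast_one, add_comm k 1, zpow_add, zpow_one,
        Equiv.Perm.mul_apply, ← he] at h2
      exact h2.symm
    rw [hs, h1, e.injective.eq_iff]
    rfl

end Chain

/-! ### Representations of cyclic quivers -/

namespace CyclicLabelling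

open F1Rep

variable {V E : Type} {Q : FQuiver V E} {n : ℕ} {X Y : Type} (c : CyclicLabelling Q n)

/-- The coefficient quiver over `Q` with underlying chain `K`. -/
def coef (K : Chain n X) : Coef Q X where
  pos x := c.vert (K.deg x)
  arr e x y := (c.Forward (c.edge.symm e) ∧ K.deg x = c.edge.symm e ∧ K.next x y) ∨
    (¬ c.Forward (c.edge.symm e) ∧ K.deg y = c.edge.symm e ∧ K.next y x)
  pos_src {e x y} := by
    rintro (⟨h1, h2, h3⟩ | ⟨h1, h2, h3⟩)
    · rw [h2, ← h1.1, Equiv.apply_symm_apply]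
    · rw [K.deg_next h3, h2, ← (c.backward_of_not_forward h1).1, Equiv.apply_symm_apply]
  pos_tgt {e x y} := by
    rintro (⟨h1, h2, h3⟩ | ⟨h1, h2, h3⟩)
    · rw [K.deg_next h3, h2, ← h1.2, Equiv.apply_symm_apply]
    · rw [h2, ← (c.backward_of_not_forward h1).2, Equiv.apply_symm_apply]
  right_unique := by
    rintro e x y z (⟨h1, h2, h3⟩ | ⟨h1, h2, h3⟩) (⟨h4, h5, h6⟩ | ⟨h4, h5, h6⟩)
    · exact K.right_unique h3 h6
    · exact absurd h1 h4
    · exact absurd h4 h1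
    · exact K.left_unique h3 h6
  left_unique := by
    rintro e x y z (⟨h1, h2, h3⟩ | ⟨h1, h2, h3⟩) (⟨h4, h5, h6⟩ | ⟨h4, h5, h6⟩)
    · exact K.left_unique h3 h6
    · exact absurd h1 h4
    · exact absurd h4 h1
    · exact K.right_unique h3 h6

theorem next_iff (K : Chain n X) (x y : X) : K.next x y ↔
    (c.Forward (K.deg x) ∧ (c.coef K).arr (c.edge (K.deg x)) x y) ∨
      (¬ c.Forward (K.deg x) ∧ (c.coef K).arr (c.edge (K.deg x)) y x) := by
  by_cases h : c.Forward (K.deg x) <;> simp [coef, h]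

/-- The underlying chain of a coefficient quiver. -/
def chain (D : Coef Q X) : Chain n X where
  deg x := c.vert.symm (D.pos x)
  next x y := (c.Forward (c.vert.symm (D.pos x)) ∧ D.arr (c.edge (c.vert.symm (D.pos x))) x y) ∨
    (¬ c.Forward (c.vert.symm (D.pos x)) ∧ D.arr (c.edge (c.vert.symm (D.pos x))) y x)
  deg_next {x y} := by
    rw [Equiv.symm_apply_eq]
    rintro (⟨h1, h2⟩ | ⟨h1, h2⟩)
    · rw [D.pos_tgt h2]; exact h1.2
    · rw [D.pos_src h2]; exact (c.backward_of_not_forward h1).1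
  right_unique := by
    rintro x y z (⟨h1, h2⟩ | ⟨h1, h2⟩) (⟨h3, h4⟩ | ⟨h3, h4⟩)
    · exact D.right_unique h2 h4
    · exact absurd h1 h3
    · exact absurd h3 h1
    · exact D.left_unique h2 h4
  left_unique {x y z} h h' := by
    have hdeg : ∀ {x}, ((c.Forward (c.vert.symm (D.pos x)) ∧
        D.arr (c.edge (c.vert.symm (D.pos x))) x z) ∨ (¬ c.Forward (c.vert.symm (D.pos x)) ∧
        D.arr (c.edge (c.vert.symm (D.pos x))) z x)) →
        c.vert.symm (D.pos z) = c.vert.symm (D.pos x) + 1 := by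
      intro x
      rw [Equiv.symm_apply_eq]
      rintro (⟨h1, h2⟩ | ⟨h1, h2⟩)
      · rw [D.pos_tgt h2]; exact h1.2
      · rw [D.pos_src h2]; exact (c.backward_of_not_forward h1).1
    have hxy : c.vert.symm (D.pos x) = c.vert.symm (D.pos y) :=
      add_right_cancel ((hdeg h).symm.trans (hdeg h'))
    rw [hxy] at h
    rcases h with ⟨h1, h2⟩ | ⟨h1, h2⟩ <;> rcases h' with ⟨h3, h4⟩ | ⟨h3, h4⟩
    · exact D.left_unique h2 h4
    · exact absurd h1 h3
    · exact absurd h3 h1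
    · exact D.right_unique h2 h4

/-- Every coefficient quiver over a cycle comes from a chain. -/
def coefChainIso (D : Coef Q X) : (c.coef (c.chain D)).Iso D :=
  .ofEquiv (Equiv.refl X) (fun x => (c.vert.apply_symm_apply _).symm) <| by
    intro e x y hx hy
    change D.arr e x y ↔ (_ ∧ c.vert.symm (D.pos x) = _ ∧ (_ ∨ _)) ∨
      (_ ∧ c.vert.symm (D.pos y) = _ ∧ (_ ∨ _))
    obtain ⟨k, rfl⟩ := c.edge.surjective e
    rw [Equiv.symm_apply_apply]
    change c.vert (c.vert.symm (D.pos x)) = _ at hx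
    change c.vert (c.vert.symm (D.pos y)) = _ at hy
    by_cases h : c.Forward k
    · rw [h.1, c.vert.injective.eq_iff] at hx
      simp only [hx, h, true_and, not_true_eq_false, false_and, or_false]
    · rw [(c.backward_of_not_forward h).2, c.vert.injective.eq_iff] at hy
      simp only [hy, h, true_and, not_false_eq_true, false_and, false_or]

/-- Isomorphic chains have isomorphic coefficient quivers. -/
def coefIso {K : Chain n X} {K' : Chain n Y} (i : K.Iso K') : (c.coef K).Iso (c.coef K') where
  toEquiv := i.toEquiv
  pos_eq x := congrArg c.vert (i.deg_eq x)
  arr_iff e x y := by simp only [coef, i.deg_eq, i.next_iff]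

/-- Chains with isomorphic coefficient quivers are isomorphic. -/
def chainIso {K : Chain n X} {K' : Chain n Y} (i : (c.coef K).Iso (c.coef K')) : K.Iso K' where
  toEquiv := i.toEquiv
  deg_eq x := c.vert.injective (i.pos_eq x)
  next_iff x y := by
    have h : K'.deg (i.toEquiv x) = K.deg x := c.vert.injective (i.pos_eq x)
    rw [c.next_iff, c.next_iff, i.arr_iff, i.arr_iff, h]

theorem conn_coef_iff (K : Chain n X) : (c.coef K).Conn ↔ K.Conn := by
  refine and_congr_right fun _ => forall_congr' fun A => imp_congr_left ?_
  constructor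
  · intro h x y hxy
    rcases (c.next_iff K x y).1 hxy with h' | h'
    · exact h _ _ _ h'.2
    · exact (h _ _ _ h'.2).symm
  · rintro h e x y (h' | h')
    · exact h _ _ h'.2.2
    · exact (h _ _ h'.2.2).symm

/-- The coefficient quiver of a band representation. -/
noncomputable def coverCoefIso (d : ℕ) : (c.coverWinding d).coef.Iso (c.coef (.cycle n d)) where
  toEquiv := Equiv.refl _
  pos_eq _ := rfl
  arr_iff e x y := by
    obtain ⟨k, rfl⟩ := c.edge.surjective e
    change _ ↔ ∃ a, c.edge (red n d a) = c.edge k ∧ (c.cover d).src a = x ∧ (c.cover d).tgt a = y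
    simp only [c.edge.injective.eq_iff, coef, Equiv.symm_apply_apply, Equiv.refl_apply, cover,
      Chain.cycle]
    by_cases h : c.Forward k
    · simp only [h, true_and, not_true_eq_false, false_and, or_false]
      constructor
      · rintro ⟨h1, h2⟩
        exact ⟨x, h1, by rw [if_pos (h1 ▸ h)], by rw [if_pos (h1 ▸ h), h2]⟩
      · rintro ⟨a, rfl, h1, h2⟩
        rw [if_pos h] at h1 h2
        subst h1
        exact ⟨rfl, h2.symm⟩
    · simp only [h, false_and, not_false_eq_true, true_and, false_or]
      constructor
      · rintro ⟨h1, h2⟩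
        exact ⟨y, h1, by rw [if_neg (h1 ▸ h), h2], by rw [if_neg (h1 ▸ h)]⟩
      · rintro ⟨a, rfl, h1, h2⟩
        rw [if_neg h] at h1 h2
        subst h2
        exact ⟨rfl, h1.symm⟩

/-! ### Nilpotency over cyclic quivers -/

/-- An oriented path runs around the cycle without changing its direction. -/
theorem path_cases {u w : V} {k : ℕ} (p : Q.Path u w k) :
    (∃ a : ZMod n, w = c.vert (a + k) ∧ ∀ i < k, c.Forward (a + i)) ∨
      ∃ a : ZMod n, w = c.vert a ∧ ∀ i < k, ¬ c.Forward (a + i) := by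
  induction p with
  | nil => exact Or.inr ⟨c.vert.symm u, (c.vert.apply_symm_apply _).symm, by simp⟩
  | @cons k e p ih =>
    obtain ⟨j, rfl⟩ := c.edge.surjective e
    by_cases hj : c.Forward j
    · left
      rcases ih with ⟨a, h1, h2⟩ | ⟨a, h1, h2⟩
      · obtain rfl : j = a + k := c.vert.injective (hj.1.symm.trans h1)
        refine ⟨a, by rw [hj.2]; push_cast; ring_nf, fun i hi => ?_⟩
        rcases Nat.lt_succ_iff_lt_or_eq.1 hi with h | rfl
        · exact h2 i h
        · exact hj
      · obtain rfl : j = a := c.vert.injective (hj.1.symm.trans h1)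
        obtain rfl : k = 0 := by
          by_contra h
          exact h2 0 (Nat.pos_of_ne_zero h) (by simpa using hj)
        exact ⟨j, by rw [hj.2]; simp, fun i hi => by
          obtain rfl : i = 0 := by omega
          simpa using hj⟩
    · right
      have hb := c.backward_of_not_forward hj
      rcases ih with ⟨a, h1, h2⟩ | ⟨a, h1, h2⟩
      · have h3 : j + 1 = a + k := c.vert.injective (hb.1.symm.trans h1)
        obtain rfl : k = 0 := by
          by_contra h
          obtain ⟨m, rfl⟩ := Nat.exists_eq_succ_of_ne_zero h
          have h4 : j = a + m := by
            push_cast at h3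
            exact add_right_cancel (h3.trans (add_assoc _ _ _).symm)
          exact hj (h4 ▸ h2 m (Nat.lt_succ_self m))
        exact ⟨j, hb.2, fun i hi => by
          obtain rfl : i = 0 := by omega
          simpa using hj⟩
      · have h3 : j + 1 = a := c.vert.injective (hb.1.symm.trans h1)
        refine ⟨j, hb.2, fun i hi => ?_⟩
        rcases i with _ | i
        · simpa using hj
        · have := h2 i (by omega)
          rw [← h3] at this
          push_cast
          rwa [add_comm (i : ZMod n) 1, ← add_assoc]

theorem forall_of_forall_lt [NeZero n] {p : ZMod n → Prop} {k : ℕ} (hk : n ≤ k) (a : ZMod n)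
    (h : ∀ i < k, p (a + (i : ℕ))) (b : ZMod n) : p b := by
  have h1 := h (b - a).val ((ZMod.val_lt _).trans_le hk)
  rwa [ZMod.natCast_zmod_val, add_sub_cancel] at h1

variable {c} in
/-- Without a common direction there are no long paths. -/
theorem isNilpotent_of_not_equioriented [NeZero n] (h : ¬ c.Equioriented) (M : F1Rep Q) :
    M.IsNilpotent := by
  refine ⟨n, fun k hk u w p => ?_⟩
  refine absurd ?_ h
  rcases c.path_cases p with ⟨a, -, h2⟩ | ⟨a, -, h2⟩
  · exact Or.inl (forall_of_forall_lt hk a h2)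
  · exact Or.inr fun b => c.backward_of_not_forward
      (forall_of_forall_lt (p := fun b => ¬ c.Forward b) hk a h2 b)

variable {c} in
/-- For `n = 1` an arrow is forward and backward at the same time; `Forward` is preferred. -/
theorem Equioriented.cases (h : c.Equioriented) :
    (∀ k, c.Forward k) ∨ ∀ k, ¬ c.Forward k := by
  by_cases h1 : ∃ k, c.Forward k
  · left
    obtain ⟨k, hk⟩ := h1
    rcases h with h | h
    · exact h
    · intro j
      have h2 : k = k + 1 := c.vert.injective (hk.1.symm.trans (h k).1)
      have h3 : (1 : ZMod n) = 0 := left_eq_add.1 h2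
      have h4 : j = k := by
        rw [← mul_one j, ← mul_one k, h3, mul_zero, mul_zero]
      exact h4 ▸ hk
  · exact Or.inr (not_exists.1 h1)

end CyclicLabelling

namespace F1Rep

variable {V E : Type} {Q : FQuiver V E}

/-- A representation is nilpotent if there is a rank function that increases along the arrows of
its coefficient quiver. -/
theorem isNilpotent_of_rank [Finite V] {M : F1Rep Q} (r : M.El → ℕ)
    (hr : ∀ e p q, M.coef.arr e p q → r p < r q) : M.IsNilpotent := by
  obtain ⟨B, hB⟩ := (Set.finite_range r).bddAbove
  have key : ∀ {k : ℕ} {u w : V} (p : Q.Path u w k) (x : M.X u) (hx : M.act p x ≠ M.zero w),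
      k ≤ r (El.mk M _ hx) := by
    intro k u w p x
    induction p with
    | nil => exact fun _ => Nat.zero_le _
    | cons e p ih =>
      intro hx
      have h0 : M.act p x ≠ M.zero _ := fun h => hx (by rw [act, h, M.map_zero])
      exact (ih h0).trans_lt (hr e (El.mk M _ h0) (El.mk M _ hx) (M.coef_arr_mk.2 rfl))
  refine ⟨B + 1, fun k hk u w p x => ?_⟩
  by_contra hx
  have h1 := key p x hx
  have h2 : r (El.mk M _ hx) ≤ B := hB ⟨_, rfl⟩
  omega

/-- A nonzero representation is not nilpotent if an arrow starts at each vertex of its coefficient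
quiver. -/
theorem not_isNilpotent_of_forall_exists_arr {M : F1Rep Q} (hM : Nonempty M.El)
    (h : ∀ p, ∃ e q, M.coef.arr e p q) : ¬ M.IsNilpotent := by
  rintro ⟨N, hN⟩
  obtain ⟨⟨⟨u, x⟩, hx⟩⟩ := hM
  have key : ∀ k, ∃ w, ∃ p : Q.Path u w k, M.act p x ≠ M.zero w := by
    intro k
    induction k with
    | zero => exact ⟨u, .nil u, hx⟩
    | succ k ih =>
      obtain ⟨w, p, hp⟩ := ih
      obtain ⟨e, q, hq⟩ := h (El.mk M _ hp)
      obtain rfl : w = Q.src e := M.coef.pos_src hq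
      obtain ⟨⟨v, y⟩, hy⟩ := q
      obtain rfl : v = Q.tgt e := M.coef.pos_tgt hq
      have h1 : M.map e (M.act p x) = y := M.coef_arr_mk.1 hq
      exact ⟨_, .cons e p, fun h => hy (h1.symm.trans h)⟩
  obtain ⟨w, p, hp⟩ := key N
  exact hp (hN N le_rfl u w p x)

end F1Rep

namespace CyclicLabelling

open F1Rep

variable {V E : Type} {Q : FQuiver V E} {n : ℕ} {X Y : Type} (c : CyclicLabelling Q n)

theorem isNilpotent_string [NeZero n] [Finite V] (a : ZMod n) (l : ℕ) :
    (c.coef (.string n a l)).rep.IsNilpotent := by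
  by_cases h : c.Equioriented
  · let i := (c.coef (.string n a l)).repCoefIso
    rcases h.cases with h | h
    · refine isNilpotent_of_rank (fun p => (i.toEquiv p : ℕ)) fun e p q hpq => ?_
      rcases (i.arr_iff e p q).2 hpq with ⟨-, -, h1⟩ | ⟨h1, -⟩
      · have h2 : (i.toEquiv p : ℕ) + 1 = i.toEquiv q := h1
        omega
      · exact absurd (h _) h1
    · refine isNilpotent_of_rank (fun p => l - 1 - (i.toEquiv p : ℕ)) fun e p q hpq => ?_
      rcases (i.arr_iff e p q).2 hpq with ⟨h1, -⟩ | ⟨-, -, h1⟩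
      · exact absurd h1 (h _)
      · have h2 : (i.toEquiv q : ℕ) + 1 = i.toEquiv p := h1
        have h3 := (i.toEquiv p).2
        change l - 1 - (i.toEquiv p : ℕ) < l - 1 - (i.toEquiv q : ℕ)
        omega
  · exact isNilpotent_of_not_equioriented h _

variable {c} in
theorem Equioriented.not_isNilpotent [NeZero n] (h : c.Equioriented) {M : F1Rep Q}
    {K : Chain n X} (i : M.coef.Iso (c.coef K)) (hX : Nonempty X) (hK : K.Complete) :
    ¬ M.IsNilpotent := by
  refine not_isNilpotent_of_forall_exists_arr (hX.map i.toEquiv.symm) fun p => ?_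
  suffices ∃ e y, (c.coef K).arr e (i.toEquiv p) y by
    obtain ⟨e, y, hy⟩ := this
    exact ⟨e, i.toEquiv.symm y, (i.arr_iff _ _ _).1 (by rwa [Equiv.apply_symm_apply])⟩
  rcases h.cases with h | h
  · obtain ⟨y, hy⟩ := hK.1 (i.toEquiv p)
    exact ⟨c.edge (K.deg (i.toEquiv p)), y, Or.inl ⟨h _, (c.edge.symm_apply_apply _).symm, hy⟩⟩
  · obtain ⟨y, hy⟩ := hK.2 (i.toEquiv p)
    exact ⟨c.edge (K.deg y), y, Or.inr ⟨h _, (c.edge.symm_apply_apply _).symm, hy⟩⟩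

/-! ### The bracket evaluated at strings -/

open Classical in
/-- The direction of the `k`-th arrow, as a sign. The loop for `n = 1` has sign `1`. -/
noncomputable def eps (k : ZMod n) : ℂ := if c.Forward k then 1 else -1

theorem eps_mul_self (k : ZMod n) : c.eps k * c.eps k = 1 := by
  unfold eps
  split_ifs <;> ring

/-- The initial segment of a string is a subrepresentation if the arrow at the cut points into it. -/
theorem closed_initial_iff (a : ZMod n) {l p : ℕ} (hp : p < l) :
    (c.coef (.string n a (l + 1))).Closed {i : Fin (l + 1) | (i : ℕ) ≤ p} ↔
      ¬ c.Forward (a + p) := by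
  constructor
  · intro h h'
    have h1 := h (c.edge (a + p)) ⟨p, by omega⟩ ⟨p + 1, by omega⟩
      (Or.inl ⟨by rwa [Equiv.symm_apply_apply], by rw [Equiv.symm_apply_apply]; rfl, rfl⟩)
      (le_refl p)
    exact absurd h1 (Nat.not_succ_le_self p)
  · rintro h e x y (⟨h1, h2, h3⟩ | ⟨-, -, h3⟩) hx
    · have hx' : (x : ℕ) ≤ p := hx
      have h3' : (x : ℕ) + 1 = y := h3
      change (y : ℕ) ≤ p
      by_contra hy
      have hxp : (x : ℕ) = p := by omega
      rw [← h2] at h1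
      change c.Forward (a + (x : ℕ)) at h1
      exact h (hxp ▸ h1)
    · have hx' : (x : ℕ) ≤ p := hx
      have h3' : (y : ℕ) + 1 = x := h3
      change (y : ℕ) ≤ p
      omega

theorem closed_final_iff (a : ZMod n) {l p : ℕ} (hp : p < l) :
    (c.coef (.string n a (l + 1))).Closed {i : Fin (l + 1) | p < (i : ℕ)} ↔
      c.Forward (a + p) := by
  constructor
  · intro h
    by_contra h'
    have h1 := h (c.edge (a + p)) ⟨p + 1, by omega⟩ ⟨p, by omega⟩
      (Or.inr ⟨by rwa [Equiv.symm_apply_apply], by rw [Equiv.symm_apply_apply]; rfl, rfl⟩)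
      (Nat.lt_succ_self p)
    exact absurd h1 (lt_irrefl p)
  · rintro h e x y (⟨-, -, h3⟩ | ⟨h1, h2, h3⟩) hx
    · have hx' : p < (x : ℕ) := hx
      have h3' : (x : ℕ) + 1 = y := h3
      change p < (y : ℕ)
      omega
    · have hx' : p < (x : ℕ) := hx
      have h3' : (y : ℕ) + 1 = x := h3
      change p < (y : ℕ)
      by_contra hy
      have hxp : (y : ℕ) = p := by omega
      rw [← h2] at h1
      change ¬ c.Forward (a + (y : ℕ)) at h1
      exact h1 (hxp ▸ h)

variable [NeZero n] [Finite V] [Finite E]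

/-- The value at the string with `l + 1` vertices that starts at `a`. -/
noncomputable def evString (f : Hall Q) (a : ZMod n) (l : ℕ) : ℂ :=
  f.ev (c.coef (.string n a (l + 1)))

/-- The bracket at a string: it can be cut at each of its arrows, and the direction of the arrow
decides which piece is the subrepresentation. -/
theorem evString_lie {f g : Hall Q} (hf : f ∈ hallLie Q) (hg : g ∈ hallLie Q) (a : ZMod n)
    (l : ℕ) : c.evString ⁅f, g⁆ a l = ∑ p ∈ Finset.range l, c.eps (a + p) *
      (c.evString f a p * c.evString g (a + p + 1) (l - 1 - p) -
        c.evString g a p * c.evString f (a + p + 1) (l - 1 - p)) := by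
  classical
  set D := c.coef (.string n a (l + 1)) with hD
  let lo : ℕ → Set (Fin (l + 1)) := fun p => {i | (i : ℕ) ≤ p}
  let hi : ℕ → Set (Fin (l + 1)) := fun p => {i | p < (i : ℕ)}
  have hlo : ∀ p, (lo p)ᶜ = hi p := fun p => by ext; simp [lo, hi]
  have hhi : ∀ p, (hi p)ᶜ = lo p := fun p => by ext; simp [lo, hi]
  let t : Set (Fin (l + 1)) → ℂ := fun A => if D.Closed A then
      f.ev (D.restrict Aᶜ) * g.ev (D.restrict A) - g.ev (D.restrict Aᶜ) * f.ev (D.restrict A)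
        else 0
  have h1 : c.evString ⁅f, g⁆ a l = ∑ A, t A := Hall.ev_lie f g (c.isNilpotent_string a (l + 1))
  have hevlo : ∀ (f : Hall Q) p, p < l → f.ev (D.restrict (lo p)) = c.evString f a p :=
    fun f p hp => f.ev_congr (c.coefIso (Chain.stringRestrictLE a hp))
  have hevhi : ∀ (f : Hall Q) p, p < l →
      f.ev (D.restrict (hi p)) = c.evString f (a + p + 1) (l - 1 - p) :=
    fun f p hp => f.ev_congr (c.coefIso (Chain.stringRestrictGT a hp))
  -- Primitive elements see only cuts into connected pieces, that is, into two segments.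
  have ht0 : ∀ A, (∀ p < l, A ≠ lo p ∧ A ≠ hi p) → t A = 0 := by
    intro A hA
    have hnc : ¬ (D.restrict A).Conn ∨ ¬ (D.restrict Aᶜ).Conn := by
      by_contra! h
      have h2 : ∀ B, (D.restrict B).Conn → ((Chain.string n a (l + 1)).restrict B).Conn :=
        fun B hB => (c.conn_coef_iff _).1 hB
      by_cases h0 : 0 ∈ A
      · obtain ⟨p, hp, h3⟩ := Chain.eq_initial_segment a l h0 (h2 _ h.1)
          (Set.nonempty_coe_sort.1 h.2.1)
        exact (hA p hp).1 h3
      · obtain ⟨p, hp, h3⟩ := Chain.eq_initial_segment a l (A := Aᶜ) h0 (h2 _ h.2)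
          (by rw [compl_compl]; exact Set.nonempty_coe_sort.1 h.1.1)
        exact (hA p hp).2 (by rw [← hlo p, ← compl_compl A, h3])
    have h2 : f.ev (D.restrict Aᶜ) * g.ev (D.restrict A) -
        g.ev (D.restrict Aᶜ) * f.ev (D.restrict A) = 0 := by
      rcases hnc with h | h
      · rw [hallLie.ev_eq_zero hf h, hallLie.ev_eq_zero hg h]; ring
      · rw [hallLie.ev_eq_zero hf h, hallLie.ev_eq_zero hg h]; ring
    simp only [t, h2, ite_self]
  let S : ℕ × Bool → Set (Fin (l + 1)) := fun s => if s.2 then hi s.1 else lo s.1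
  have h2 : ∑ s ∈ Finset.range l ×ˢ Finset.univ, t (S s) = ∑ A, t A := by
    refine Finset.sum_of_injOn S ?_ (fun _ _ => Finset.mem_coe.2 (Finset.mem_univ _)) ?_
      (fun _ _ => rfl)
    · have hmono : ∀ p q, p < l → q < l → lo p = lo q → p ≤ q := fun p q hp hq h => by
        have h3 : (⟨p, by omega⟩ : Fin (l + 1)) ∈ lo p := le_refl p
        rw [h] at h3
        exact h3
      have hne : ∀ p q, lo p ≠ hi q := fun p q h => by
        have h3 : (0 : Fin (l + 1)) ∈ lo p := Nat.zero_le p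
        rw [h] at h3
        exact absurd h3 (Nat.not_lt_zero q)
      rintro ⟨p, b⟩ hp ⟨q, b'⟩ hq h
      have hp' : p < l := Finset.mem_range.1 (Finset.mem_product.1 (Finset.mem_coe.1 hp)).1
      have hq' : q < l := Finset.mem_range.1 (Finset.mem_product.1 (Finset.mem_coe.1 hq)).1
      cases b <;> cases b' <;> simp only [S, if_true, Bool.false_eq_true, if_false] at h
      · rw [le_antisymm (hmono _ _ hp' hq' h) (hmono _ _ hq' hp' h.symm)]
      · exact absurd h (hne _ _)
      · exact absurd h.symm (hne _ _)
      · rw [← hlo, ← hlo, compl_inj_iff] at h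
        rw [le_antisymm (hmono _ _ hp' hq' h) (hmono _ _ hq' hp' h.symm)]
    · intro A _ hA
      refine ht0 A fun p hp => ⟨fun h => hA ⟨(p, false), ?_, h.symm⟩, fun h =>
        hA ⟨(p, true), ?_, h.symm⟩⟩ <;> simp [hp]
  rw [h1, ← h2, Finset.sum_product]
  refine Finset.sum_congr rfl fun p hp => ?_
  have hp' := Finset.mem_range.1 hp
  rw [Fintype.sum_bool]
  change t (hi p) + t (lo p) = _
  have hev : ∀ (f : Hall Q) {A B}, A = B → f.ev (D.restrict A) = f.ev (D.restrict B) := by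
    rintro f A _ rfl
    rfl
  simp only [t, hev _ (hlo p), hev _ (hhi p), hevlo _ p hp', hevhi _ p hp']
  have e1 : D.Closed (lo p) ↔ ¬ c.Forward (a + p) := c.closed_initial_iff a hp'
  have e2 : D.Closed (hi p) ↔ c.Forward (a + p) := c.closed_final_iff a hp'
  simp only [e1, e2, eps]
  split_ifs <;> ring

end CyclicLabelling

/-! ### Matrix units of the positive part of the affine Lie algebra -/

namespace AffineGl

open LieAlgebra LieAlgebra.LoopAlgebra Matrix

attribute [local instance 100] LieRing.ofAssociativeRing

variable {n : ℕ}

/-- `x ↦ x t^m` as a linear map. -/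
noncomputable def monLin (n : ℕ) (m : ℤ) : Gl n →ₗ[ℂ] Affine n where
  toFun x := mon x m
  map_add' x y := by
    rw [mon, mon, mon, ← of_add, Prod.mk_add_mk, add_zero, TensorProduct.tmul_add]
  map_smul' r x := by
    rw [mon, mon, RingHom.id_apply, ← of_smul, Prod.smul_mk, smul_zero, TensorProduct.tmul_smul]

theorem monLin_apply (x : Gl n) (m : ℤ) : monLin n m x = mon x m := rfl

/-- The matrix coefficient of `t^m` at position `(i, j)`. -/
noncomputable def coeff (m : ℤ) (i j : Fin n) : Affine n →ₗ[ℂ] ℂ where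
  toFun x := (toFinsupp ℂ ℤ (Gl n) ((ofProd _).symm x).1) m i j
  map_add' x y := by simp
  map_smul' r x := by simp

theorem coeff_mon (x : Gl n) (m m' : ℤ) (i j : Fin n) :
    coeff m i j (mon x m') = if m' = m then x i j else 0 := by
  change (toFinsupp ℂ ℤ (Gl n) (AddMonoidAlgebra.single m' 1 ⊗ₜ[ℂ] x)) m i j = _
  rw [toFinsupp_single_tmul, Finsupp.single_apply]
  split_ifs <;> rfl

/-- There is no central term in degrees `p, q ≥ 0`. -/
theorem lie_mon_mon_of_nonneg (x y : Gl n) (p q : ℕ) :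
    ⁅mon x p, mon y q⁆ = mon (x * y) ((p + q : ℕ) : ℤ) - mon (y * x) ((p + q : ℕ) : ℤ) := by
  have h0 : (if (p : ℤ) = -(q : ℤ) then (((q : ℤ) : ℂ)) * (x * y).trace else 0) = 0 := by
    split_ifs with h
    · have : q = 0 := by omega
      simp [this]
    · rfl
  rw [lie_mon_mon, h0, zero_smul, add_zero, LieRing.of_associative_ring_bracket,
    ← monLin_apply, ← monLin_apply, ← monLin_apply, _root_.map_sub]
  push_cast
  rfl

/-- Concatenation of strings. -/
noncomputable def conv (n : ℕ) :
    (ZMod n × ℕ →₀ ℂ) →ₗ[ℂ] (ZMod n × ℕ →₀ ℂ) →ₗ[ℂ] (ZMod n × ℕ →₀ ℂ) :=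
  Finsupp.linearCombination ℂ fun s => Finsupp.linearCombination ℂ fun t =>
    if t.1 = s.1 + s.2 + 1 then Finsupp.single (s.1, s.2 + t.2 + 1) 1 else 0

theorem conv_single (n : ℕ) (s t : ZMod n × ℕ) (x y : ℂ) :
    conv n (Finsupp.single s x) (Finsupp.single t y) =
      if t.1 = s.1 + s.2 + 1 then Finsupp.single (s.1, s.2 + t.2 + 1) (x * y) else 0 := by
  rw [conv, Finsupp.linearCombination_single, LinearMap.smul_apply,
    Finsupp.linearCombination_single]
  split_ifs <;> simp

theorem conv_apply (F G : ZMod n × ℕ →₀ ℂ) (a : ZMod n) (l : ℕ) :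
    conv n F G (a, l) = ∑ p ∈ Finset.range l, F (a, p) * G (a + p + 1, l - 1 - p) := by
  induction F using Finsupp.induction_linear with
  | zero => simp
  | add F F' hF hF' =>
    rw [_root_.map_add, LinearMap.add_apply, Finsupp.add_apply, hF, hF', ← Finset.sum_add_distrib]
    exact Finset.sum_congr rfl fun p _ => by rw [Finsupp.add_apply, add_mul]
  | single s x =>
    induction G using Finsupp.induction_linear with
    | zero => simp
    | add G G' hG hG' =>
      rw [_root_.map_add, Finsupp.add_apply, hG, hG', ← Finset.sum_add_distrib]
      exact Finset.sum_congr rfl fun p _ => by rw [Finsupp.add_apply, mul_add]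
    | single t y =>
      obtain ⟨b, p⟩ := s
      obtain ⟨d, q⟩ := t
      rw [conv_single]
      by_cases h : b = a ∧ p < l ∧ d = a + p + 1 ∧ q = l - 1 - p
      · obtain ⟨rfl, h1, rfl, rfl⟩ := h
        rw [Finset.sum_eq_single_of_mem p (Finset.mem_range.2 h1)]
        · have : p + (l - 1 - p) + 1 = l := by omega
          simp [this]
        · intro p' _ hp'
          rw [Finsupp.single_eq_of_ne, zero_mul]
          exact fun h => hp' (congrArg Prod.snd h)
      · rw [Finset.sum_eq_zero]
        · split_ifs with h1
          · rw [Finsupp.single_eq_of_ne]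
            intro h2
            obtain ⟨h3, h4⟩ := Prod.mk.inj h2
            simp only at h1 h3 h4
            exact h ⟨h3.symm, by omega, by rw [h1, h3], by omega⟩
          · rfl
        · intro p' hp'
          have hp'' := Finset.mem_range.1 hp'
          simp only [Finsupp.single_apply, Prod.mk.injEq, mul_ite, ite_mul, zero_mul, mul_zero]
          split_ifs with h1 h2
          · obtain ⟨rfl, rfl⟩ := h2
            exact absurd ⟨rfl, hp'', h1⟩ h
          · rfl
          · rfl

section NonzeroPeriod

variable [NeZero n]

/-- An element of `ℤ / n` as a matrix index. -/
def idx (a : ZMod n) : Fin n := ⟨a.val, ZMod.val_lt a⟩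

theorem idx_injective : Function.Injective (idx (n := n)) := fun _ _ h =>
  ZMod.val_injective n (congrArg Fin.val h)

/-- The matrix unit attached to the string with `l + 1` vertices that starts at `a`: in terms of
periodic `ℤ × ℤ` matrices it is the unit at position `(a, a + l + 1)`, so the power of `t` is the number
of multiples of `n` among `a + 1, …, a + l + 1`. -/
noncomputable def stringMon (a : ZMod n) (l : ℕ) : Affine n :=
  mon (Matrix.single (idx a) (idx (a + (l : ZMod n) + 1)) 1) (((a.val + (l + 1)) / n : ℕ) : ℤ)

theorem val_add_succ (a : ZMod n) (l : ℕ) : (a + l + 1).val = (a.val + (l + 1)) % n := by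
  rw [← ZMod.val_natCast]
  push_cast
  rw [ZMod.natCast_zmod_val, add_assoc]

/-- Products of matrix units over `ℂ[t]` correspond to concatenations of strings. -/
theorem single_mul_single_stringMon (a b : ZMod n) (l m : ℕ) :
    mon (Matrix.single (idx a) (idx (a + (l : ZMod n) + 1)) 1 * Matrix.single (idx b) (idx (b + (m : ZMod n) + 1)) 1)
      (((a.val + (l + 1)) / n + (b.val + (m + 1)) / n : ℕ) : ℤ) =
    if b = a + l + 1 then stringMon a (l + m + 1) else 0 := by
  split_ifs with h
  · subst h
    have h1 : a + l + 1 + m + 1 = a + ((l + m + 1 : ℕ) : ZMod n) + 1 := by push_cast; ring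
    have h2 : (a.val + (l + 1)) / n + ((a + l + 1).val + (m + 1)) / n =
        (a.val + (l + m + 1 + 1)) / n := by
      have h3 : a.val + (l + m + 1 + 1) =
          ((a.val + (l + 1)) % n + (m + 1)) + n * ((a.val + (l + 1)) / n) := by
        have := Nat.mod_add_div (a.val + (l + 1)) n
        omega
      rw [val_add_succ, h3, Nat.add_mul_div_left _ _ (NeZero.pos n), add_comm]
    rw [Matrix.single_mul_single_same, mul_one, h1, h2, stringMon]
  · rw [Matrix.single_mul_single_of_ne _ _ _ _ fun h' => h (idx_injective h').symm,
      ← monLin_apply, _root_.map_zero]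

theorem lie_stringMon (a b : ZMod n) (l m : ℕ) : ⁅stringMon a l, stringMon b m⁆ =
    (if b = a + l + 1 then stringMon a (l + m + 1) else 0) -
      (if a = b + m + 1 then stringMon b (m + l + 1) else 0) := by
  rw [← single_mul_single_stringMon, ← single_mul_single_stringMon, stringMon, stringMon,
    lie_mon_mon_of_nonneg, add_comm ((b.val + (m + 1)) / n)]

theorem stringMon_mem_posGen (a : ZMod n) (l : ℕ) : stringMon a l ∈ posGen n := by
  refine ⟨_, _, rfl, fun h i j hij => Matrix.single_apply_of_ne _ _ _ _ _ ?_⟩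
  rintro ⟨rfl, rfl⟩
  have h1 : (a + l + 1).val ≤ a.val := hij
  rw [val_add_succ] at h1
  have := Nat.mod_add_div (a.val + (l + 1)) n
  rw [h] at this
  omega

/-- Every matrix unit in the positive part comes from a string. -/
theorem exists_stringMon (i j : Fin n) (m : ℕ) (h : m = 0 → i < j) :
    ∃ a l, stringMon a l = mon (Matrix.single i j 1) m := by
  have hi : ((i : ℕ) : ZMod n).val = i := by rw [ZMod.val_natCast, Nat.mod_eq_of_lt i.2]
  obtain ⟨l, hl⟩ : ∃ l, (i : ℕ) + (l + 1) = j + n * m := by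
    refine ⟨j + n * m - i - 1, ?_⟩
    have h1 := i.2
    have h2 := j.2
    rcases Nat.eq_zero_or_pos m with h3 | h3
    · have h4 : (i : ℕ) < j := h h3
      omega
    · have h4 : n * 1 ≤ n * m := Nat.mul_le_mul_left n h3
      omega
  refine ⟨(i : ℕ), l, ?_⟩
  have e1 : idx ((i : ℕ) : ZMod n) = i := Fin.ext hi
  have e2 : idx (((i : ℕ) : ZMod n) + (l : ZMod n) + 1) = j := by
    refine Fin.ext ?_
    change ZMod.val _ = _
    rw [val_add_succ, hi, hl, Nat.add_mul_mod_self_left, Nat.mod_eq_of_lt j.2]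
  rw [stringMon, e1, e2, hi, hl, Nat.add_mul_div_left _ _ (NeZero.pos n),
    Nat.div_eq_of_lt j.2, zero_add]

/-- The linear map that sends strings to matrix units. -/
noncomputable def ofStrings (n : ℕ) [NeZero n] : (ZMod n × ℕ →₀ ℂ) →ₗ[ℂ] Affine n :=
  Finsupp.linearCombination ℂ fun s => stringMon s.1 s.2

theorem ofStrings_single (s : ZMod n × ℕ) (x : ℂ) :
    ofStrings n (Finsupp.single s x) = x • stringMon s.1 s.2 :=
  Finsupp.linearCombination_single _ _ _

/-- Different strings give different matrix units. -/
theorem coeff_ofStrings (F : ZMod n × ℕ →₀ ℂ) (a : ZMod n) (l : ℕ) :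
    coeff (((a.val + (l + 1)) / n : ℕ) : ℤ) (idx a) (idx (a + (l : ZMod n) + 1)) (ofStrings n F) =
      F (a, l) := by
  induction F using Finsupp.induction_linear with
  | zero => simp
  | add F G hF hG => rw [_root_.map_add, _root_.map_add, hF, hG, Finsupp.add_apply]
  | single s x =>
    obtain ⟨b, m⟩ := s
    rw [ofStrings_single, _root_.map_smul, stringMon, coeff_mon, smul_eq_mul, Finsupp.single_apply,
      Matrix.single_apply]
    by_cases h : (b, m) = (a, l)
    · cases h
      simp
    · rw [if_neg h]
      split_ifs with h1 h2
      · refine absurd ?_ h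
        dsimp only at h1 h2
        obtain rfl := idx_injective h2.1
        have h3 := congrArg Fin.val h2.2
        change ZMod.val _ = ZMod.val _ at h3
        rw [val_add_succ, val_add_succ] at h3
        have h4 := Nat.mod_add_div (b.val + (m + 1)) n
        have h5 := Nat.mod_add_div (b.val + (l + 1)) n
        rw [Nat.cast_inj.1 h1, h3] at h4
        have h6 : m = l := by omega
        rw [h6]
      · exact mul_zero x
      · exact mul_zero x

theorem ofStrings_injective : Function.Injective (ofStrings n) := by
  refine (injective_iff_map_eq_zero _).2 fun F hF => Finsupp.ext fun s => ?_
  rw [← coeff_ofStrings F s.1 s.2, hF, _root_.map_zero]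
  rfl

theorem lie_ofStrings (F G : ZMod n × ℕ →₀ ℂ) :
    ⁅ofStrings n F, ofStrings n G⁆ = ofStrings n (conv n F G - conv n G F) := by
  induction F using Finsupp.induction_linear with
  | zero => simp
  | add F F' hF hF' =>
    rw [_root_.map_add, add_lie, hF, hF', ← _root_.map_add]
    congr 1
    simp only [_root_.map_add, LinearMap.add_apply]
    abel
  | single s x =>
    induction G using Finsupp.induction_linear with
    | zero => simp
    | add G G' hG hG' =>
      rw [_root_.map_add, lie_add, hG, hG', ← _root_.map_add]
      congr 1
      simp only [_root_.map_add, LinearMap.add_apply]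
      abel
    | single t y =>
      rw [ofStrings_single, ofStrings_single, smul_lie, lie_smul, lie_stringMon, _root_.map_sub,
        conv_single, conv_single, smul_sub, smul_sub]
      congr 1
      · split_ifs
        · rw [ofStrings_single, smul_smul]
        · simp
      · split_ifs
        · rw [ofStrings_single, smul_smul, mul_comm]
        · simp

end NonzeroPeriod

end AffineGl

/-! ### The Lie algebra of a cyclic quiver -/

namespace CyclicLabelling

open F1Rep AffineGl

variable {V E : Type} {Q : FQuiver V E} {n : ℕ} (c : CyclicLabelling Q n)

/-- The product of the directions of the arrows of the string with `l + 1` vertices that starts at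
`a`, as a sign. -/
noncomputable def sgn (a : ZMod n) (l : ℕ) : ℂ := ∏ i ∈ Finset.range l, c.eps (a + (i : ZMod n))

theorem sgn_mul_self (a : ZMod n) (l : ℕ) : c.sgn a l * c.sgn a l = 1 := by
  rw [sgn, ← Finset.prod_mul_distrib]
  exact Finset.prod_eq_one fun i _ => c.eps_mul_self _

theorem sgn_ne_zero (a : ZMod n) (l : ℕ) : c.sgn a l ≠ 0 :=
  left_ne_zero_of_mul (b := c.sgn a l) (by rw [sgn_mul_self]; exact one_ne_zero)

/-- Cutting a string at one of its arrows. -/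
theorem sgn_mul_eps (a : ZMod n) {l p : ℕ} (hp : p < l) :
    c.sgn a l * c.eps (a + (p : ZMod n)) =
      c.sgn a p * c.sgn (a + (p : ZMod n) + 1) (l - 1 - p) := by
  obtain ⟨q, rfl⟩ : ∃ q, l = p + (q + 1) := ⟨l - 1 - p, by omega⟩
  have h1 : p + (q + 1) - 1 - p = q := by omega
  have h2 : ∀ i : ℕ, a + ((p + (i + 1) : ℕ) : ZMod n) = a + (p : ZMod n) + 1 + (i : ZMod n) :=
    fun i => by push_cast; ring
  rw [h1, sgn, Finset.prod_range_add, Finset.prod_range_succ', add_zero]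
  simp only [h2]
  rw [mul_assoc, mul_assoc, eps_mul_self, mul_one]
  rfl

/-- A union of cycles in a connected coefficient quiver is everything. -/
theorem eq_univ_of_complete {X : Type} {D : Coef Q X} (hD : D.Conn) {A : Set X}
    (h1 : (c.chain (D.restrict A)).Conn) (h2 : (c.chain (D.restrict A)).Complete) :
    A = Set.univ := by
  have hnext : ∀ x y : A, (c.chain (D.restrict A)).next x y ↔ (c.chain D).next x y :=
    fun _ _ => Iff.rfl
  have hD' := (c.conn_coef_iff _).1 ((Coef.conn_iff_of_iso (c.coefChainIso D)).2 hD)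
  refine (hD'.2 A fun x y hxy => ⟨fun hx => ?_, fun hy => ?_⟩).resolve_left ?_
  · obtain ⟨z, hz⟩ := h2.1 ⟨x, hx⟩
    exact (c.chain D).right_unique ((hnext _ _).1 hz) hxy ▸ z.2
  · obtain ⟨z, hz⟩ := h2.2 ⟨y, hy⟩
    exact (c.chain D).left_unique ((hnext _ _).1 hz) hxy ▸ z.2
  · obtain ⟨x⟩ := h1.1
    exact Set.nonempty_iff_ne_empty.1 ⟨x.1, x.2⟩

variable [NeZero n] [Finite V]

/-- The isomorphism class of the string with `l + 1` vertices that starts at `a`. -/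
noncomputable def stringIsoClass (s : ZMod n × ℕ) : NilIso Q :=
  .mk (c.coef (.string n s.1 (s.2 + 1))).rep (c.isNilpotent_string s.1 (s.2 + 1))

theorem stringIsoClass_injective : Function.Injective c.stringIsoClass := by
  rintro ⟨a, l⟩ ⟨b, m⟩ h
  obtain ⟨i⟩ := nonempty_iso_iff.1 (NilIso.mk_eq_iff.1 h)
  obtain ⟨rfl, rfl⟩ := Chain.eq_of_string_iso
    (c.chainIso ((Coef.repCoefIso _).symm.trans (i.trans (Coef.repCoefIso _))))
  rfl

theorem evString_eq_apply (f : Hall Q) (s : ZMod n × ℕ) :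
    c.evString f s.1 s.2 = f (c.stringIsoClass s) :=
  dif_pos (c.isNilpotent_string s.1 (s.2 + 1))

/-- The values of an element of the Hall algebra at the strings, up to sign. -/
noncomputable def strings : Hall Q →ₗ[ℂ] (ZMod n × ℕ →₀ ℂ) where
  toFun f := Finsupp.ofSupportFinite (fun s => c.sgn s.1 s.2 * c.evString f s.1 s.2) <| by
    refine ((Finsupp.hasFiniteSupport (f : NilIso Q →₀ ℂ)).preimage
      c.stringIsoClass_injective.injOn).subset fun s hs => ?_
    have h := right_ne_zero_of_mul hs
    rwa [c.evString_eq_apply f s] at h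
  map_add' f g := Finsupp.ext fun s =>
    (congrArg (c.sgn s.1 s.2 * ·) (f.ev_add g _)).trans (mul_add _ _ _)
  map_smul' r f := Finsupp.ext fun s =>
    (congrArg (c.sgn s.1 s.2 * ·) (f.ev_smul r _)).trans (mul_left_comm _ _ _)

theorem strings_apply (f : Hall Q) (a : ZMod n) (l : ℕ) :
    c.strings f (a, l) = c.sgn a l * c.evString f a l := rfl

variable [Finite E]

theorem strings_lie {f g : Hall Q} (hf : f ∈ hallLie Q) (hg : g ∈ hallLie Q) :
    c.strings ⁅f, g⁆ = conv n (c.strings f) (c.strings g) - conv n (c.strings g) (c.strings f) := by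
  ext ⟨a, l⟩
  rw [Finsupp.sub_apply, conv_apply, conv_apply, ← Finset.sum_sub_distrib, strings_apply,
    c.evString_lie hf hg, Finset.mul_sum]
  refine Finset.sum_congr rfl fun p hp => ?_
  simp only [strings_apply]
  rw [← mul_assoc, c.sgn_mul_eps a (Finset.mem_range.1 hp)]
  ring

/-- The homomorphism to the affine Lie algebra that sends the string from `a` to `b` to the
matrix unit at position `(a, b + 1)` of periodic matrices, up to sign. -/
noncomputable def toAffine : hallLie Q →ₗ⁅ℂ⁆ Affine n where
  __ := ofStrings n ∘ₗ c.strings ∘ₗ (hallLie Q).toSubmodule.subtype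
  map_lie' {f g} :=
    (congrArg (ofStrings n) (c.strings_lie f.2 g.2)).trans (lie_ofStrings _ _).symm

theorem toAffine_apply (f : hallLie Q) : c.toAffine f = ofStrings n (c.strings f) := rfl

/-- The class of a string. -/
noncomputable def stringCls (a : ZMod n) (l : ℕ) : hallLie Q :=
  ⟨Hall.cls _ (c.isNilpotent_string a (l + 1)), hallLie.cls_mem _ <|
    (Coef.conn_iff_of_iso (Coef.repCoefIso _)).2 ((c.conn_coef_iff _).2 (Chain.conn_string a l))⟩

theorem toAffine_stringCls (a : ZMod n) (l : ℕ) :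
    c.toAffine (c.stringCls a l) = c.sgn a l • stringMon a l := by
  have h : c.strings (c.stringCls a l : Hall Q) = Finsupp.single (a, l) (c.sgn a l) := by
    classical
    ext ⟨b, m⟩
    rw [strings_apply, evString, stringCls, Hall.ev_cls, Finsupp.single_apply]
    by_cases h : (a, l) = (b, m)
    · cases h
      rw [if_pos ⟨(Coef.repCoefIso _).symm⟩, if_pos rfl, mul_one]
    · rw [if_neg h, if_neg, mul_zero]
      rintro ⟨i⟩
      obtain ⟨rfl, rfl⟩ := Chain.eq_of_string_iso (c.chainIso (i.trans (Coef.repCoefIso _)))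
      exact h rfl
  rw [toAffine_apply, h, ofStrings_single]

theorem range_toAffine : c.toAffine.range = aPlus n := by
  apply le_antisymm
  · rintro _ ⟨f, rfl⟩
    refine Submodule.sum_mem _ fun s _ => Submodule.smul_mem _ _ (Submodule.subset_span ?_)
    exact stringMon_mem_posGen _ _
  · have key : ∀ a l, stringMon a l ∈ c.toAffine.range := fun a l => by
      refine ⟨c.sgn a l • c.stringCls a l, ?_⟩
      change c.toAffine _ = _
      rw [map_smul, toAffine_stringCls, smul_smul, sgn_mul_self, one_smul]
    refine (Submodule.span_le (p := c.toAffine.range.toSubmodule)).2 ?_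
    rintro _ ⟨x, m, rfl, hx⟩
    change mon x m ∈ c.toAffine.range.toSubmodule
    rw [← monLin_apply, Matrix.matrix_eq_sum_single x, map_sum]
    refine Submodule.sum_mem _ fun i _ => ?_
    rw [map_sum]
    refine Submodule.sum_mem _ fun j _ => ?_
    by_cases h : m = 0 ∧ j ≤ i
    · rw [hx h.1 i j h.2, Matrix.single_zero, _root_.map_zero]
      exact Submodule.zero_mem _
    · obtain ⟨a, l, hal⟩ := exists_stringMon i j m fun hm => not_le.1 fun h' => h ⟨hm, h'⟩
      have h1 : Matrix.single i j (x i j) = x i j • Matrix.single i j (1 : ℂ) := by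
        rw [Matrix.smul_single, smul_eq_mul, mul_one]
      rw [h1, map_smul, monLin_apply, ← hal]
      exact Submodule.smul_mem _ _ (key a l)

theorem mem_ker_toAffine {f : hallLie Q} :
    f ∈ c.toAffine.ker ↔ ∀ a l, c.evString f a l = 0 := by
  rw [LieHom.mem_ker, toAffine_apply, map_eq_zero_iff _ ofStrings_injective, DFunLike.ext_iff,
    Prod.forall]
  exact forall₂_congr fun a l => mul_eq_zero.trans (or_iff_right (c.sgn_ne_zero a l))

variable {c} in
/-- Elements of the kernel vanish at strings, hence are supported on unions of cycles. -/
theorem complete_of_ev_ne_zero {f : hallLie Q} (hf : f ∈ c.toAffine.ker) {X : Type} [Finite X]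
    {D : Coef Q X} (h : f.1.ev D ≠ 0) : (c.chain D).Conn ∧ (c.chain D).Complete := by
  have hD : (c.chain D).Conn := by
    rw [← c.conn_coef_iff, Coef.conn_iff_of_iso (c.coefChainIso D)]
    by_contra h'
    exact h (hallLie.ev_eq_zero f.2 h')
  refine ⟨hD, (Chain.exists_iso_string_or_complete hD).resolve_left ?_⟩
  rintro ⟨a, l, ⟨i⟩⟩
  exact h ((f.1.ev_congr ((c.coefChainIso D).symm.trans (c.coefIso i))).trans
    (c.mem_ker_toAffine.1 hf a l))

variable {c} in
/-- Coverings of an oriented cycle are not nilpotent, so only strings remain. -/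
theorem Equioriented.ker_toAffine (h : c.Equioriented) : c.toAffine.ker = ⊥ := by
  refine (LieSubmodule.eq_bot_iff _).2 fun f hf => hallLie.ext_conn fun M hM hc => ?_
  refine Eq.trans ?_ (Hall.ev_zero _).symm
  by_contra h0
  exact h.not_isNilpotent (c.coefChainIso M.coef).symm hc.1 (complete_of_ev_ne_zero hf h0).2 hM

theorem cls_band_mem (d : ℕ) [NeZero d] (h : (c.band d).IsNilpotent) :
    Hall.cls (c.band d) h ∈ hallLie Q := by
  have : NeZero (d * n) := ⟨mul_ne_zero (NeZero.ne d) (NeZero.ne n)⟩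
  refine hallLie.cls_mem h ?_
  exact (Coef.conn_iff_of_iso ((c.coverWinding d).coefIso.trans (c.coverCoefIso d))).2
    ((c.conn_coef_iff _).2 (Chain.conn_cycle n d))

variable {c} in
/-- If bands are nilpotent, then they span the kernel. -/
theorem ker_toAffine_eq_span (h : ¬ c.Equioriented) :
    c.toAffine.ker.toSubmodule = Submodule.span ℂ c.bandClasses := by
  apply le_antisymm
  · intro f hf
    refine hallLie.mem_span f _ fun M hM hc h0 => ?_
    rw [Hall.apply_mk f.1 hM (.refl _)] at h0
    obtain ⟨h1, h2⟩ := complete_of_ev_ne_zero hf h0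
    obtain ⟨d, hd, ⟨i⟩⟩ := Chain.exists_iso_cycle h1 h2
    have : NeZero d := ⟨hd⟩
    have : NeZero (d * n) := ⟨mul_ne_zero hd (NeZero.ne n)⟩
    refine ⟨d, ‹_›, isNilpotent_of_not_equioriented h _, ?_⟩
    refine congrArg (fun x => (Finsupp.single x 1 : NilIso Q →₀ ℂ)) (NilIso.mk_eq_iff.2 ?_)
    exact nonempty_iso_of_coef ((c.coefChainIso _).symm.trans ((c.coefIso i).symm.trans
      ((c.coverCoefIso d).symm.trans (c.coverWinding d).coefIso.symm)))
  · refine Submodule.span_le.2 ?_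
    rintro f ⟨d, _, hd, hf⟩
    have : NeZero (d * n) := ⟨mul_ne_zero (NeZero.ne d) (NeZero.ne n)⟩
    refine c.mem_ker_toAffine.2 fun a l => ?_
    classical
    rw [evString, hf, Hall.ev_cls, if_neg]
    rintro ⟨i⟩
    have j := ((c.coverWinding d).coefIso.trans (c.coverCoefIso d)).symm.trans i.symm
    exact Chain.not_complete_string a l ((Chain.complete_cycle n d).of_iso (c.chainIso j))

/-- The kernel is central, since unions of cycles do not occur as proper pieces of cuts. -/
theorem ker_toAffine_le_center : c.toAffine.ker ≤ LieAlgebra.center ℂ (hallLie Q) := by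
  classical
  intro f hf
  refine (LieModule.mem_maxTrivSubmodule _ _ _ f).2 fun g => ?_
  refine hallLie.ext_conn fun M hM hc => ?_
  have : Fintype M.El := Fintype.ofFinite _
  have hM' : M.coef.rep.IsNilpotent := hM.of_iso (nonempty_iso_rep (.refl _))
  -- Where `f` does not vanish, the complementary piece is empty.
  have key : ∀ A : Set M.El, f.1.ev (M.coef.restrict A) * g.1.ev (M.coef.restrict Aᶜ) = 0 := by
    intro A
    by_cases h : f.1.ev (M.coef.restrict A) = 0
    · rw [h, zero_mul]
    · obtain ⟨h1, h2⟩ := complete_of_ev_ne_zero hf h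
      obtain rfl := c.eq_univ_of_complete hc h1 h2
      rw [hallLie.ev_eq_zero g.2, mul_zero]
      rintro ⟨⟨x⟩, -⟩
      exact x.2 (Set.mem_univ _)
  refine Eq.trans (Hall.ev_lie g.1 f.1 hM') (Eq.trans ?_ (Hall.ev_zero _).symm)
  refine Finset.sum_eq_zero fun A _ => ?_
  have h1 := key Aᶜ
  rw [compl_compl] at h1
  rw [mul_comm, key A, h1, sub_zero, ite_self]

/-- The quotient by the kernel is the positive part of the affine Lie algebra. -/
noncomputable def quotKerEquiv : (hallLie Q ⧸ c.toAffine.ker) ≃ₗ⁅ℂ⁆ aPlus n :=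
  c.toAffine.quotKerEquivRange.trans
    (LieEquiv.ofEq _ _ (congrArg (fun L : LieSubalgebra ℂ (Affine n) => (L : Set (Affine n)))
      c.range_toAffine))

variable {c} in
/-- The homomorphism for an equioriented cycle is injective with the same range, so it can be
inverted on the range of any other one. -/
theorem Equioriented.exists_surjective {V' E' : Type} [Finite V'] [Finite E'] {Q' : FQuiver V' E'}
    {c' : CyclicLabelling Q' n} (h : c'.Equioriented) :
    ∃ π : hallLie Q →ₗ⁅ℂ⁆ hallLie Q', Function.Surjective π ∧ π.ker = c.toAffine.ker := by
  have hinj : Function.Injective c'.toAffine := (LieHom.ker_eq_bot _).1 h.ker_toAffine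
  let e : hallLie Q' ≃ₗ⁅ℂ⁆ c.toAffine.range := (LieEquiv.ofInjective c'.toAffine hinj).trans
    (LieEquiv.ofEq _ _ (congrArg (fun L : LieSubalgebra ℂ (Affine n) => (L : Set (Affine n)))
      (c'.range_toAffine.trans c.range_toAffine.symm)))
  refine ⟨e.symm.toLieHom.comp c.toAffine.rangeRestrict,
    e.symm.surjective.comp c.toAffine.surjective_rangeRestrict, ?_⟩
  ext f
  rw [LieHom.mem_ker, LieHom.mem_ker]
  refine (map_eq_zero_iff e.symm e.symm.injective).trans ?_
  exact Subtype.ext_iff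

end CyclicLabelling

theorem theoremF :
    (∀ (V E E' : Type) [Finite V] [Finite E] [Finite E'] (T : SimpleGraph V)
      (Q : FQuiver V E) (Q' : FQuiver V E'),
      T.IsTree → Q.IsOrientation T → Q'.IsOrientation T →
      ∃ (b : Module.Basis {S : T.Subgraph // S.Connected} ℂ (hallLie Q))
        (b' : Module.Basis {S : T.Subgraph // S.Connected} ℂ (hallLie Q'))
        (φ : hallLie Q ≃ₗ⁅ℂ⁆ hallLie Q'),
        (∀ S, ∃ h : (Q.thin S.1).IsNilpotent, (b S : Hall Q) = Hall.cls (Q.thin S.1) h) ∧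
        (∀ S, ∃ h : (Q'.thin S.1).IsNilpotent, (b' S : Hall Q') = Hall.cls (Q'.thin S.1) h) ∧
        ∀ S, φ (b S) = (-1 : ℂ) ^ Q.numReversed Q' S.1 • b' S) ∧
    (∀ (n : ℕ) [NeZero n] (V E : Type) [Finite V] [Finite E] (Q : FQuiver V E)
      (c : CyclicLabelling Q n),
      ∃ Z : LieIdeal ℂ (hallLie Q),
        (c.Equioriented → Z = ⊥) ∧
        (¬ c.Equioriented →
          (∀ (d : ℕ) [NeZero d], ∃ h : (c.band d).IsNilpotent,
            Hall.cls (c.band d) h ∈ hallLie Q) ∧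
          Z.toSubmodule = Submodule.span ℂ c.bandClasses) ∧
        Z ≤ LieAlgebra.center ℂ (hallLie Q) ∧
        Nonempty ((hallLie Q ⧸ Z) ≃ₗ⁅ℂ⁆ AffineGl.aPlus n) ∧
        ∀ (V' E' : Type) [Finite V'] [Finite E'] (Q' : FQuiver V' E')
          (c' : CyclicLabelling Q' n), c'.Equioriented →
          ∃ π : hallLie Q →ₗ⁅ℂ⁆ hallLie Q', Function.Surjective π ∧ π.ker = Z) := by
  refine ⟨fun V E E' _ _ _ T Q Q' hT hQ hQ' => ?_, fun n _ V E _ _ Q c => ?_⟩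
  · refine ⟨FQuiver.thinBasis T Q hQ hT.isAcyclic, FQuiver.thinBasis T Q' hQ' hT.isAcyclic,
      FQuiver.reverseLie hQ hQ' hT.isAcyclic, fun S => ⟨hQ.isNilpotent hT.isAcyclic _, ?_⟩,
      fun S => ⟨hQ'.isNilpotent hT.isAcyclic _, ?_⟩,
      fun S => FQuiver.reverseLin_thinBasis hQ hQ' hT.isAcyclic S⟩
    · rw [FQuiver.thinBasis_apply]
      rfl
    · rw [FQuiver.thinBasis_apply]
      rfl
  · exact ⟨c.toAffine.ker, fun h => h.ker_toAffine,
      fun h => ⟨fun d _ => ⟨CyclicLabelling.isNilpotent_of_not_equioriented h _,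
        c.cls_band_mem d _⟩, CyclicLabelling.ker_toAffine_eq_span h⟩,
      c.ker_toAffine_le_center, ⟨c.quotKerEquiv⟩, fun V' E' _ _ Q' c' h => h.exists_surjective⟩
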